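/- Let $G$ be a group with a finite symmetrized presentation $\mathcal P=\langle A\mid R\rangle$: the finite generating set $A$ is closed under inversion, no $a\in A$ represents the identity $\epsilon$, and $R$ is a finite set of nonempty words over $A$, closed under inversion and cyclic conjugation, that contains the nontrivial freely reduced representative of each of its elements. Let $X$ be the Cayley 2-complex, $X^1$ its 1-skeleton and $E(X)$ its set of undirected edges. For words, $v=_Gw$ means that $v,w$ represent the same element of $G$. A van Kampen diagram $\Delta$ for a word $w=_G\epsilon$ is a finite planar contractible 2-complex with edges labelled in $A$ and 2-cells with boundary labels in $R$, whose boundary path, read counterclockwise from a base vertex $*$, has label $w$; $\pi_\Delta:\Delta\to X$ is the canonical label-preserving cellular map with $\pi_\Delta(*)=\epsilon$. Let $\mathbb N[\frac14]=\{n/4 : n\in\mathbb N\}$. The coarse distance $\tilde d(p)=\tilde d_X(\epsilon,p)\in\mathbb N[\frac14]$ of a point $p\in X$ is the path metric distance from $\epsilon$ in $X^1$ if $p$ is a vertex; it is $\frac12$ plus the minimum of the values at the end points if $p$ is interior to an edge; it is $-\frac14$ plus the maximum of the values on the interiors of the boundary edges if $p$ is interior to a 2-cell. For nondecreasing $f:\mathbb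 N[\frac14]\to\mathbb N[\frac14]$, a map $\alpha:Z\times[0,1]\to\Delta$ is extrinsically $f$-tame if $\tilde d(\pi_\Delta(\alpha(p,s)))\le f(\tilde d(\pi_\Delta(\alpha(p,t))))$ for all $p\in Z$ and $0\le s<t\le1$. * A van Kampen homotopy of $\Delta$ is a continuous $\psi:\partial\Delta\times[0,1]\to\Delta$ with $\psi(p,0)=*$, $\psi(p,1)=p$, $\psi(*,t)=*$, and $\psi(p,t)\in\Delta^1$ for every vertex $p$ of $\partial\Delta$ and all $t$. * Let $n$ be the length of the boundary word of $\Delta$, let $C_n$ be the unit circle subdivided into $n$ edges with $(-1,0)$ as a vertex, and let $\vartheta_\Delta:C_n\to\partial\Delta$ wrap $C_n$ once counterclockwise along the boundary path, $(-1,0)\mapsto *$. A disk homotopy is a continuous $\varphi:C_n\times[0,1]\to\Delta$ with $\varphi(p,0)=*$, $\varphi(p,1)=\vartheta_\Delta(p)$, $\varphi((-1,0),t)=*$, and $\varphi(p,t)\in\Delta^1$ for every vertex $p$ of $C_n$ and all $t$. * If $\Delta$ has boundary word $w_1aw_2^{-1}$ with $a\in A$, and $\hat e$ is the directed edge of the boundary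 path, from $v_1$ to $v_2$, that corresponds to $a$, then an edge homotopy is a continuous $\theta:\hat e\times[0,1]\to\Delta$ with $\theta(p,0)=*$, $\theta(p,1)=p$, such that $\theta(v_i,\cdot)$ follows the path labelled $w_i$ in $\partial\Delta$ (up to a weakly monotone reparametrization) for $i=1,2$. * A word is simple if it labels a path in $X^1$ without repeated vertices or edges. A combed normal filling consists of a simple word $y_g$ representing $g$ for each $g\in G$, and, for each $e\in E(X)$, a direction of $e$, say from $g$ to $h$ with label $a$, a van Kampen diagram $\Delta_e$ for $y_gay_h^{-1}$ and an edge homotopy $\theta_e$ of the edge of $\partial\Delta_e$ corresponding to $a$, such that, whenever $e,e'$ share an end point $g$, the paths of $\theta_e$ and $\theta_{e'}$ to that end point have the same parametrized projection to $X$. It is geodesic if every $y_g$ labels a geodesic in $X^1$. * A diagrammatic 1-combing of $X$ is a continuous $\Upsilon:X^1\times[0,1]\to X$ with $\Upsilon(p,0)=\epsilon$, $\Upsilon(p,1)=p$, $\Upsilon(v,t)\in X^1$ for every vertex $v$, and $\Upsilon(\epsilon,t)=\epsilon$, such that for every vertex $v$ the path $\Upsilon(v,\cdot)$ follows, up to a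 weakly monotone reparametrization, an embedded edge path from $\epsilon$ to $v$, labelled $w_v$ say, and such that for every directed edge $e$ of $X$, from $u$ to $v$ with label $a$, there are a van Kampen diagram $\Delta$ for $w_uaw_v^{-1}$ and an edge homotopy $\theta$ of the edge $\hat e$ of $\partial\Delta$ corresponding to $a$ with $\Upsilon(\pi_\Delta(p),t)=\pi_\Delta(\theta(p,t))$ for all $p\in\hat e$ and $t\in[0,1]$. Functions $f,g:\mathbb N[\frac14]\to\mathbb N[\frac14]$ are Lipschitz equivalent if there is a constant $C\in\mathbb N$ with $f(n)\le Cg(Cn+C)+C$ and $g(n)\le Cf(Cn+C)+C$ for all $n$. **Proposition 3.3.** Let $f:\mathbb N[\frac14]\to\mathbb N[\frac14]$ be nondecreasing. The following are equivalent up to Lipschitz equivalence of $f$; that is, if one of them holds for some nondecreasing function that is Lipschitz equivalent to $f$, then so does each of the others, for a possibly different such function. 1. $(G,\mathcal P)$ satisfies an extrinsic tame filling inequality for $f$: every word $w=_G\epsilon$ has a van Kampen diagram with an extrinsically $f$-tame van Kampen homotopy. 2. $(G,\mathcal P)$ satisfies an extrinsic relaxed tame filling inequality for $f$: every word $w=_G\epsilon$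 has a van Kampen diagram with an extrinsically $f$-tame disk homotopy. 3. $(G,\mathcal P)$ satisfies an extrinsic geodesic tame normal inequality for $f$: there is a geodesic combed normal filling all of whose edge homotopies are extrinsically $f$-tame. 4. $(G,\mathcal P)$ satisfies an extrinsic tame normal inequality for $f$: there is a combed normal filling all of whose edge homotopies are extrinsically $f$-tame. 5. $(G,\mathcal P)$ satisfies a radial tame combing inequality for $f$: there is a diagrammatic 1-combing $\Upsilon$ of $X$ with $\tilde d(\Upsilon(p,s))\le f(\tilde d(\Upsilon(p,t)))$ for all $p\in X^1$ and $0\le s<t\le1$. -/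

import Mathlib

open scoped unitInterval

namespace TameFilling

/-! ### The value set `ℕ[1/4]` and Lipschitz equivalence -/

/-- The set `ℕ[1/4] = {0, 1/4, 1/2, 3/4, 1, …}` of values of coarse distances, ordered as a
subset of the rationals. -/
abbrev QuarterNat : Type := {q : ℚ // ∃ n : ℕ, q = n / 4}

/-- `ofQuarters n` is the number `n / 4`. -/
def ofQuarters (n : ℕ) : QuarterNat := ⟨n / 4, n, rfl⟩

/-- The element `C q + C` of `ℕ[1/4]`. -/
def affine (C : ℕ) (q : QuarterNat) : QuarterNat :=
  ⟨C * (q : ℚ) + C, by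
    obtain ⟨q, n, rfl⟩ := q
    exact ⟨C * n + 4 * C, by push_cast; ring⟩⟩

/-- Lipschitz equivalence of functions. -/
def LipschitzEquivalent (f g : QuarterNat → QuarterNat) : Prop :=
  ∃ C : ℕ, ∀ n : QuarterNat,
    (f n : ℚ) ≤ C * (g (affine C n) : ℚ) + C ∧ (g n : ℚ) ≤ C * (f (affine C n) : ℚ) + C

/-- `Q` holds for some nondecreasing function that is Lipschitz equivalent to `f`. -/
def UpToLipschitz (Q : (QuarterNat → QuarterNat) → Prop) (f : QuarterNat → QuarterNat) : Prop :=
  ∃ g : QuarterNat → QuarterNat, Monotone g ∧ LipschitzEquivalent f g ∧ Q g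

/-! ### Combinatorial 2-complexes -/

/-- The cyclic successor in `{0, …, n - 1}`. -/
def cycSucc {n : ℕ} (i : Fin n) : Fin n := ⟨(i + 1) % n, Nat.mod_lt _ i.pos⟩

/-- A combinatorial 2-complex: vertices `V`, directed edges `D` (with initial vertex `src` and
fixed point free reversal `rev`; an undirected edge is a pair `{d, rev d}`), and 2-cells `F`.
The 2-cell `f` is a polygon attached along the nonempty closed edge path `bd f`. -/
structure TwoComplex.{u, v, w} where
  V : Type u
  D : Type v
  F : Type w
  src : D → V
  rev : D → D
  rev_rev : ∀ d, rev (rev d) = d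
  rev_ne : ∀ d, rev d ≠ d
  bd : F → List D
  bd_ne_nil : ∀ f, bd f ≠ []
  bd_closed : ∀ f (k : Fin (bd f).length), src (rev ((bd f).get k)) = src ((bd f).get (cycSucc k))

namespace TwoComplex

universe u v w
variable (K : TwoComplex.{u, v, w})

/-- The terminal vertex of a directed edge. -/
def tgt (d : K.D) : K.V := K.src (K.rev d)

/-- `IsPath x l y`: the list `l` of directed edges is an edge path from `x` to `y`. -/
def IsPath (x : K.V) : List K.D → K.V → Prop
  | [], y => x = y
  | d :: l, y => K.src d = x ∧ IsPath (K.tgt d) l y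

/-- The reverse of an edge path. -/
def revPath (l : List K.D) : List K.D := (l.map K.rev).reverse

/-- The path metric on the vertices of the 1-skeleton. -/
noncomputable def dist (x y : K.V) : ℕ := sInf {n | ∃ l, K.IsPath x l y ∧ l.length = n}

/-- The set of undirected edges. -/
def Edge : Type v := Quot (fun d d' : K.D => d' = K.rev d)

/-- The disjoint union of the cells before gluing: a point for each vertex, a unit interval for
each directed edge, and for each 2-cell and each side of it a sector `I × I`. In the sector
`(x, r)` of the `k`-th side, `r` is the radial coordinate (`r = 0` is the centre of the polygon,
`r = 1` its boundary) and `x` runs along the side. -/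
abbrev Pre : Type (max u v w) :=
  (Σ _ : K.V, Unit) ⊕ (Σ _ : K.D, I) ⊕ (Σ _ : (Σ f : K.F, Fin (K.bd f).length), I × I)

variable {K} in
/-- The vertex `x`. -/
abbrev Pre.vtx (x : K.V) : K.Pre := Sum.inl ⟨x, ()⟩

variable {K} in
/-- The point with parameter `x` on the directed edge `d`. -/
abbrev Pre.edge (d : K.D) (x : I) : K.Pre := Sum.inr (Sum.inl ⟨d, x⟩)

variable {K} in
/-- The point with coordinates `(x, r)` in the `k`-th sector of the 2-cell `f`. -/
abbrev Pre.sector (f : K.F) (k : Fin (K.bd f).length) (x r : I) : K.Pre :=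
  Sum.inr (Sum.inr ⟨⟨f, k⟩, (x, r)⟩)

/-- The gluing relations: edges are glued to their end points, the two directions of an edge are
identified, the sectors of a 2-cell are glued together to the cone over a circle (a disk), and the
boundary of this disk is attached along `bd f`. -/
inductive Glue : K.Pre → K.Pre → Prop
  | start (d : K.D) : Glue (Pre.edge d 0) (Pre.vtx (K.src d))
  | rev (d : K.D) (x : I) : Glue (Pre.edge d x) (Pre.edge (K.rev d) (σ x))
  | centre (f : K.F) (k k' : Fin (K.bd f).length) (x x' : I) :
      Glue (Pre.sector f k x 0) (Pre.sector f k' x' 0)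
  | ray (f : K.F) (k : Fin (K.bd f).length) (r : I) :
      Glue (Pre.sector f k 1 r) (Pre.sector f (cycSucc k) 0 r)
  | side (f : K.F) (k : Fin (K.bd f).length) (x : I) :
      Glue (Pre.sector f k x 1) (Pre.edge ((K.bd f).get k) x)

/-- The underlying topological space of the 2-complex, with the quotient (CW) topology. -/
def Realization : Type (max u v w) := Quot K.Glue

instance : TopologicalSpace K.Realization := inferInstanceAs (TopologicalSpace (Quot K.Glue))

/-- The point of the space given by the vertex `x`. -/
def vtx (x : K.V) : K.Realization := Quot.mk _ (Pre.vtx x)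

/-- The point with parameter `x ∈ [0,1]` on the directed edge `d`. -/
def onEdge (d : K.D) (x : I) : K.Realization := Quot.mk _ (Pre.edge d x)

/-- The 1-skeleton. -/
def skeletonOne : Set K.Realization :=
  {p | (∃ x, p = K.vtx x) ∨ ∃ d x, p = K.onEdge d x}

/-- Four times the coarse distance from `y` to the interior of the edge `d`. -/
noncomputable def edgeQuarters (y : K.V) (d : K.D) : ℕ :=
  4 * min (K.dist y (K.src d)) (K.dist y (K.tgt d)) + 2

/-- Four times the coarse distance from `y` to the interior of the 2-cell `f`. -/
noncomputable def faceQuarters (y : K.V) (f : K.F) : ℕ :=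
  (Finset.univ.sup fun k : Fin (K.bd f).length => K.edgeQuarters y ((K.bd f).get k)) - 1

/-- The coarse distance from `y` to the point with parameter `x` on the closed edge `d`. -/
noncomputable def edgeCoarse (y : K.V) (d : K.D) (x : I) : QuarterNat :=
  if x = 0 then ofQuarters (4 * K.dist y (K.src d))
  else if x = 1 then ofQuarters (4 * K.dist y (K.tgt d))
  else ofQuarters (K.edgeQuarters y d)

/-- Coarse distance from `y`, before gluing. -/
noncomputable def preCoarse (y : K.V) : K.Pre → QuarterNat
  | .inl ⟨x, _⟩ => ofQuarters (4 * K.dist y x)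
  | .inr (.inl ⟨d, x⟩) => K.edgeCoarse y d x
  | .inr (.inr ⟨⟨f, k⟩, (x, r)⟩) =>
      if r = 1 then K.edgeCoarse y ((K.bd f).get k) x else ofQuarters (K.faceQuarters y f)

theorem preCoarse_glue (y : K.V) (p q : K.Pre) (h : K.Glue p q) :
    K.preCoarse y p = K.preCoarse y q := by
  cases h with
  | start d => simp [preCoarse, edgeCoarse]
  | rev d x =>
    have h0 : (σ x = 0) = (x = 1) := by
      rw [← unitInterval.symm_one, unitInterval.symm_inj]
    have h1 : (σ x = 1) = (x = 0) := by
      rw [← unitInterval.symm_zero, unitInterval.symm_inj]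
    simp only [preCoarse, edgeCoarse, edgeQuarters, tgt, K.rev_rev, h0, h1]
    by_cases hx : x = 0
    · subst hx; simp
    · simp [hx, min_comm]
  | centre f k k' x x' => simp [preCoarse]
  | ray f k r =>
    by_cases hr : r = 1
    · subst hr
      simpa [preCoarse, edgeCoarse, tgt] using
        congrArg (fun z => ofQuarters (4 * K.dist y z)) (K.bd_closed f k)
    · simp [preCoarse, hr]
  | side f k x => simp [preCoarse]

/-- The coarse distance from the vertex `y` to a point: the path metric on vertices; the minimum
over the two end points plus `1/2` inside an edge; the maximum over the interiors of the boundary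
edges minus `1/4` inside a 2-cell. -/
noncomputable def coarseDist (y : K.V) : K.Realization → QuarterNat :=
  Quot.lift (K.preCoarse y) (K.preCoarse_glue y)

/-- The point at parameter `s ∈ [0, l.length]` on the edge path `l` starting at the vertex `x`,
where each edge is traversed at unit speed. -/
noncomputable def pathPt (x : K.V) : List K.D → ℝ → K.Realization
  | [], _ => K.vtx x
  | d :: l, s =>
      if s ≤ 1 then K.onEdge d (Set.projIcc 0 1 zero_le_one s) else pathPt (K.tgt d) l (s - 1)

/-- `c : [0,1] → K` follows the edge path `l` starting at the vertex `x`: it is a (weakly monotone)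
reparametrization of that path. -/
def Follows (c : I → K.Realization) (x : K.V) (l : List K.D) : Prop :=
  ∃ ρ : I → ℝ, Continuous ρ ∧ Monotone ρ ∧ ρ 0 = 0 ∧ ρ 1 = l.length ∧
    ∀ t, c t = K.pathPt x l (ρ t)

/-- A cellular map of combinatorial 2-complexes that maps each open cell homeomorphically onto an
open cell of the same dimension. -/
structure Hom.{u', v', w'} (K : TwoComplex.{u, v, w}) (L : TwoComplex.{u', v', w'}) where
  onV : K.V → L.V
  onD : K.D → L.D
  onF : K.F → L.F
  src_onD : ∀ d, L.src (onD d) = onV (K.src d)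
  rev_onD : ∀ d, L.rev (onD d) = onD (K.rev d)
  bd_onF : ∀ f, L.bd (onF f) = (K.bd f).map onD

namespace Hom

universe u' v' w'
variable {K} {L : TwoComplex.{u', v', w'}} (φ : Hom K L)

theorem length_eq (f : K.F) : (K.bd f).length = (L.bd (φ.onF f)).length := by
  rw [φ.bd_onF]; simp

/-- The cellular map before gluing. -/
def preMap : K.Pre → L.Pre
  | .inl ⟨x, _⟩ => Pre.vtx (φ.onV x)
  | .inr (.inl ⟨d, x⟩) => Pre.edge (φ.onD d) x
  | .inr (.inr ⟨⟨f, k⟩, (x, r)⟩) => Pre.sector (φ.onF f) (Fin.cast (φ.length_eq f) k) x r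

theorem preMap_glue (p q : K.Pre) (h : K.Glue p q) : L.Glue (φ.preMap p) (φ.preMap q) := by
  cases h with
  | start d =>
    have := Glue.start (K := L) (φ.onD d)
    rw [φ.src_onD] at this
    exact this
  | rev d x =>
    have := Glue.rev (K := L) (φ.onD d) x
    rw [φ.rev_onD] at this
    exact this
  | centre f k k' x x' => exact Glue.centre _ _ _ _ _
  | ray f k r =>
    have := Glue.ray (K := L) (φ.onF f) (Fin.cast (φ.length_eq f) k) r
    have e : cycSucc (Fin.cast (φ.length_eq f) k) = Fin.cast (φ.length_eq f) (cycSucc k) := by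
      apply Fin.ext
      simp [cycSucc, φ.length_eq f]
    rw [e] at this
    exact this
  | side f k x =>
    have := Glue.side (K := L) (φ.onF f) (Fin.cast (φ.length_eq f) k) x
    have e : (L.bd (φ.onF f)).get (Fin.cast (φ.length_eq f) k) = φ.onD ((K.bd f).get k) := by
      simp [φ.bd_onF]
    rw [e] at this
    exact this

/-- The map of spaces induced by a cellular map. -/
def map : K.Realization → L.Realization := Quot.map φ.preMap φ.preMap_glue

end Hom

end TwoComplex

/-! ### Symmetrized presentations and the Cayley 2-complex -/

section Presentation

universe u v
variable {G : Type u} {A : Type v} [Group G]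

/-- `FreeStep inv u v`: the word `v` arises from `u` by deleting a subword `a a⁻¹`. -/
def FreeStep (inv : A → A) (u v : List A) : Prop :=
  ∃ (x y : List A) (a : A), u = x ++ a :: inv a :: y ∧ v = x ++ y

variable (G A) in
/-- A symmetrized presentation `⟨A | R⟩` of `G` with finitely many relators. The letters in `A`
represent nontrivial elements of `G`; `inv` is the formal inversion of letters. The set `R` of
nonempty words is closed under formal inversion and cyclic conjugation, and contains the nonempty
freely reduced representatives of its elements. The field `presents` says that `G` is the quotient
of the free group on `A` by the normal closure of `R` and the relators `a · inv a`. -/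
structure SymmetrizedPresentation where
  inv : A → A
  inv_inv : ∀ a, inv (inv a) = a
  val : A → G
  val_inv : ∀ a, val (inv a) = (val a)⁻¹
  val_ne_one : ∀ a, val a ≠ 1
  R : Set (List A)
  R_finite : R.Finite
  R_ne_nil : ∀ r ∈ R, r ≠ []
  R_inv : ∀ r ∈ R, (r.map inv).reverse ∈ R
  R_cyclic : ∀ x y : List A, x ++ y ∈ R → y ++ x ∈ R
  R_reduced : ∀ r ∈ R, ∀ s, Relation.ReflTransGen (FreeStep inv) r s →
    (∀ s', ¬ FreeStep inv s s') → s ≠ [] → s ∈ R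
  generates : Function.Surjective (FreeGroup.lift val)
  presents : (FreeGroup.lift val).ker = Subgroup.normalClosure
    (Set.range (fun a => FreeGroup.of a * FreeGroup.of (inv a)) ∪
      (fun r : List A => (r.map FreeGroup.of).prod) '' R)

namespace SymmetrizedPresentation

variable (P : SymmetrizedPresentation G A)

/-- The element of `G` represented by a word. -/
def eval (l : List A) : G := (l.map P.val).prod

/-- The formal inverse of a word. -/
def invWord (l : List A) : List A := (l.map P.inv).reverse

theorem eval_relator {r : List A} (hr : r ∈ P.R) : P.eval r = 1 := by
  have h : (r.map FreeGroup.of).prod ∈ (FreeGroup.lift P.val).ker := by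
    rw [P.presents]
    exact Subgroup.subset_normalClosure (Or.inr ⟨r, hr, rfl⟩)
  rw [MonoidHom.mem_ker, map_list_prod, List.map_map] at h
  have e : (⇑(FreeGroup.lift P.val) ∘ FreeGroup.of) = P.val := by
    funext a; simp
  rwa [e] at h

/-- The edge path in the Cayley graph that starts at `g` and is labelled by the given word; the
pair `(g, a)` is the directed edge labelled `a` from `g` to `g a`. -/
def pathFrom (g : G) : List A → List (G × A)
  | [] => []
  | a :: l => (g, a) :: pathFrom (g * P.val a) l

theorem length_pathFrom (g : G) (l : List A) : (P.pathFrom g l).length = l.length := by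
  induction l generalizing g with
  | nil => rfl
  | cons a l ih => simp [pathFrom, ih]

theorem getElem_pathFrom (g : G) (l : List A) (i : ℕ) (h : i < (P.pathFrom g l).length) :
    (P.pathFrom g l)[i] =
      (g * P.eval (l.take i), l[i]'(by rwa [P.length_pathFrom] at h)) := by
  induction l generalizing g i with
  | nil => simp [pathFrom] at h
  | cons a l ih =>
    cases i with
    | zero => simp [pathFrom, eval]
    | succ i => simp [pathFrom, ih, eval, mul_assoc]

theorem pathFrom_closed (g : G) (r : List A) (hr : P.eval r = 1)
    (k : Fin (P.pathFrom g r).length) :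
    ((P.pathFrom g r).get k).1 * P.val ((P.pathFrom g r).get k).2 =
      ((P.pathFrom g r).get (cycSucc k)).1 := by
  obtain ⟨i, h⟩ := k
  have h' : i < r.length := by rwa [P.length_pathFrom] at h
  have e : P.eval (r.take i) * P.val r[i] = P.eval (r.take (i + 1)) := by
    rw [List.take_succ_eq_append_getElem h']
    simp only [eval, List.map_append, List.prod_append, List.map_cons, List.map_nil,
      List.prod_singleton]
  have hR : ((P.pathFrom g r).get (cycSucc ⟨i, h⟩)).1 =
      g * P.eval (r.take ((i + 1) % r.length)) := by
    have hl := P.length_pathFrom g r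
    simp only [List.get_eq_getElem, cycSucc]
    rw [P.getElem_pathFrom]
    simp only [hl]
  have hL : (P.pathFrom g r).get ⟨i, h⟩ = (g * P.eval (r.take i), r[i]) :=
    P.getElem_pathFrom g r i h
  rw [hR, hL, mul_assoc, e]
  rcases Nat.lt_or_ge (i + 1) r.length with hi | hi
  · rw [Nat.mod_eq_of_lt hi]
  · have hi' : i + 1 = r.length := by omega
    rw [hi', Nat.mod_self, List.take_length, hr]
    simp [eval]

/-- The Cayley 2-complex: the vertices are the elements of `G`; the directed edges are the pairs
`(g, a)`, from `g` to `g a`, with reverse `(g a, a⁻¹)`; and for each `g` and each relator `r` there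
is a 2-cell attached along the loop at `g` labelled `r`. -/
def cayley : TwoComplex.{u, max u v, max u v} where
  V := G
  D := G × A
  F := G × P.R
  src := Prod.fst
  rev d := (d.1 * P.val d.2, P.inv d.2)
  rev_rev d := by simp [P.val_inv, P.inv_inv]
  rev_ne d h := P.val_ne_one d.2 (by simpa using congrArg Prod.fst h)
  bd f := P.pathFrom f.1 f.2
  bd_ne_nil f h := P.R_ne_nil f.2 f.2.2 (by
    have := congrArg List.length h
    rw [P.length_pathFrom] at this
    exact List.eq_nil_of_length_eq_zero this)
  bd_closed f k := P.pathFrom_closed f.1 f.2 (P.eval_relator f.2.2) k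

/-- The coarse distance `d̃_X(ε, p)` in the Cayley 2-complex from the identity vertex. -/
noncomputable def height (p : P.cayley.Realization) : QuarterNat :=
  P.cayley.coarseDist (1 : G) p

/-- A word is simple if it labels a simple path in the Cayley graph. (If no vertex is repeated, no
edge is repeated either.) -/
def IsSimple (l : List A) : Prop := (l.inits.map P.eval).Nodup

/-- A word is geodesic if it labels a geodesic in the Cayley graph. -/
def IsGeodesic (l : List A) : Prop := l.length = P.cayley.dist (1 : G) (P.eval l)

end SymmetrizedPresentation

/-! ### Van Kampen diagrams -/

/-- Two directed edges `d`, `d'` with the same initial vertex are consecutive around that vertex: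
`d'` follows `rev d` on one of the given closed edge paths (`cw f` for `f : F`, and `b`). -/
def Corner {F D : Type} (rev : D → D) (cw : F → List D) (b : List D) (d d' : D) : Prop :=
  (∃ (f : F) (k : Fin (cw f).length), (cw f).get k = rev d ∧ (cw f).get (cycSucc k) = d') ∨
    ∃ k : Fin b.length, b.get k = rev d ∧ b.get (cycSucc k) = d'

/-- A van Kampen diagram over the presentation `P` with boundary word `w`: a finite planar
contractible 2-complex with edges labelled in `A`, 2-cells labelled in `R`, and with boundary path
labelled `w`, read counterclockwise from the base point.

Planarity and contractibility are encoded combinatorially: the complex together with one further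
2-cell (the outer region, attached along the boundary path `bdry`) is a cell decomposition of the
oriented 2-sphere. That is, it is connected, each edge has exactly two sides, one in each direction,
where inner 2-cells are traversed clockwise and the outer one counterclockwise (`sides`); around
each vertex the directed edges form a single cycle (`link`), so that it is a closed oriented
surface; and the Euler characteristic is 2, equivalently `|V| - |D|/2 + |F| = 1` (`euler`). The
complex with a single vertex and no edges is the diagram of the empty word.

The field `pos` is the canonical map to the Cayley 2-complex on vertices; it is determined by
`pos_base` and `pos_tgt`. -/
structure VanKampenDiagram (P : SymmetrizedPresentation G A) (w : List A)
    extends TwoComplex.{0, 0, 0} where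
  finite_V : Finite V
  finite_D : Finite D
  finite_F : Finite F
  base : V
  label : D → A
  label_rev : ∀ d, label (rev d) = P.inv (label d)
  label_face : ∀ f, (bd f).map label ∈ P.R
  pos : V → G
  pos_base : pos base = 1
  pos_tgt : ∀ d, pos (src (rev d)) = pos (src d) * P.val (label d)
  /-- the boundary path of a 2-cell, in clockwise direction -/
  cw : F → List D
  cw_spec : ∀ f, cw f = bd f ∨ cw f = ((bd f).map rev).reverse
  bdry : List D
  bdry_isPath : toTwoComplex.IsPath base bdry base
  bdry_label : bdry.map label = w
  connected : ∀ x, ∃ l, toTwoComplex.IsPath base l x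
  sides : Function.Bijective
    (Sum.elim (fun s : Σ f : F, Fin (cw f).length => (cw s.1).get s.2) bdry.get)
  link : ∀ d d', src d = src d' → Relation.EqvGen (Corner rev cw bdry) d d'
  euler : 2 * Nat.card V + 2 * Nat.card F = Nat.card D + 2

namespace VanKampenDiagram

variable {P : SymmetrizedPresentation G A} {w : List A} (Δ : VanKampenDiagram P w)

/-- The directed edge of the Cayley graph under a directed edge of the diagram. -/
def dart (d : Δ.D) : G × A := (Δ.pos (Δ.src d), Δ.label d)

theorem bd_dart (f : Δ.F) :
    P.pathFrom (Δ.pos (Δ.src ((Δ.bd f).head (Δ.bd_ne_nil f)))) ((Δ.bd f).map Δ.label) =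
      (Δ.bd f).map Δ.dart := by
  have key : ∀ (i : ℕ) (h : i < (Δ.bd f).length),
      Δ.pos (Δ.src ((Δ.bd f).head (Δ.bd_ne_nil f))) * P.eval (((Δ.bd f).map Δ.label).take i) =
        Δ.pos (Δ.src (Δ.bd f)[i]) := by
    intro i
    induction i with
    | zero => intro h; simp [SymmetrizedPresentation.eval, List.head_eq_getElem]
    | succ i ih =>
      intro h
      have h' : i < (Δ.bd f).length := by omega
      have hc := Δ.bd_closed f ⟨i, h'⟩
      simp only [List.get_eq_getElem, cycSucc, Nat.mod_eq_of_lt h] at hc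
      rw [← hc, Δ.pos_tgt, ← ih h']
      have h'' : i < ((Δ.bd f).map Δ.label).length := by simpa using h'
      rw [List.take_succ_eq_append_getElem h'']
      simp [SymmetrizedPresentation.eval, mul_assoc]
  apply List.ext_getElem
  · simp [P.length_pathFrom]
  · intro i h1 h2
    have h : i < (Δ.bd f).length := by simpa using h2
    rw [P.getElem_pathFrom, key i h]
    simp [dart]

/-- The canonical cellular map from the diagram to the Cayley 2-complex: it maps the base point to
the identity, preserves labels and directions of edges, and maps a 2-cell with label `r` to the
2-cell of the Cayley complex with that label. -/
def cell : TwoComplex.Hom Δ.toTwoComplex P.cayley where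
  onV := Δ.pos
  onD := Δ.dart
  onF f := (Δ.pos (Δ.src ((Δ.bd f).head (Δ.bd_ne_nil f))), ⟨_, Δ.label_face f⟩)
  src_onD _ := rfl
  rev_onD d := Prod.ext (Δ.pos_tgt d).symm (Δ.label_rev d).symm
  bd_onF f := Δ.bd_dart f

/-- The canonical map `π_Δ` from the diagram to the Cayley 2-complex. -/
def proj : Δ.Realization → P.cayley.Realization := Δ.cell.map

/-- The base point of the diagram. -/
def basePt : Δ.Realization := Δ.vtx Δ.base

/-- The boundary `∂Δ`, as a subspace of the diagram. -/
def boundary : Set Δ.Realization :=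
  {p | p = Δ.basePt ∨ ∃ d ∈ Δ.bdry, ∃ x, p = Δ.onEdge d x}

/-- A map `α : Z × [0,1] → Δ` is extrinsically `f`-tame. -/
def ExtrinsicallyTame {Z : Type} (α : Z × I → Δ.Realization) (f : QuarterNat → QuarterNat) :
    Prop :=
  ∀ (p : Z) (s t : I), s < t →
    P.height (Δ.proj (α (p, s))) ≤ f (P.height (Δ.proj (α (p, t))))

/-- `ψ : ∂Δ × [0,1] → Δ` is a van Kampen homotopy. -/
structure IsVanKampenHomotopy (ψ : Δ.boundary × I → Δ.Realization) : Prop where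
  continuous : Continuous ψ
  zero : ∀ p, ψ (p, 0) = Δ.basePt
  one : ∀ p, ψ (p, 1) = p
  base : ∀ (p : Δ.boundary) (t : I), (p : Δ.Realization) = Δ.basePt → ψ (p, t) = Δ.basePt
  vertex : ∀ (p : Δ.boundary) (t : I), (∃ x, (p : Δ.Realization) = Δ.vtx x) →
    ψ (p, t) ∈ Δ.skeletonOne

/-- The fraction in `(0, 1]` of the unit circle between `-1` and `z`, counterclockwise. -/
noncomputable def turn (z : Circle) : ℝ := (Complex.arg (z : ℂ) + Real.pi) / (2 * Real.pi)

/-- The map `C_n → ∂Δ`, where `C_n` is the unit circle subdivided into `n` edges of equal length,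
that maps `-1` to the base point and wraps the circle once counterclockwise along the boundary
path of the diagram. -/
noncomputable def wrap (z : Circle) : Δ.Realization :=
  Δ.pathPt Δ.base Δ.bdry (w.length * turn z)

/-- `φ : C_n × [0,1] → Δ`, with `n` the length of the boundary word, is a disk homotopy. -/
structure IsDiskHomotopy (φ : Circle × I → Δ.Realization) : Prop where
  continuous : Continuous φ
  zero : ∀ p, φ (p, 0) = Δ.basePt
  one : ∀ p, φ (p, 1) = Δ.wrap p
  base : ∀ (p : Circle) (t : I), (p : ℂ) = -1 → φ (p, t) = Δ.basePt
  vertex : ∀ (p : Circle) (t : I), (∃ k : ℕ, w.length * turn p = k) → φ (p, t) ∈ Δ.skeletonOne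

/-- `θ` is an edge homotopy for the factorization `w₁ a w₂⁻¹` of the boundary word: the boundary
path of `Δ` is `p₁ d p₂⁻¹`, where `p₁`, `d`, `p₂` have labels `w₁`, `a`, `w₂`, and
`θ : d × [0,1] → Δ` combs the closed directed edge `d`, whose points are given by their
parameter in `[0,1]` (there are no loops, as no letter represents the identity). -/
def IsEdgeHomotopy (w₁ : List A) (a : A) (w₂ : List A) (θ : I × I → Δ.Realization) : Prop :=
  ∃ (p₁ : List Δ.D) (d : Δ.D) (p₂ : List Δ.D),
    Δ.bdry = p₁ ++ d :: Δ.revPath p₂ ∧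
    p₁.map Δ.label = w₁ ∧ Δ.label d = a ∧ p₂.map Δ.label = w₂ ∧
    Continuous θ ∧
    (∀ x, θ (x, 0) = Δ.basePt) ∧ (∀ x, θ (x, 1) = Δ.onEdge d x) ∧
    Δ.Follows (fun t => θ (0, t)) Δ.base p₁ ∧ Δ.Follows (fun t => θ (1, t)) Δ.base p₂

end VanKampenDiagram

/-! ### Combed normal fillings, 1-combings, and the five inequalities -/

/-- A combed normal filling: simple word normal forms `nf g` for the elements of `G`, and for each
undirected edge `e` of the Cayley complex, with a chosen direction `dir e` from `g` to `h`, labelled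
`a`, a van Kampen diagram for `nf g · a · (nf h)⁻¹` and an edge homotopy, such that the paths to a
common end point of two edges have the same projection to the Cayley complex. -/
structure CombedNormalFilling (P : SymmetrizedPresentation G A) where
  nf : G → List A
  nf_eval : ∀ g, P.eval (nf g) = g
  nf_simple : ∀ g, P.IsSimple (nf g)
  dir : P.cayley.Edge → G × A
  dir_spec : ∀ e, Quot.mk _ (dir e) = e
  diagram : ∀ e, VanKampenDiagram P
    (nf (dir e).1 ++ (dir e).2 :: P.invWord (nf ((dir e).1 * P.val (dir e).2)))
  homotopy : ∀ e, I × I → (diagram e).Realization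
  isEdgeHomotopy : ∀ e, (diagram e).IsEdgeHomotopy
    (nf (dir e).1) (dir e).2 (nf ((dir e).1 * P.val (dir e).2)) (homotopy e)
  consistent : ∀ (g : G) (e e' : P.cayley.Edge) (x x' : I),
    P.cayley.onEdge (dir e) x = P.cayley.vtx g → P.cayley.onEdge (dir e') x' = P.cayley.vtx g →
    ∀ t, (diagram e).proj (homotopy e (x, t)) = (diagram e').proj (homotopy e' (x', t))

/-- The point with parameter `x` on the directed edge `(g, a)`, as a point of the Cayley graph. -/
def edgePt (P : SymmetrizedPresentation G A) (g : G) (a : A) (x : I) : P.cayley.skeletonOne :=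
  ⟨P.cayley.onEdge (g, a) x, Or.inr ⟨(g, a), x, rfl⟩⟩

/-- The vertex `g`, as a point of the Cayley graph. -/
def vertexPt (P : SymmetrizedPresentation G A) (g : G) : P.cayley.skeletonOne :=
  ⟨P.cayley.vtx g, Or.inl ⟨g, rfl⟩⟩

/-- `Υ` is a diagrammatic 1-combing of the Cayley complex. In the last two fields, `word g` labels
the embedded edge path from the identity to `g` that `Υ (g, ·)` follows. -/
def IsDiagrammaticCombing (P : SymmetrizedPresentation G A)
    (Υ : P.cayley.skeletonOne × I → P.cayley.Realization) : Prop :=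
  Continuous Υ ∧
  (∀ p, Υ (p, 0) = P.cayley.vtx (1 : G)) ∧
  (∀ p, Υ (p, 1) = p) ∧
  (∀ (g : G) (t : I), Υ (vertexPt P g, t) ∈ P.cayley.skeletonOne) ∧
  (∀ t, Υ (vertexPt P 1, t) = P.cayley.vtx (1 : G)) ∧
  ∃ word : G → List A,
    (∀ g, P.eval (word g) = g ∧ P.IsSimple (word g) ∧
      P.cayley.Follows (fun t => Υ (vertexPt P g, t)) (1 : G) (P.pathFrom 1 (word g))) ∧
    ∀ (g : G) (a : A),
      ∃ (Δ : VanKampenDiagram P (word g ++ a :: P.invWord (word (g * P.val a))))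
        (θ : I × I → Δ.Realization),
        Δ.IsEdgeHomotopy (word g) a (word (g * P.val a)) θ ∧
        ∀ x t, Υ (edgePt P g a x, t) = Δ.proj (θ (x, t))

/-- Extrinsic tame filling inequality for `f`. -/
def ExtrinsicTameFilling (P : SymmetrizedPresentation G A) (f : QuarterNat → QuarterNat) : Prop :=
  ∀ w : List A, P.eval w = 1 → ∃ (Δ : VanKampenDiagram P w) (ψ : Δ.boundary × I → Δ.Realization),
    Δ.IsVanKampenHomotopy ψ ∧ Δ.ExtrinsicallyTame ψ f

/-- Extrinsic relaxed tame filling inequality for `f`. -/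
def ExtrinsicRelaxedTameFilling (P : SymmetrizedPresentation G A)
    (f : QuarterNat → QuarterNat) : Prop :=
  ∀ w : List A, P.eval w = 1 → ∃ (Δ : VanKampenDiagram P w) (φ : Circle × I → Δ.Realization),
    Δ.IsDiskHomotopy φ ∧ Δ.ExtrinsicallyTame φ f

/-- Extrinsic tame normal inequality for `f`. -/
def ExtrinsicTameNormal (P : SymmetrizedPresentation G A) (f : QuarterNat → QuarterNat) : Prop :=
  ∃ E : CombedNormalFilling P, ∀ e, (E.diagram e).ExtrinsicallyTame (E.homotopy e) f

/-- Extrinsic geodesic tame normal inequality for `f`. -/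
def ExtrinsicGeodesicTameNormal (P : SymmetrizedPresentation G A)
    (f : QuarterNat → QuarterNat) : Prop :=
  ∃ E : CombedNormalFilling P, (∀ g, P.IsGeodesic (E.nf g)) ∧
    ∀ e, (E.diagram e).ExtrinsicallyTame (E.homotopy e) f

/-- Radial tame combing inequality for `f`. -/
def RadialTameCombing (P : SymmetrizedPresentation G A) (f : QuarterNat → QuarterNat) : Prop :=
  ∃ Υ : P.cayley.skeletonOne × I → P.cayley.Realization, IsDiagrammaticCombing P Υ ∧
    ∀ (p : P.cayley.skeletonOne) (s t : I), s < t →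
      P.height (Υ (p, s)) ≤ f (P.height (Υ (p, t)))

end Presentation

end TameFilling

/-! The five conditions are linked in a cycle. An implication loses at most an additive constant,
which is absorbed by passing from `f` to `shift c f`, that is `q ↦ f (q + c) + c`; this function is
again nondecreasing and Lipschitz equivalent to the given one (`LipschitzEquivalent.shift`). A van
Kampen homotopy pulled back along the boundary path is a disk homotopy, and a geodesic normal
filling is a normal filling. Three implications have content.

One estimate serves two of them. Tameness only compares times `s < t`, so it does not say directly
that `f` is almost at least the identity. But a continuous curve that ends at a vertex at distance
`n` lies, shortly before its end, in the open star of that vertex, where heights are at least `n -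
1`. Hence `n - 1 ≤ f n`, and the height of a point of the 1-skeleton is at most `f` of that height
plus 2 (`height_le_of_vertices`).

From disk homotopies to geodesic normal fillings: take geodesic normal forms and, for an edge
labelled `a`, a tame disk homotopy for `y₁ a y₂⁻¹`. Run it during the first third of the time, so
that every curve ends on the boundary path; then push the end points along the boundary towards the
edge `a`; finally slide them inside that edge. As `y₁` and `y₂` are geodesics, the height at a
boundary point is, up to a constant, the length of `y₁` minus the distance along the boundary to the
edge (`height_bdry_bounds`), so the last two phases almost never lower the height. The curves at the
two ends of the edge depend on the normal forms alone, which gives consistency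
(`exists_edgeHomotopy`).

From normal fillings to combings: the projected edge homotopies agree at vertices and so define a
map on the 1-skeleton times the interval. It is continuous because it can be curried into a space of
paths (`exists_continuous_skeletonOne`). An edge read against its chosen direction uses the mirror
image of its diagram.

From combings to van Kampen homotopies: for a word, the diagrams of its letters are wedged at the
base point and folded along the simple paths that consecutive ones share (`exists_wedge`,
`exists_fold`, `exists_glue`). This yields a diagram with the given boundary word and a chain of
tame homotopies, one for each boundary edge, with matching ends (`exists_isShell`). It is not yet a
map on the boundary: a vertex that the boundary path visits several times comes with several curves.
Between two such visits the boundary path runs around a lobe attached at that cut vertex. Collapsing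
the lobe retracts the diagram, keeps curves tame, fixes the two curves in question because they
follow simple paths, and turns the intermediate homotopies into a homotopy between them through tame
curves with a fixed end point (`IsShell.joinedIn`). So one curve can be chosen for each vertex. The
lobe is found by homology: the Euler characteristic makes the first rational homology of the sphere
vanish, so a closed boundary subpath bounds a function on the 2-cells whose values single out the
lobe (`exists_dF_eq`, `exists_lobe`). -/

namespace TameFilling

namespace TwoComplex

universe u v w u' v' w'
variable {K : TwoComplex.{u, v, w}} {L : TwoComplex.{u', v', w'}}

/-! ### Cells and continuous maps -/

/-- The point with coordinates `(x, r)` in the `k`-th sector of the 2-cell `f`. -/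
def onSector (K : TwoComplex.{u, v, w}) (f : K.F) (k : Fin (K.bd f).length) (z : I × I) :
    K.Realization :=
  Quot.mk _ (Pre.sector f k z.1 z.2)

theorem Realization.ind {p : K.Realization → Prop} (hv : ∀ x, p (K.vtx x))
    (hd : ∀ d x, p (K.onEdge d x)) (hf : ∀ f k z, p (K.onSector f k z)) (q : K.Realization) :
    p q := by
  induction q using Quot.ind with
  | mk a =>
    rcases a with ⟨x, ⟨⟩⟩ | ⟨d, x⟩ | ⟨⟨f, k⟩, z⟩
    exacts [hv x, hd d x, hf f k z]

theorem continuous_mk : Continuous (Quot.mk K.Glue : K.Pre → K.Realization) :=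
  continuous_quot_mk

theorem continuous_onEdge (d : K.D) : Continuous (K.onEdge d) :=
  continuous_mk.comp (continuous_inr.comp (continuous_inl.comp continuous_sigmaMk))

theorem continuous_onSector (f : K.F) (k : Fin (K.bd f).length) :
    Continuous (K.onSector f k) := by
  have h : Continuous fun z : I × I => (Sum.inr (Sum.inr ⟨⟨f, k⟩, z⟩) : K.Pre) :=
    continuous_inr.comp (continuous_inr.comp
      (@continuous_sigmaMk _ (fun _ : (Σ f : K.F, Fin (K.bd f).length) => I × I) _ ⟨f, k⟩))
  exact continuous_mk.comp h

theorem onEdge_zero (d : K.D) : K.onEdge d 0 = K.vtx (K.src d) := Quot.sound (Glue.start d)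

theorem onEdge_rev (d : K.D) (x : I) : K.onEdge (K.rev d) (σ x) = K.onEdge d x :=
  (Quot.sound (Glue.rev d x)).symm

theorem onEdge_rev' (d : K.D) (x : I) : K.onEdge (K.rev d) x = K.onEdge d (σ x) := by
  rw [← onEdge_rev d (σ x), unitInterval.symm_symm]

theorem onEdge_one (d : K.D) : K.onEdge d 1 = K.vtx (K.tgt d) := by
  rw [← onEdge_rev d 1, unitInterval.symm_one, onEdge_zero, tgt]

theorem onSector_one (f : K.F) (k : Fin (K.bd f).length) (x : I) :
    K.onSector f k (x, 1) = K.onEdge ((K.bd f).get k) x := Quot.sound (Glue.side f k x)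

/-- The topology is a quotient topology, and vertices enter the disjoint union as discrete points,
so only edges and sectors impose conditions. Continuity can therefore be checked cell by cell. -/
theorem isOpen_iff_cells {U : Set K.Realization} :
    IsOpen U ↔ (∀ d, IsOpen (K.onEdge d ⁻¹' U)) ∧ ∀ f k, IsOpen (K.onSector f k ⁻¹' U) := by
  constructor
  · intro h
    exact ⟨fun d => h.preimage (continuous_onEdge d),
      fun f k => h.preimage (continuous_onSector f k)⟩
  · rintro ⟨hd, hf⟩
    have hq : Topology.IsQuotientMap (Quot.mk K.Glue : K.Pre → K.Realization) :=
      isQuotientMap_quot_mk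
    refine hq.isOpen_preimage.1 ?_
    rw [ isOpen_sum_iff, isOpen_sum_iff, isOpen_sigma_iff, isOpen_sigma_iff,
      isOpen_sigma_iff]
    exact ⟨fun x => isOpen_discrete _, fun d => hd d, fun s => hf s.1 s.2⟩

theorem continuous_of_cells {Y : Type*} [TopologicalSpace Y] {g : K.Realization → Y}
    (hd : ∀ d, Continuous fun x => g (K.onEdge d x))
    (hf : ∀ f k, Continuous fun z => g (K.onSector f k z)) : Continuous g := by
  rw [continuous_def]
  intro U hU
  exact isOpen_iff_cells.2 ⟨fun d => hU.preimage (hd d), fun f k => hU.preimage (hf f k)⟩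

/-! ### Cellular maps -/

namespace Hom

variable (φ : Hom K L)

theorem map_onSector (f : K.F) (k : Fin (K.bd f).length) (z : I × I) :
    φ.map (K.onSector f k z) = L.onSector (φ.onF f) (Fin.cast (φ.length_eq f) k) z := rfl

theorem continuous_map : Continuous φ.map :=
  continuous_of_cells (fun d => continuous_onEdge (φ.onD d))
    (fun f k => continuous_onSector (φ.onF f) (Fin.cast (φ.length_eq f) k))

theorem tgt_onD (d : K.D) : L.tgt (φ.onD d) = φ.onV (K.tgt d) := by
  rw [tgt, tgt, φ.rev_onD, φ.src_onD]

theorem map_skeletonOne {q : K.Realization} (hq : q ∈ K.skeletonOne) :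
    φ.map q ∈ L.skeletonOne := by
  rcases hq with ⟨x, rfl⟩ | ⟨d, x, rfl⟩
  · exact Or.inl ⟨_, rfl⟩
  · exact Or.inr ⟨_, _, rfl⟩

end Hom

/-! ### Real functions on a 2-complex -/

/-- The radial extension to the 2-cells of a function on the 1-skeleton. -/
def radialExt (val : K.V → ℝ) (e : K.D → I → ℝ) (c : K.F → ℝ)
    (h0 : ∀ d, e d 0 = val (K.src d)) (hr : ∀ d x, e (K.rev d) (σ x) = e d x) :
    K.Realization → ℝ :=
  Quot.lift (fun a => match a with
    | .inl ⟨x, _⟩ => val x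
    | .inr (.inl ⟨d, x⟩) => e d x
    | .inr (.inr ⟨⟨f, k⟩, (x, r)⟩) => r * e ((K.bd f).get k) x + (1 - r) * c f) (by
      intro p q h
      cases h with
      | start d => exact h0 d
      | rev d x => exact (hr d x).symm
      | centre f k k' x x' => simp
      | ray f k r =>
        have h1 : e ((K.bd f).get k) 1 = e ((K.bd f).get (cycSucc k)) 0 := by
          rw [← hr, unitInterval.symm_one, h0, h0, K.bd_closed f k]
        simp only [h1]
      | side f k x => simp)

section radialExt

variable (val : K.V → ℝ) (e : K.D → I → ℝ) (c : K.F → ℝ)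
    (h0 : ∀ d, e d 0 = val (K.src d)) (hr : ∀ d x, e (K.rev d) (σ x) = e d x)

theorem radialExt_onEdge (d : K.D) (x : I) : radialExt val e c h0 hr (K.onEdge d x) = e d x := rfl

theorem radialExt_onSector (f : K.F) (k : Fin (K.bd f).length) (z : I × I) :
    radialExt val e c h0 hr (K.onSector f k z) =
      z.2 * e ((K.bd f).get k) z.1 + (1 - z.2) * c f := rfl

theorem continuous_radialExt (he : ∀ d, Continuous (e d)) :
    Continuous (radialExt val e c h0 hr) := by
  refine continuous_of_cells (fun d => ?_) (fun f k => ?_)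
  · simpa only [radialExt_onEdge] using he d
  · simp only [radialExt_onSector]
    have := he ((K.bd f).get k)
    fun_prop

end radialExt

/-- The affine extension to edges, and radial extension to 2-cells, of a function on vertices. -/
def linExt (val : K.V → ℝ) (c : K.F → ℝ) : K.Realization → ℝ :=
  radialExt val (fun d x => (1 - x) * val (K.src d) + x * val (K.tgt d)) c
    (fun d => by simp) (fun d x => by simp [tgt, K.rev_rev]; ring)

theorem linExt_vtx (val : K.V → ℝ) (c : K.F → ℝ) (x : K.V) :
    linExt val c (K.vtx x) = val x := rfl

theorem linExt_onEdge (val : K.V → ℝ) (c : K.F → ℝ) (d : K.D) (x : I) :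
    linExt val c (K.onEdge d x) = (1 - x) * val (K.src d) + x * val (K.tgt d) := rfl

theorem linExt_onSector (val : K.V → ℝ) (c : K.F → ℝ) (f : K.F) (k : Fin (K.bd f).length)
    (z : I × I) : linExt val c (K.onSector f k z) =
      z.2 * ((1 - z.1) * val (K.src ((K.bd f).get k)) + z.1 * val (K.tgt ((K.bd f).get k))) +
        (1 - z.2) * c f := rfl

theorem continuous_linExt (val : K.V → ℝ) (c : K.F → ℝ) : Continuous (linExt val c) :=
  continuous_radialExt _ _ _ _ _ (fun d => by fun_prop)

/-- The affine extension of an indicator function separates vertices. Testing points against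
`linExt` serves below to tell points of the quotient apart without analysing the gluing relation. -/
theorem vtx_injective : Function.Injective K.vtx := by
  classical
  intro x y h
  have := congrArg (linExt (fun z => if z = x then (1 : ℝ) else 0) 0) h
  simp only [linExt_vtx, if_true] at this
  by_contra hne
  rw [if_neg (Ne.symm hne)] at this
  exact one_ne_zero this

/-! ### Edge paths -/

/-- The last vertex of the edge path `l` from `x`. -/
def pathEnd (K : TwoComplex.{u, v, w}) (x : K.V) : List K.D → K.V
  | [] => x
  | d :: l => K.pathEnd (K.tgt d) l

theorem IsPath.pathEnd_eq {x y : K.V} {l : List K.D} (h : K.IsPath x l y) :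
    K.pathEnd x l = y := by
  induction l generalizing x with
  | nil => exact h
  | cons d l ih => exact ih h.2

theorem isPath_append {x y : K.V} {l l' : List K.D} :
    K.IsPath x (l ++ l') y ↔ K.IsPath x l (K.pathEnd x l) ∧ K.IsPath (K.pathEnd x l) l' y := by
  induction l generalizing x with
  | nil => simp [IsPath, pathEnd]
  | cons d l ih => simp [IsPath, pathEnd, ih, and_assoc]

theorem IsPath.append {x y z : K.V} {l l' : List K.D} (h : K.IsPath x l y)
    (h' : K.IsPath y l' z) : K.IsPath x (l ++ l') z := by
  rw [isPath_append, h.pathEnd_eq]; exact ⟨h, h'⟩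

theorem pathEnd_append (x : K.V) (l l' : List K.D) :
    K.pathEnd x (l ++ l') = K.pathEnd (K.pathEnd x l) l' := by
  induction l generalizing x with
  | nil => rfl
  | cons d l ih => exact ih _

theorem revPath_append (l l' : List K.D) : K.revPath (l ++ l') = K.revPath l' ++ K.revPath l := by
  simp [revPath]

theorem revPath_cons (d : K.D) (l : List K.D) :
    K.revPath (d :: l) = K.revPath l ++ [K.rev d] := by simp [revPath]

theorem revPath_revPath (l : List K.D) : K.revPath (K.revPath l) = l := by
  simp [revPath, List.map_reverse, Function.comp_def, K.rev_rev]

theorem length_revPath (l : List K.D) : (K.revPath l).length = l.length := by simp [revPath]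

theorem tgt_rev (d : K.D) : K.tgt (K.rev d) = K.src d := by rw [tgt, K.rev_rev]

theorem mem_revPath {d : K.D} {l : List K.D} : d ∈ K.revPath l ↔ K.rev d ∈ l := by
  simp only [revPath, List.mem_reverse, List.mem_map]
  constructor
  · rintro ⟨a, ha, rfl⟩
    rwa [K.rev_rev]
  · exact fun h => ⟨_, h, K.rev_rev d⟩

theorem IsPath.revPath {x y : K.V} {l : List K.D} (h : K.IsPath x l y) :
    K.IsPath y (K.revPath l) x := by
  induction l generalizing x with
  | nil => exact Eq.symm h
  | cons d l ih =>
    rw [revPath_cons]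
    exact (ih h.2).append ⟨rfl, (tgt_rev d).trans h.1⟩

theorem Hom.isPath (φ : Hom K L) {x y : K.V} {l : List K.D} (h : K.IsPath x l y) :
    L.IsPath (φ.onV x) (l.map φ.onD) (φ.onV y) := by
  induction l generalizing x with
  | nil => exact congrArg φ.onV h
  | cons d l ih =>
    refine ⟨by rw [φ.src_onD, h.1], ?_⟩
    rw [φ.tgt_onD]
    exact ih h.2

theorem Hom.pathEnd_map (φ : Hom K L) (x : K.V) (l : List K.D) :
    L.pathEnd (φ.onV x) (l.map φ.onD) = φ.onV (K.pathEnd x l) := by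
  induction l generalizing x with
  | nil => rfl
  | cons d l ih =>
    simp only [List.map_cons, pathEnd]
    rw [φ.tgt_onD, ih]

theorem Hom.revPath_map (φ : Hom K L) (l : List K.D) :
    L.revPath (l.map φ.onD) = (K.revPath l).map φ.onD := by
  simp [TwoComplex.revPath, φ.rev_onD, Function.comp_def]

theorem Hom.map_pathPt (φ : Hom K L) (x : K.V) (l : List K.D) (s : ℝ) :
    φ.map (K.pathPt x l s) = L.pathPt (φ.onV x) (l.map φ.onD) s := by
  induction l generalizing x s with
  | nil => rfl
  | cons d l ih =>
    simp only [pathPt, List.map_cons]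
    split_ifs
    · rfl
    · rw [ih, φ.tgt_onD]

theorem pathPt_nonpos {x y : K.V} {l : List K.D} (h : K.IsPath x l y) {s : ℝ} (hs : s ≤ 0) :
    K.pathPt x l s = K.vtx x := by
  cases l with
  | nil => rfl
  | cons d l =>
    rw [pathPt, if_pos (hs.trans zero_le_one), Set.projIcc_of_le_left _ hs]
    exact (onEdge_zero d).trans (by rw [h.1])

theorem pathPt_of_length_le {x y : K.V} {l : List K.D} (h : K.IsPath x l y) {s : ℝ}
    (hs : l.length ≤ s) : K.pathPt x l s = K.vtx y := by
  induction l generalizing x s with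
  | nil => exact congrArg K.vtx h
  | cons d l ih =>
    simp only [List.length_cons, Nat.cast_add, Nat.cast_one] at hs
    rw [pathPt]
    split_ifs with h1
    -- The parameter is at most 1 and at least the length of the path, so this is the last edge.
    · have hl : (l.length : ℝ) = 0 := le_antisymm (by linarith) (Nat.cast_nonneg _)
      have hl' : l = [] := List.eq_nil_of_length_eq_zero (by exact_mod_cast hl)
      subst hl'
      rw [Set.projIcc_of_right_le _ (by simpa using hs)]
      exact (onEdge_one d).trans (congrArg K.vtx h.2)
    · exact ih h.2 (by linarith)

theorem continuous_pathPt {x y : K.V} {l : List K.D} (h : K.IsPath x l y) :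
    Continuous (K.pathPt x l) := by
  induction l generalizing x with
  | nil => exact continuous_const
  | cons d l ih =>
    refine Continuous.if_le ?_ ?_ continuous_id continuous_const ?_
    · exact (continuous_onEdge d).comp continuous_projIcc
    · exact (ih h.2).comp (by fun_prop)
    · rintro s rfl
      rw [Set.projIcc_right, pathPt_nonpos h.2 (by simp)]
      exact onEdge_one d

theorem pathPt_mem_skeletonOne (x : K.V) (l : List K.D) (s : ℝ) :
    K.pathPt x l s ∈ K.skeletonOne := by
  induction l generalizing x s with
  | nil => exact Or.inl ⟨_, rfl⟩
  | cons d l ih =>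
    rw [pathPt]
    split_ifs
    · exact Or.inr ⟨_, _, rfl⟩
    · exact ih _ _

theorem pathPt_append_left {x y z : K.V} {l l' : List K.D} (h : K.IsPath x l y)
    (h' : K.IsPath y l' z) {s : ℝ} (hs : s ≤ l.length) :
    K.pathPt x (l ++ l') s = K.pathPt x l s := by
  induction l generalizing x s with
  | nil =>
    rw [List.nil_append, h]
    exact pathPt_nonpos h' (by simpa using hs)
  | cons d l ih =>
    simp only [List.cons_append, pathPt]
    split_ifs
    · rfl
    · exact ih h.2 (by simp at hs; linarith)

theorem pathPt_append_right {x y z : K.V} {l l' : List K.D} (h : K.IsPath x l y)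
    (h' : K.IsPath y l' z) {s : ℝ} (hs : l.length ≤ s) :
    K.pathPt x (l ++ l') s = K.pathPt y l' (s - l.length) := by
  induction l generalizing x s with
  | nil =>
    rw [List.nil_append, h]; simp
  | cons d l ih =>
    simp only [List.length_cons, Nat.cast_add, Nat.cast_one] at hs
    simp only [List.cons_append, pathPt]
    split_ifs with h1
    · have hl : (l.length : ℝ) = 0 := le_antisymm (by linarith) (Nat.cast_nonneg _)
      have hl' : l = [] := List.eq_nil_of_length_eq_zero (by exact_mod_cast hl)
      subst hl'
      have hs1 : s = 1 := le_antisymm h1 (by simpa using hs)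
      subst hs1
      rw [pathPt_nonpos h' (by simp), Set.projIcc_right]
      exact (onEdge_one d).trans (congrArg K.vtx h.2)
    · rw [ih h.2 (by linarith)]
      congr 1
      push_cast [List.length_cons]
      ring

theorem pathPt_singleton (x : K.V) (d : K.D) {s : ℝ} (hs : s ≤ 1) :
    K.pathPt x [d] s = K.onEdge d (Set.projIcc 0 1 zero_le_one s) := by
  rw [pathPt, if_pos hs]

theorem pathPt_revPath {x y : K.V} {l : List K.D} (h : K.IsPath x l y) (s : ℝ) :
    K.pathPt y (K.revPath l) s = K.pathPt x l (l.length - s) := by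
  induction l generalizing x s with
  | nil => exact (congrArg K.vtx h).symm
  | cons d l ih =>
    have h2 : K.IsPath (K.tgt d) [K.rev d] x := ⟨rfl, (tgt_rev d).trans h.1⟩
    rw [revPath_cons]
    simp only [List.length_cons, Nat.cast_add, Nat.cast_one]
    -- The reversed first edge comes last on the reversed path, so the split is at the point where
    -- it begins.
    rcases le_total s l.length with hs | hs
    · rw [pathPt_append_left h.2.revPath h2 (by rwa [length_revPath]), ih h.2]
      rw [pathPt]
      split_ifs with h1
      · have : s = l.length := le_antisymm hs (by linarith)
        subst this
        rw [pathPt_nonpos h.2 (by simp)]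
        rw [add_sub_cancel_left, Set.projIcc_right]
        exact (onEdge_one d).symm
      · congr 1; ring
    · rw [pathPt_append_right h.2.revPath h2 (by rwa [length_revPath]), length_revPath,
        pathPt.eq_2 _ _ _ d, if_pos (by linarith)]
      rcases le_total (s - l.length) 1 with h3 | h3
      · rw [pathPt_singleton _ _ h3, onEdge_rev']
        congr 1
        have m1 : s - l.length ∈ Set.Icc (0 : ℝ) 1 := ⟨by linarith, h3⟩
        have m2 : (l.length : ℝ) + 1 - s ∈ Set.Icc (0 : ℝ) 1 := ⟨by linarith, by linarith⟩
        rw [Set.projIcc_of_mem _ m1, Set.projIcc_of_mem _ m2]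
        apply Subtype.ext
        simp only [unitInterval.coe_symm_eq]
        ring
      · rw [pathPt_of_length_le h2 (by simpa using h3), Set.projIcc_of_le_left _ (by linarith)]
        exact ((onEdge_zero d).trans (by rw [h.1])).symm

/-- If the vertex values grow by one along each edge, the affine extension recovers arc length; it
is then a left inverse of the parametrization of the path. -/
theorem linExt_pathPt (val : K.V → ℝ) (c : K.F → ℝ) {x : K.V} {l : List K.D} {m : ℝ}
    (hv : ∀ k ≤ l.length, val (K.pathEnd x (l.take k)) = m + k) {y : K.V}
    (h : K.IsPath x l y) {s : ℝ} (h0 : 0 ≤ s) (h1 : s ≤ l.length) :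
    linExt val c (K.pathPt x l s) = m + s := by
  induction l generalizing x s m with
  | nil =>
    have : s = 0 := le_antisymm (by simpa using h1) h0
    subst this
    simpa [pathEnd, pathPt, linExt_vtx] using hv 0 le_rfl
  | cons d l ih =>
    have e0 : val (K.src d) = m := by
      have := hv 0 (Nat.zero_le _)
      simpa [pathEnd, h.1] using this
    have e1 : val (K.tgt d) = m + 1 := by
      have := hv 1 (by simp)
      simpa [pathEnd] using this
    simp only [List.length_cons, Nat.cast_add, Nat.cast_one] at h1
    rw [pathPt]
    split_ifs with hs
    · rw [linExt_onEdge, Set.projIcc_of_mem _ ⟨h0, hs⟩, e0, e1]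
      ring
    · rw [ih (m := m + 1) ?_ h.2 (by linarith) (by linarith)]
      · ring
      · intro k hk
        have := hv (k + 1) (by simpa using hk)
        simpa [pathEnd, add_comm, add_left_comm] using this

/-- A simple edge path is traversed injectively. -/
theorem pathPt_injOn {x y : K.V} {l : List K.D} (h : K.IsPath x l y)
    (hs : ∀ j ≤ l.length, ∀ k ≤ l.length,
      K.pathEnd x (l.take j) = K.pathEnd x (l.take k) → j = k) :
    Set.InjOn (K.pathPt x l) (Set.Icc 0 l.length) := by
  classical
  -- The position of a vertex on the path, with an irrelevant value off the path.
  let val : K.V → ℝ := fun z =>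
    if hz : ∃ k, k ≤ l.length ∧ K.pathEnd x (l.take k) = z then (hz.choose : ℝ) else 0
  have hv : ∀ k ≤ l.length, val (K.pathEnd x (l.take k)) = 0 + k := by
    intro k hk
    have hz : ∃ j, j ≤ l.length ∧ K.pathEnd x (l.take j) = K.pathEnd x (l.take k) := ⟨k, hk, rfl⟩
    have := hs _ hz.choose_spec.1 _ hk hz.choose_spec.2
    simp only [val]
    rw [dif_pos hz, this, zero_add]
  intro s hs' t ht' e
  have := congrArg (linExt val 0) e
  rw [linExt_pathPt val 0 hv h hs'.1 hs'.2, linExt_pathPt val 0 hv h ht'.1 ht'.2] at this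
  simpa using this

end TwoComplex

end TameFilling

namespace TameFilling

/-! ### Shifting functions on `ℕ[1/4]` -/

/-- The element `q + c` of `ℕ[1/4]`. -/
def QuarterNat.addNat (q : QuarterNat) (c : ℕ) : QuarterNat :=
  ⟨q + c, by
    obtain ⟨q, n, rfl⟩ := q
    exact ⟨n + 4 * c, by push_cast; ring⟩⟩

/-- The function `q ↦ f (q + c) + c`. -/
def shift (c : ℕ) (f : QuarterNat → QuarterNat) (q : QuarterNat) : QuarterNat :=
  (f (q.addNat c)).addNat c

theorem QuarterNat.coe_nonneg (q : QuarterNat) : (0 : ℚ) ≤ q := by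
  obtain ⟨q, n, rfl⟩ := q
  positivity

theorem coe_shift (c : ℕ) (f : QuarterNat → QuarterNat) (q : QuarterNat) :
    (shift c f q : ℚ) = f (q.addNat c) + c := rfl

theorem monotone_shift {c : ℕ} {f : QuarterNat → QuarterNat} (hf : Monotone f) :
    Monotone (shift c f) := by
  intro a b hab
  have hab' : (a : ℚ) ≤ b := hab
  have h : a.addNat c ≤ b.addNat c := by
    change (a : ℚ) + c ≤ b + c
    linarith
  have h2 : (f (a.addNat c) : ℚ) ≤ f (b.addNat c) := hf h
  change (f (a.addNat c) : ℚ) + c ≤ f (b.addNat c) + c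
  linarith

/-- This is how bounded errors are absorbed: one in the argument of `f` and one in its value, both
at most `c`. -/
theorem le_shift {f : QuarterNat → QuarterNat} (hf : Monotone f) {c : ℕ} {a b b' : QuarterNat}
    (h : (b : ℚ) ≤ b' + c) (h' : (a : ℚ) ≤ f b + c) : a ≤ shift c f b' := by
  have hb : b ≤ b'.addNat c := h
  have h2 : (f b : ℚ) ≤ f (b'.addNat c) := hf hb
  change (a : ℚ) ≤ f (b'.addNat c) + c
  linarith

theorem le_shift_self {f : QuarterNat → QuarterNat} (hf : Monotone f) (c : ℕ) (q : QuarterNat) :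
    f q ≤ shift c f q :=
  le_shift hf (b := q) (by simp) (by simp)

theorem shift_le_shift {f : QuarterNat → QuarterNat} (hf : Monotone f) {c c' : ℕ} (h : c ≤ c')
    (q : QuarterNat) : shift c f q ≤ shift c' f q := by
  have hc : (c : ℚ) ≤ c' := by exact_mod_cast h
  refine le_shift hf (b := q.addNat c) ?_ ?_
  · change (q : ℚ) + c ≤ q + c'
    linarith
  · rw [coe_shift]
    linarith

/-- The constant `C (c + 1) + C + c` leaves room for `C (n + c) + C` in the argument and for `C + c`
in the value. -/
theorem LipschitzEquivalent.shift {f g : QuarterNat → QuarterNat} (hf : Monotone f)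
    (hg : Monotone g) (h : LipschitzEquivalent f g) (c : ℕ) :
    LipschitzEquivalent f (shift c g) := by
  obtain ⟨C, hC⟩ := h
  refine ⟨C * (c + 1) + C + c, fun n => ⟨(hC n).1.trans ?_, ?_⟩⟩
  · have hn := n.coe_nonneg
    have h1 : TameFilling.affine C n ≤ TameFilling.affine (C * (c + 1) + C + c) n := by
      change (C : ℚ) * n + C ≤ ((C * (c + 1) + C + c : ℕ) : ℚ) * n + (C * (c + 1) + C + c : ℕ)
      push_cast
      nlinarith [mul_nonneg (Nat.cast_nonneg (α := ℚ) C) (Nat.cast_nonneg (α := ℚ) c),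
        mul_nonneg (Nat.cast_nonneg (α := ℚ) C) hn, mul_nonneg (Nat.cast_nonneg (α := ℚ) c) hn,
        mul_nonneg (mul_nonneg (Nat.cast_nonneg (α := ℚ) C) (Nat.cast_nonneg (α := ℚ) c)) hn,
        Nat.cast_nonneg (α := ℚ) C, Nat.cast_nonneg (α := ℚ) c]
    have h2 : (g (TameFilling.affine C n) : ℚ) ≤
        TameFilling.shift c g (TameFilling.affine (C * (c + 1) + C + c) n) :=
      (hg h1).trans (le_shift_self hg c _)
    generalize TameFilling.shift c g (TameFilling.affine (C * (c + 1) + C + c) n) = X at *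
    have hX := X.coe_nonneg
    have hC0 : (0 : ℚ) ≤ C := Nat.cast_nonneg _
    have hc0 : (0 : ℚ) ≤ c := Nat.cast_nonneg _
    have h3 : (C : ℚ) * g (TameFilling.affine C n) ≤ C * X := mul_le_mul_of_nonneg_left h2 hC0
    push_cast
    nlinarith [mul_nonneg hC0 hc0, mul_nonneg hC0 hX, mul_nonneg hc0 hX,
      mul_nonneg (mul_nonneg hC0 hc0) hX]
  · have hn := n.coe_nonneg
    have h1 : TameFilling.affine C (n.addNat c) ≤
        TameFilling.affine (C * (c + 1) + C + c) n := by
      change (C : ℚ) * (n + c) + C ≤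
        ((C * (c + 1) + C + c : ℕ) : ℚ) * n + (C * (c + 1) + C + c : ℕ)
      push_cast
      nlinarith [mul_nonneg (Nat.cast_nonneg (α := ℚ) C) (Nat.cast_nonneg (α := ℚ) c),
        mul_nonneg (Nat.cast_nonneg (α := ℚ) C) hn, mul_nonneg (Nat.cast_nonneg (α := ℚ) c) hn,
        mul_nonneg (mul_nonneg (Nat.cast_nonneg (α := ℚ) C) (Nat.cast_nonneg (α := ℚ) c)) hn,
        Nat.cast_nonneg (α := ℚ) C, Nat.cast_nonneg (α := ℚ) c]
    have h2 : (f (TameFilling.affine C (n.addNat c)) : ℚ) ≤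
        f (TameFilling.affine (C * (c + 1) + C + c) n) := hf h1
    have h3 := (hC (n.addNat c)).2
    rw [coe_shift]
    generalize f (TameFilling.affine (C * (c + 1) + C + c) n) = X at *
    have hX := X.coe_nonneg
    have hC0 : (0 : ℚ) ≤ C := Nat.cast_nonneg _
    have hc0 : (0 : ℚ) ≤ c := Nat.cast_nonneg _
    have h4 : (C : ℚ) * f (TameFilling.affine C (n.addNat c)) ≤ C * X :=
      mul_le_mul_of_nonneg_left h2 hC0
    push_cast
    nlinarith [mul_nonneg hC0 hc0, mul_nonneg hC0 hX, mul_nonneg hc0 hX,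
      mul_nonneg (mul_nonneg hC0 hc0) hX]

theorem UpToLipschitz.imp {Q Q' : (QuarterNat → QuarterNat) → Prop}
    {f : QuarterNat → QuarterNat} (hf : Monotone f) (c : ℕ)
    (h : ∀ g, Monotone g → Q g → Q' (shift c g)) (hQ : UpToLipschitz Q f) :
    UpToLipschitz Q' f := by
  obtain ⟨g, hg, hfg, hQg⟩ := hQ
  exact ⟨shift c g, monotone_shift hg, hfg.shift hf hg c, h g hg hQg⟩

namespace TwoComplex

universe u v w u' v' w'
variable {K : TwoComplex.{u, v, w}}

/-! ### Distances and coarse distances -/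

theorem dist_le_length {x y : K.V} {l : List K.D} (h : K.IsPath x l y) :
    K.dist x y ≤ l.length := Nat.sInf_le ⟨l, h, rfl⟩

theorem exists_isPath_length {x y : K.V} {l : List K.D} (h : K.IsPath x l y) :
    ∃ l', K.IsPath x l' y ∧ l'.length = K.dist x y :=
  Nat.sInf_mem (s := {n | ∃ l, K.IsPath x l y ∧ l.length = n}) ⟨_, l, h, rfl⟩

theorem dist_self (x : K.V) : K.dist x x = 0 :=
  Nat.le_zero.1 (dist_le_length (l := []) rfl)

/-- Every vertex can be reached from `x`. -/
def ReachableFrom (K : TwoComplex.{u, v, w}) (x : K.V) : Prop := ∀ y, ∃ l, K.IsPath x l y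

theorem ReachableFrom.dist_le_add {x : K.V} (h : K.ReachableFrom x) {y z : K.V} {l : List K.D}
    (hl : K.IsPath y l z) : K.dist x z ≤ K.dist x y + l.length := by
  obtain ⟨l', h1⟩ := h y
  obtain ⟨l'', h2, h3⟩ := exists_isPath_length h1
  rw [← h3, ← List.length_append]
  exact dist_le_length (h2.append hl)

theorem ReachableFrom.dist_tgt_le {x : K.V} (h : K.ReachableFrom x) (d : K.D) :
    K.dist x (K.tgt d) ≤ K.dist x (K.src d) + 1 :=
  h.dist_le_add (l := [d]) ⟨rfl, rfl⟩

theorem ReachableFrom.dist_src_le {x : K.V} (h : K.ReachableFrom x) (d : K.D) :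
    K.dist x (K.src d) ≤ K.dist x (K.tgt d) + 1 :=
  h.dist_le_add (l := [K.rev d]) ⟨rfl, tgt_rev d⟩

theorem coarseDist_vtx (y x : K.V) : (K.coarseDist y (K.vtx x) : ℚ) = K.dist y x := by
  change (((4 * K.dist y x : ℕ) : ℚ)) / 4 = _
  push_cast
  ring

theorem coarseDist_onEdge (y : K.V) (d : K.D) {x : I} (h0 : x ≠ 0) (h1 : x ≠ 1) :
    (K.coarseDist y (K.onEdge d x) : ℚ) =
      min (K.dist y (K.src d) : ℚ) (K.dist y (K.tgt d)) + 1 / 2 := by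
  have : K.coarseDist y (K.onEdge d x) = K.edgeCoarse y d x := rfl
  rw [this, edgeCoarse, if_neg h0, if_neg h1]
  change ((4 * min (K.dist y (K.src d)) (K.dist y (K.tgt d)) + 2 : ℕ) : ℚ) / 4 = _
  push_cast
  ring

theorem coarseDist_onSector (y : K.V) (f : K.F) (k : Fin (K.bd f).length) {z : I × I}
    (h1 : z.2 ≠ 1) : (K.coarseDist y (K.onSector f k z) : ℚ) = K.faceQuarters y f / 4 := by
  have : K.coarseDist y (K.onSector f k z) =
    if z.2 = 1 then K.edgeCoarse y ((K.bd f).get k) z.1 else ofQuarters (K.faceQuarters y f) := rfl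
  rw [this, if_neg h1]
  rfl

theorem eq_of_mem_endpoint_or (K : TwoComplex.{u, v, w}) (d : K.D) (x : I) :
    K.onEdge d x = K.vtx (K.src d) ∨ K.onEdge d x = K.vtx (K.tgt d) ∨ (x ≠ 0 ∧ x ≠ 1) := by
  by_cases h0 : x = 0
  · exact Or.inl (h0 ▸ onEdge_zero d)
  · by_cases h1 : x = 1
    · exact Or.inr (Or.inl (h1 ▸ onEdge_one d))
    · exact Or.inr (Or.inr ⟨h0, h1⟩)

/-- The coarse distance at a point of the 1-skeleton exceeds the distance of a vertex of its cell
by at most `1/2`. -/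
theorem exists_vtx_coarseDist_le (y : K.V) {q : K.Realization} (hq : q ∈ K.skeletonOne) :
    ∃ x, (K.dist y x : ℚ) ≤ K.coarseDist y q ∧ (K.coarseDist y q : ℚ) ≤ K.dist y x + 1 / 2 := by
  have hv : ∀ x, ∃ x', (K.dist y x' : ℚ) ≤ K.coarseDist y (K.vtx x) ∧
      (K.coarseDist y (K.vtx x) : ℚ) ≤ K.dist y x' + 1 / 2 := by
    intro x
    refine ⟨x, ?_⟩
    rw [coarseDist_vtx]
    constructor <;> linarith
  rcases hq with ⟨x, rfl⟩ | ⟨d, x, rfl⟩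
  · exact hv x
  · rcases K.eq_of_mem_endpoint_or d x with h | h | ⟨h0, h1⟩
    · rw [h]; exact hv _
    · rw [h]; exact hv _
    · rw [coarseDist_onEdge y d h0 h1]
      rcases le_total (K.dist y (K.src d)) (K.dist y (K.tgt d)) with hle | hle
      · refine ⟨K.src d, ?_⟩
        rw [min_eq_left (by exact_mod_cast hle)]
        constructor <;> linarith
      · refine ⟨K.tgt d, ?_⟩
        rw [min_eq_right (by exact_mod_cast hle)]
        constructor <;> linarith

theorem ReachableFrom.coarseDist_onEdge_bounds {y : K.V} (h : K.ReachableFrom y) (d : K.D)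
    (x : I) : (K.dist y (K.src d) : ℚ) - 1 ≤ K.coarseDist y (K.onEdge d x) ∧
      (K.coarseDist y (K.onEdge d x) : ℚ) ≤ K.dist y (K.src d) + 1 := by
  have h1 : (K.dist y (K.tgt d) : ℚ) ≤ K.dist y (K.src d) + 1 := by
    exact_mod_cast h.dist_tgt_le d
  have h2 : (K.dist y (K.src d) : ℚ) ≤ K.dist y (K.tgt d) + 1 := by
    exact_mod_cast h.dist_src_le d
  rcases K.eq_of_mem_endpoint_or d x with h' | h' | ⟨h0, h1'⟩
  · rw [h', coarseDist_vtx]; constructor <;> linarith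
  · rw [h', coarseDist_vtx]; constructor <;> linarith
  · rw [coarseDist_onEdge y d h0 h1']
    rcases le_total (K.dist y (K.src d) : ℚ) (K.dist y (K.tgt d)) with hle | hle
    · rw [min_eq_left hle]; constructor <;> linarith
    · rw [min_eq_right hle]; constructor <;> linarith

/-- Along an edge path that moves away from `y`, the coarse distance is the arc length up to an
error of at most `1`. -/
theorem coarseDist_pathPt {y x z : K.V}
    {l : List K.D} {m : ℕ} (hl : K.IsPath x l z)
    (hd : ∀ k ≤ l.length, K.dist y (K.pathEnd x (l.take k)) = m + k) {s : ℝ} (h0 : 0 ≤ s)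
    (h1 : s ≤ l.length) :
    m + s - 1 ≤ ((K.coarseDist y (K.pathPt x l s) : ℚ) : ℝ) ∧
      ((K.coarseDist y (K.pathPt x l s) : ℚ) : ℝ) ≤ m + s + 1 := by
  induction l generalizing x s m with
  | nil =>
    have : s = 0 := le_antisymm (by simpa using h1) h0
    subst this
    have e := hd 0 le_rfl
    simp only [List.take_nil, pathEnd, add_zero] at e
    rw [pathPt, coarseDist_vtx, e]
    push_cast
    constructor <;> linarith
  | cons d l ih =>
    have e0 : K.dist y (K.src d) = m := by
      have := hd 0 (Nat.zero_le _)
      simpa [pathEnd, hl.1] using this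
    simp only [List.length_cons, Nat.cast_add, Nat.cast_one] at h1
    rw [pathPt]
    split_ifs with hs
    · by_cases hs1 : s = 1
      · subst hs1
        have e1 : K.dist y (K.tgt d) = m + 1 := by simpa [pathEnd] using hd 1 (by simp)
        rw [Set.projIcc_right]
        have := onEdge_one d
        change K.onEdge d ⟨1, _⟩ = _ at this
        rw [this, coarseDist_vtx, e1]
        push_cast
        constructor <;> linarith
      · by_cases hs0 : s = 0
        · subst hs0
          rw [Set.projIcc_left]
          have := onEdge_zero d
          change K.onEdge d ⟨0, _⟩ = _ at this
          rw [this, coarseDist_vtx, e0]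
          push_cast
          constructor <;> linarith
        · have e1 : K.dist y (K.tgt d) = m + 1 := by simpa [pathEnd] using hd 1 (by simp)
          rw [Set.projIcc_of_mem _ ⟨h0, hs⟩, coarseDist_onEdge, e0, e1]
          · have : min (m : ℚ) ((m + 1 : ℕ) : ℚ) = m := min_eq_left (by push_cast; linarith)
            rw [this]
            push_cast
            constructor <;> linarith
          · exact fun h => hs0 (congrArg Subtype.val h)
          · exact fun h => hs1 (congrArg Subtype.val h)
    · have := ih (x := K.tgt d) (m := m + 1) (s := s - 1) hl.2 ?_ (by linarith) (by linarith)
      · push_cast at this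
        constructor <;> linarith [this.1, this.2]
      · intro k hk
        have := hd (k + 1) (by simpa using hk)
        simpa [pathEnd, add_comm, add_left_comm] using this

/-- A continuous path that ends at a vertex `x` visits points of coarse distance at least that of
`x` minus `1` strictly before its end. -/
theorem ReachableFrom.exists_lt_coarseDist {y : K.V} (h : K.ReachableFrom y) {x : K.V}
    {c : I → K.Realization} (hc : Continuous c) (h1 : c 1 = K.vtx x) :
    ∃ s < 1, (K.dist y x : ℚ) ≤ K.coarseDist y (c s) + 1 := by
  classical
  -- A bump function that is positive exactly on the points near the vertex that matter: just before
  -- its end, the curve lies in a cell having `x` among its vertices.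
  let b : K.Realization → ℝ := linExt (fun z => if z = x then 1 else 0) 0
  have hb : Continuous b := continuous_linExt _ _
  have hb1 : 0 < b (c 1) := by rw [h1]; simp [b, linExt_vtx]
  have hop : IsOpen {s : I | 0 < b (c s)} := isOpen_lt continuous_const (hb.comp hc)
  obtain ⟨s, hs1, hs⟩ : ∃ s : I, s < 1 ∧ 0 < b (c s) := by
    have hcl : (1 : I) ∈ closure (Set.Iio (1 : I)) := by
      have hne : (Set.Iio (1 : I)).Nonempty := ⟨0, by simp⟩
      rw [closure_Iio' hne]
      simp
    obtain ⟨s, hs, hs'⟩ := mem_closure_iff.1 hcl _ hop hb1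
    exact ⟨s, hs', hs⟩
  refine ⟨s, hs1, ?_⟩
  have hedge : ∀ (d : K.D) (t : I),
      0 < (1 - (t : ℝ)) * (if K.src d = x then 1 else 0) + t * (if K.tgt d = x then 1 else 0) →
      K.src d = x ∨ K.tgt d = x := by
    intro d t ht
    by_contra hcon
    push Not at hcon
    rw [if_neg hcon.1, if_neg hcon.2] at ht
    simp at ht
  have hmin : ∀ d : K.D, (K.src d = x ∨ K.tgt d = x) →
      K.dist y x ≤ min (K.dist y (K.src d)) (K.dist y (K.tgt d)) + 1 := by
    intro d hd
    have h1 := h.dist_tgt_le d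
    have h2 := h.dist_src_le d
    rcases hd with rfl | rfl <;> omega
  generalize c s = q at hs
  revert hs
  induction q using Realization.ind with
  | hv z =>
    intro hs
    have : z = x := by
      by_contra hne
      simp [b, linExt_vtx, hne] at hs
    rw [this, coarseDist_vtx]
    linarith
  | hd d t =>
    intro hs
    have hd := hmin d (hedge d t hs)
    have h1 : (K.dist y x : ℚ) ≤ min (K.dist y (K.src d) : ℚ) (K.dist y (K.tgt d)) + 1 := by
      exact_mod_cast hd
    rcases K.eq_of_mem_endpoint_or d t with h' | h' | ⟨h0, h1'⟩
    · rw [h', coarseDist_vtx]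
      linarith [min_le_left (K.dist y (K.src d) : ℚ) (K.dist y (K.tgt d))]
    · rw [h', coarseDist_vtx]
      linarith [min_le_right (K.dist y (K.src d) : ℚ) (K.dist y (K.tgt d))]
    · rw [coarseDist_onEdge y d h0 h1']
      linarith
  | hf f k z =>
    intro hs
    have hz : 0 < (z.2 : ℝ) * ((1 - (z.1 : ℝ)) * (if K.src ((K.bd f).get k) = x then 1 else 0) +
        z.1 * (if K.tgt ((K.bd f).get k) = x then 1 else 0)) := by
      have := linExt_onSector (fun z => if z = x then (1 : ℝ) else 0) 0 f k z
      change 0 < linExt _ _ _ at hs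
      rw [this] at hs
      simpa using hs
    have hd := hmin _ (hedge ((K.bd f).get k) z.1 (pos_of_mul_pos_right hz z.2.2.1))
    by_cases hz1 : z.2 = 1
    · have : K.onSector f k z = K.onEdge ((K.bd f).get k) z.1 := by
        rw [← onSector_one, ← hz1]
      rw [this]
      have h1 : (K.dist y x : ℚ) ≤ min (K.dist y (K.src ((K.bd f).get k)) : ℚ)
          (K.dist y (K.tgt ((K.bd f).get k))) + 1 := by
        exact_mod_cast hd
      rcases K.eq_of_mem_endpoint_or ((K.bd f).get k) z.1 with h' | h' | ⟨h0, h1'⟩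
      · rw [h', coarseDist_vtx]
        linarith [min_le_left (K.dist y (K.src ((K.bd f).get k)) : ℚ)
          (K.dist y (K.tgt ((K.bd f).get k)))]
      · rw [h', coarseDist_vtx]
        linarith [min_le_right (K.dist y (K.src ((K.bd f).get k)) : ℚ)
          (K.dist y (K.tgt ((K.bd f).get k)))]
      · rw [coarseDist_onEdge y _ h0 h1']
        linarith
    -- A side ending at `x` has at least `4 (dist - 1) + 2` quarters, and a 2-cell loses only one
    -- quarter from the maximum over its sides.
    · rw [coarseDist_onSector y f k hz1]
      have hsup : K.edgeQuarters y ((K.bd f).get k) ≤ Finset.univ.sup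
          fun k : Fin (K.bd f).length => K.edgeQuarters y ((K.bd f).get k) :=
        Finset.le_sup (f := fun k : Fin (K.bd f).length => K.edgeQuarters y ((K.bd f).get k))
          (Finset.mem_univ k)
      have : 4 * K.dist y x ≤ K.faceQuarters y f + 4 := by
        rw [faceQuarters]
        rw [edgeQuarters] at hsup
        omega
      have : (4 : ℚ) * K.dist y x ≤ K.faceQuarters y f + 4 := by exact_mod_cast this
      linarith

end TwoComplex

end TameFilling

namespace TameFilling

universe u v
variable {G : Type u} {A : Type v} [Group G]

/-! ### Words and the group elements they represent -/

namespace SymmetrizedPresentation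

variable (P : SymmetrizedPresentation G A)

theorem eval_nil : P.eval [] = 1 := rfl

theorem eval_cons (a : A) (l : List A) : P.eval (a :: l) = P.val a * P.eval l := by
  simp [eval]

theorem eval_append (l l' : List A) : P.eval (l ++ l') = P.eval l * P.eval l' := by
  simp [eval]

theorem eval_invWord (l : List A) : P.eval (P.invWord l) = (P.eval l)⁻¹ := by
  induction l with
  | nil => simp [eval, invWord]
  | cons a l ih =>
    have : P.invWord (a :: l) = P.invWord l ++ [P.inv a] := by simp [invWord]
    rw [this, eval_append, ih, eval_cons, eval_cons, eval_nil, P.val_inv]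
    group

theorem invWord_invWord (l : List A) : P.invWord (P.invWord l) = l := by
  simp [invWord, List.map_reverse, Function.comp_def, P.inv_inv]

theorem length_invWord (l : List A) : (P.invWord l).length = l.length := by simp [invWord]

theorem exists_eval_eq (g : G) : ∃ l, P.eval l = g := by
  obtain ⟨x, rfl⟩ := P.generates g
  induction x using FreeGroup.induction_on with
  | C1 => exact ⟨[], by simp [eval]⟩
  | of a => exact ⟨[a], by simp [eval]⟩
  | inv_of a _ => exact ⟨[P.inv a], by simp [eval, P.val_inv]⟩
  | mul x y hx hy =>
    obtain ⟨l, hl⟩ := hx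
    obtain ⟨l', hl'⟩ := hy
    exact ⟨l ++ l', by rw [eval_append, hl, hl', map_mul]⟩

/-! ### The Cayley complex -/

theorem tgt_cayley (d : G × A) : P.cayley.tgt d = d.1 * P.val d.2 := rfl

theorem isPath_pathFrom (g : G) (l : List A) :
    P.cayley.IsPath g (P.pathFrom g l) (g * P.eval l) := by
  induction l generalizing g with
  | nil => exact (mul_one g).symm
  | cons a l ih =>
    refine ⟨rfl, ?_⟩
    rw [eval_cons, ← mul_assoc]
    exact ih _

theorem isPath_pathFrom' {g h : G} {l : List A} (e : g * P.eval l = h) :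
    P.cayley.IsPath g (P.pathFrom g l) h := e ▸ P.isPath_pathFrom g l

theorem eq_pathFrom_of_isPath {g h : G} {l : List (G × A)} (hl : P.cayley.IsPath g l h) :
    l = P.pathFrom g (l.map Prod.snd) := by
  induction l generalizing g with
  | nil => rfl
  | cons d l ih =>
    have h1 : d.1 = g := hl.1
    rw [List.map_cons, pathFrom]
    have h2 := ih hl.2
    rw [tgt_cayley, h1] at h2
    rw [← h2]
    exact congrArg (· :: l) (Prod.ext h1 rfl)

theorem take_pathFrom (g : G) (l : List A) (k : ℕ) :
    (P.pathFrom g l).take k = P.pathFrom g (l.take k) := by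
  induction l generalizing g k with
  | nil => simp [pathFrom]
  | cons a l ih =>
    cases k with
    | zero => rfl
    | succ k => simp [pathFrom, ih]

theorem length_cayleyPath (g : G) (l : List A) :
    List.length (α := P.cayley.D) (P.pathFrom g l) = l.length := P.length_pathFrom g l

theorem take_cayleyPath (g : G) (l : List A) (k : ℕ) :
    List.take (α := P.cayley.D) k (P.pathFrom g l) = P.pathFrom g (l.take k) :=
  P.take_pathFrom g l k

theorem pathEnd_pathFrom (g : G) (l : List A) :
    P.cayley.pathEnd g (P.pathFrom g l) = g * P.eval l :=
  (P.isPath_pathFrom g l).pathEnd_eq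

theorem reachable : P.cayley.ReachableFrom (1 : G) := by
  intro g
  obtain ⟨l, rfl⟩ := P.exists_eval_eq g
  exact ⟨_, P.isPath_pathFrom' (one_mul _)⟩

/-! ### Geodesic and simple words -/

theorem exists_isGeodesic (g : G) : ∃ l, P.eval l = g ∧ P.IsGeodesic l := by
  obtain ⟨l, hl⟩ := P.reachable g
  obtain ⟨l', h1, h2⟩ := TwoComplex.exists_isPath_length hl
  have h3 := P.eq_pathFrom_of_isPath h1
  have h4 : P.eval (l'.map Prod.snd) = g := by
    have := h1.pathEnd_eq
    rw [h3, pathEnd_pathFrom, one_mul] at this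
    exact this
  exact ⟨l'.map Prod.snd, h4, by
    rw [IsGeodesic, h4]
    exact (List.length_map _).trans h2⟩

theorem dist_eval_le (l : List A) : P.cayley.dist (1 : G) (P.eval l) ≤ l.length := by
  have := TwoComplex.dist_le_length (P.isPath_pathFrom' (one_mul (P.eval l)))
  rwa [P.length_cayleyPath] at this

-- A shortcut to the end of a prefix, followed by the remaining letters, would shorten the whole
-- word.
variable {P} in
theorem IsGeodesic.dist_take {l : List A} (h : P.IsGeodesic l) {k : ℕ} (hk : k ≤ l.length) :
    P.cayley.dist (1 : G) (P.eval (l.take k)) = k := by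
  apply le_antisymm
  · refine (P.dist_eval_le _).trans ?_
    rw [List.length_take]
    exact min_le_left _ _
  · have h1 := P.reachable.dist_le_add (P.isPath_pathFrom (P.eval (l.take k)) (l.drop k))
    rw [← P.eval_append, List.take_append_drop, P.length_cayleyPath, List.length_drop] at h1
    have h2 : l.length = P.cayley.dist (1 : G) (P.eval l) := h
    omega

theorem isSimple_iff {l : List A} : P.IsSimple l ↔ ∀ j ≤ l.length, ∀ k ≤ l.length,
    P.eval (l.take j) = P.eval (l.take k) → j = k := by
  have hi : l.inits = (List.range (l.length + 1)).map (fun k => l.take k) := by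
    apply List.ext_getElem
    · simp
    · intro i h1 h2
      simp [List.getElem_inits]
  rw [IsSimple, hi, List.map_map, List.nodup_map_iff_inj_on List.nodup_range]
  simp only [List.mem_range, Nat.lt_succ_iff, Function.comp]

variable {P} in
theorem IsGeodesic.isSimple {l : List A} (h : P.IsGeodesic l) : P.IsSimple l := by
  rw [isSimple_iff]
  intro j hj k hk e
  rw [← h.dist_take hj, ← h.dist_take hk, e]

-- The first and the last vertex coincide, so a simple word has no letters. This is what keeps the
-- curves to the base point constant.
variable {P} in
theorem IsSimple.eq_nil {l : List A} (h : P.IsSimple l) (h1 : P.eval l = 1) : l = [] := by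
  have := P.isSimple_iff.1 h 0 (Nat.zero_le _) l.length le_rfl (by simpa [eval] using h1.symm)
  exact List.eq_nil_of_length_eq_zero this.symm

variable {P} in
theorem IsSimple.pathPt_injOn {l : List A} (h : P.IsSimple l) :
    Set.InjOn (P.cayley.pathPt (1 : G) (P.pathFrom 1 l)) (Set.Icc 0 l.length) := by
  have := TwoComplex.pathPt_injOn (P.isPath_pathFrom' (one_mul (P.eval l))) (by
    intro j hj k hk e
    rw [P.length_cayleyPath] at hj hk
    rw [P.take_cayleyPath, P.take_cayleyPath, P.pathEnd_pathFrom, P.pathEnd_pathFrom] at e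
    exact P.isSimple_iff.1 h j hj k hk (mul_left_cancel e))
  rwa [P.length_cayleyPath] at this

/-- In the height of the Cayley complex, points on edges are bounded by a function that bounds the
vertices. -/
theorem height_le_of_vertices {f : QuarterNat → QuarterNat} (hf : Monotone f)
    (h : ∀ g : G, ∃ q : QuarterNat, (P.cayley.dist (1 : G) g : ℚ) ≤ q + 1 ∧
      q ≤ f (ofQuarters (4 * P.cayley.dist (1 : G) g)))
    {q : P.cayley.Realization} (hq : q ∈ P.cayley.skeletonOne) :
    (P.height q : ℚ) ≤ f (P.height q) + 2 := by
  obtain ⟨x, h1, h2⟩ := TwoComplex.exists_vtx_coarseDist_le (1 : G) hq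
  obtain ⟨r, h3, h4⟩ := h x
  have h5 : ofQuarters (4 * P.cayley.dist (1 : G) x) ≤ P.height q := by
    change ((4 * P.cayley.dist (1 : G) x : ℕ) : ℚ) / 4 ≤ P.cayley.coarseDist (1 : G) q
    push_cast
    linarith
  have h6 : (r : ℚ) ≤ f (P.height q) := h4.trans (hf h5)
  have h7 : (P.height q : ℚ) ≤ P.cayley.dist (1 : G) x + 1 / 2 := h2
  linarith

/-- A tame path to a vertex gives a lower bound for the tameness function. -/
theorem exists_le_of_tame {f : QuarterNat → QuarterNat} {g : G} {c : I → P.cayley.Realization}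
    (hc : Continuous c) (h1 : c 1 = P.cayley.vtx g)
    (ht : ∀ s t, s < t → P.height (c s) ≤ f (P.height (c t))) :
    ∃ q : QuarterNat, (P.cayley.dist (1 : G) g : ℚ) ≤ q + 1 ∧
      q ≤ f (ofQuarters (4 * P.cayley.dist (1 : G) g)) := by
  obtain ⟨s, hs, hs'⟩ := P.reachable.exists_lt_coarseDist hc h1
  refine ⟨P.height (c s), hs', ?_⟩
  have := ht s 1 hs
  rwa [h1] at this

end SymmetrizedPresentation

/-! ### Edge paths of a diagram and their projections -/

namespace VanKampenDiagram

variable {P : SymmetrizedPresentation G A} {w : List A} (Δ : VanKampenDiagram P w)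

theorem map_label_revPath (l : List Δ.D) :
    (Δ.revPath l).map Δ.label = P.invWord (l.map Δ.label) := by
  simp [TwoComplex.revPath, SymmetrizedPresentation.invWord, Δ.label_rev, Function.comp_def]

theorem map_dart {x y : Δ.V} {l : List Δ.D} (h : Δ.IsPath x l y) :
    l.map Δ.dart = P.pathFrom (Δ.pos x) (l.map Δ.label) := by
  induction l generalizing x with
  | nil => rfl
  | cons d l ih =>
    simp only [List.map_cons, SymmetrizedPresentation.pathFrom]
    rw [ih h.2, ← h.1]
    have : Δ.pos (Δ.tgt d) = Δ.pos (Δ.src d) * P.val (Δ.label d) := Δ.pos_tgt d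
    rw [this]
    rfl

theorem proj_pathPt {x y : Δ.V} {l : List Δ.D} (h : Δ.IsPath x l y) (s : ℝ) :
    Δ.proj (Δ.pathPt x l s) =
      P.cayley.pathPt (Δ.pos x) (P.pathFrom (Δ.pos x) (l.map Δ.label)) s := by
  rw [← Δ.map_dart h]
  exact Δ.cell.map_pathPt x l s

theorem proj_vtx (x : Δ.V) : Δ.proj (Δ.vtx x) = P.cayley.vtx (Δ.pos x) := rfl

theorem proj_onEdge (d : Δ.D) (x : I) : Δ.proj (Δ.onEdge d x) = P.cayley.onEdge (Δ.dart d) x :=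
  rfl

theorem proj_basePt : Δ.proj Δ.basePt = P.cayley.vtx (1 : G) :=
  (Δ.proj_vtx _).trans (by rw [Δ.pos_base])

theorem continuous_proj : Continuous Δ.proj := Δ.cell.continuous_map

theorem pos_isPath {x y : Δ.V} {l : List Δ.D} (h : Δ.IsPath x l y) :
    Δ.pos y = Δ.pos x * P.eval (l.map Δ.label) := by
  induction l generalizing x with
  | nil => rw [show x = y from h]; simp [P.eval_nil]
  | cons d l ih =>
    rw [ih h.2, List.map_cons, P.eval_cons, ← mul_assoc, ← h.1]
    congr 1
    exact Δ.pos_tgt d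

/-- The label of a loop would represent the identity. -/
theorem src_ne_tgt (d : Δ.D) : Δ.src d ≠ Δ.tgt d := by
  intro h
  have h1 := Δ.pos_tgt d
  have h2 : Δ.pos (Δ.src d) = Δ.pos (Δ.src (Δ.rev d)) := congrArg Δ.pos h
  rw [← h2] at h1
  exact P.val_ne_one _ (by simpa using h1.symm)

/-- An edge path from the base point with a simple label has no repeated vertices. -/
theorem pathEnd_take_inj {y : Δ.V} {l : List Δ.D} (h : Δ.IsPath Δ.base l y)
    (hs : P.IsSimple (l.map Δ.label)) {j k : ℕ} (hj : j ≤ l.length) (hk : k ≤ l.length)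
    (e : Δ.pathEnd Δ.base (l.take j) = Δ.pathEnd Δ.base (l.take k)) : j = k := by
  have hp : ∀ i, Δ.pos (Δ.pathEnd Δ.base (l.take i)) = P.eval ((l.map Δ.label).take i) := by
    intro i
    have h1 : Δ.IsPath Δ.base (l.take i) (Δ.pathEnd Δ.base (l.take i)) := by
      rw [← List.take_append_drop i l, TwoComplex.isPath_append] at h
      exact h.1
    rw [Δ.pos_isPath h1, Δ.pos_base, one_mul, List.map_take]
  refine P.isSimple_iff.1 hs j (by simpa using hj) k (by simpa using hk) ?_
  rw [← hp, ← hp, e]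

theorem pathPt_injOn {y : Δ.V} {l : List Δ.D} (h : Δ.IsPath Δ.base l y)
    (hs : P.IsSimple (l.map Δ.label)) : Set.InjOn (Δ.pathPt Δ.base l) (Set.Icc 0 l.length) :=
  TwoComplex.pathPt_injOn h (fun _ hj _ hk e => Δ.pathEnd_take_inj h hs hj hk e)

end VanKampenDiagram

end TameFilling

namespace TameFilling

universe u v
variable {G : Type u} {A : Type v} [Group G]

/-! ### Vertices on edges and edge paths -/

namespace TwoComplex

universe u' v' w'
variable {K : TwoComplex.{u', v', w'}}

theorem pathPt_natCast {x y : K.V} {l : List K.D} (h : K.IsPath x l y) (k : ℕ) :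
    K.pathPt x l k = K.vtx (K.pathEnd x (l.take k)) := by
  rcases le_total k l.length with hk | hk
  · have h' := h
    rw [← List.take_append_drop k l, isPath_append] at h'
    have e := pathPt_append_left h'.1 h'.2 (s := k) (by simp [hk])
    rw [List.take_append_drop] at e
    rw [e]
    exact pathPt_of_length_le h'.1 (by simp)
  · rw [List.take_of_length_le hk, h.pathEnd_eq]
    exact pathPt_of_length_le h (by exact_mod_cast hk)

theorem pathPt_eq_onEdge (x : K.V) {l : List K.D} (hl : l ≠ []) (s : ℝ) :
    ∃ d ∈ l, ∃ t, K.pathPt x l s = K.onEdge d t := by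
  induction l generalizing x s with
  | nil => exact absurd rfl hl
  | cons d l ih =>
    rw [pathPt]
    split_ifs with hs
    · exact ⟨d, by simp, _, rfl⟩
    · by_cases hl' : l = []
      · subst hl'
        exact ⟨d, by simp, 1, (onEdge_one d).symm⟩
      · obtain ⟨d', h1, t, h2⟩ := ih (K.tgt d) hl' (s - 1)
        exact ⟨d', by simp [h1], t, h2⟩

/-- On an edge that is not a loop, the affine extension of the indicator of `z` takes the value 1
only at an end point equal to `z`. -/
theorem onEdge_eq_vtx {d : K.D} (hd : K.src d ≠ K.tgt d) {x : I} {z : K.V}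
    (h : K.onEdge d x = K.vtx z) : (x = 0 ∧ K.src d = z) ∨ (x = 1 ∧ K.tgt d = z) := by
  classical
  have h1 := congrArg (linExt (fun y => if y = z then (1 : ℝ) else 0) 0) h
  rw [linExt_onEdge, linExt_vtx, if_pos rfl] at h1
  by_cases hs : K.src d = z
  · rw [if_pos hs, if_neg (fun h => hd (hs.trans h.symm))] at h1
    exact Or.inl ⟨Subtype.ext (show (x : ℝ) = 0 by linarith), hs⟩
  · rw [if_neg hs] at h1
    by_cases ht : K.tgt d = z
    · rw [if_pos ht] at h1
      exact Or.inr ⟨Subtype.ext (show (x : ℝ) = 1 by linarith), ht⟩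
    · rw [if_neg ht] at h1
      simp at h1

end TwoComplex

/-! ### The subdivided circle -/

/-- The point of the unit circle that is the fraction `u` of a counterclockwise turn away from
`-1`. -/
noncomputable def circlePt (u : ℝ) : Circle := Circle.exp (2 * Real.pi * u - Real.pi)

theorem continuous_circlePt : Continuous circlePt := by
  unfold circlePt
  fun_prop

theorem turn_circlePt {u : ℝ} (h0 : 0 < u) (h1 : u ≤ 1) :
    VanKampenDiagram.turn (circlePt u) = u := by
  have hp := Real.pi_pos
  rw [VanKampenDiagram.turn, circlePt, Circle.arg_exp (by nlinarith) (by nlinarith)]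
  field_simp
  ring

theorem circlePt_zero : circlePt 0 = circlePt 1 := by
  have : 2 * Real.pi * 1 - Real.pi = (2 * Real.pi * 0 - Real.pi) + 2 * Real.pi := by ring
  rw [circlePt, circlePt, this, Circle.exp_add, Circle.exp_two_pi, mul_one]

theorem coe_circlePt_one : ((circlePt 1 : Circle) : ℂ) = -1 := by
  have : 2 * Real.pi * 1 - Real.pi = Real.pi := by ring
  rw [circlePt, this, Circle.coe_exp, Complex.exp_pi_mul_I]

theorem circlePt_turn (z : Circle) : circlePt (VanKampenDiagram.turn z) = z := by
  have hp := Real.pi_pos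
  have : 2 * Real.pi * VanKampenDiagram.turn z - Real.pi = Complex.arg z := by
    rw [VanKampenDiagram.turn]
    field_simp
    ring
  rw [circlePt, this, Circle.exp_arg]

theorem turn_mem (z : Circle) : 0 < VanKampenDiagram.turn z ∧ VanKampenDiagram.turn z ≤ 1 := by
  have hp := Real.pi_pos
  have h1 := Complex.neg_pi_lt_arg z
  have h2 := Complex.arg_le_pi z
  rw [VanKampenDiagram.turn]
  constructor
  · apply div_pos <;> linarith
  · rw [div_le_one (by linarith)]
    linarith

/-- A continuous surjection from a compact space to a Hausdorff space is closed. Since `turn` jumps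
at `-1`, the continuity of `wrap` is checked after pulling back to the interval. -/
theorem isQuotientMap_circlePt : Topology.IsQuotientMap (fun u : I => circlePt u) := by
  have hc : Continuous (fun u : I => circlePt u) :=
    continuous_circlePt.comp continuous_subtype_val
  refine hc.isClosedMap.isQuotientMap hc (fun z => ?_)
  exact ⟨⟨_, (turn_mem z).1.le, (turn_mem z).2⟩, circlePt_turn z⟩

/-! ### The boundary path as a map of the circle -/

namespace VanKampenDiagram

variable {P : SymmetrizedPresentation G A} {w : List A} (Δ : VanKampenDiagram P w)

theorem length_bdry : Δ.bdry.length = w.length := by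
  simpa using congrArg List.length Δ.bdry_label

theorem wrap_circlePt {u : ℝ} (h0 : 0 ≤ u) (h1 : u ≤ 1) :
    Δ.wrap (circlePt u) = Δ.pathPt Δ.base Δ.bdry (w.length * u) := by
  rcases h0.lt_or_eq with h | rfl
  · rw [wrap, turn_circlePt h h1]
  · rw [circlePt_zero, wrap, turn_circlePt one_pos le_rfl, mul_zero, mul_one,
      TwoComplex.pathPt_nonpos Δ.bdry_isPath le_rfl,
      TwoComplex.pathPt_of_length_le Δ.bdry_isPath (by rw [Δ.length_bdry])]

theorem continuous_wrap : Continuous Δ.wrap := by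
  rw [isQuotientMap_circlePt.continuous_iff]
  have : Δ.wrap ∘ (fun u : I => circlePt u) =
      fun u : I => Δ.pathPt Δ.base Δ.bdry (w.length * u) :=
    funext fun u => Δ.wrap_circlePt u.2.1 u.2.2
  rw [this]
  exact (TwoComplex.continuous_pathPt Δ.bdry_isPath).comp (by fun_prop)

theorem wrap_mem_boundary (z : Circle) : Δ.wrap z ∈ Δ.boundary := by
  by_cases h : Δ.bdry = []
  · left
    rw [wrap, h]
    rfl
  · exact Or.inr (TwoComplex.pathPt_eq_onEdge Δ.base h _)

theorem exists_bdry_eq {w₁ : List A} {a : A} {w₂ : List A}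
    (Δ : VanKampenDiagram P (w₁ ++ a :: P.invWord w₂)) :
    ∃ (p₁ : List Δ.D) (d : Δ.D) (p₂ : List Δ.D), Δ.bdry = p₁ ++ d :: Δ.revPath p₂ ∧
      p₁.map Δ.label = w₁ ∧ Δ.label d = a ∧ p₂.map Δ.label = w₂ := by
  obtain ⟨p₁, l, h1, h2, h3⟩ := List.map_eq_append_iff.1 Δ.bdry_label
  obtain ⟨d, l', rfl, h4, h5⟩ := List.map_eq_cons_iff.1 h3
  refine ⟨p₁, d, Δ.revPath l', ?_, h2, h4, ?_⟩
  · rw [TwoComplex.revPath_revPath, h1]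
  · rw [map_label_revPath, h5, P.invWord_invWord]

/-- A boundary path `p₁ d p₂⁻¹`, split at its edge `d`. -/
theorem isPath_of_bdry_eq {p₁ : List Δ.D} {d : Δ.D} {p₂ : List Δ.D}
    (h : Δ.bdry = p₁ ++ d :: Δ.revPath p₂) :
    Δ.IsPath Δ.base p₁ (Δ.src d) ∧ Δ.IsPath Δ.base p₂ (Δ.tgt d) := by
  have h1 := Δ.bdry_isPath
  rw [h, TwoComplex.isPath_append] at h1
  obtain ⟨h1, h2, h3⟩ := h1
  rw [← h2] at h1
  refine ⟨h1, ?_⟩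
  have := h3.revPath
  rwa [TwoComplex.revPath_revPath] at this

end VanKampenDiagram

/-- A tame van Kampen homotopy induces a tame disk homotopy. -/
theorem ExtrinsicTameFilling.relaxed {P : SymmetrizedPresentation G A}
    {f : QuarterNat → QuarterNat} (h : ExtrinsicTameFilling P f) :
    ExtrinsicRelaxedTameFilling P f := by
  intro w hw
  obtain ⟨Δ, ψ, hψ, ht⟩ := h w hw
  refine ⟨Δ, fun q => ψ (⟨Δ.wrap q.1, Δ.wrap_mem_boundary q.1⟩, q.2), ⟨?_, ?_, ?_, ?_, ?_⟩,
    fun p s t hst => ht _ s t hst⟩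
  · refine hψ.continuous.comp (Continuous.prodMk ?_ continuous_snd)
    exact Continuous.subtype_mk (Δ.continuous_wrap.comp continuous_fst) _
  · exact fun p => hψ.zero _
  · exact fun p => hψ.one _
  · intro p t hp
    refine hψ.base _ t ?_
    have : p = circlePt 1 := Subtype.ext (hp.trans coe_circlePt_one.symm)
    change Δ.wrap p = _
    rw [this, Δ.wrap_circlePt zero_le_one le_rfl,
      TwoComplex.pathPt_of_length_le Δ.bdry_isPath (by rw [Δ.length_bdry, mul_one])]
    rfl
  · rintro p t ⟨k, hk⟩
    refine hψ.vertex _ t ⟨Δ.pathEnd Δ.base (Δ.bdry.take k), ?_⟩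
    change Δ.wrap p = _
    rw [VanKampenDiagram.wrap, hk]
    exact TwoComplex.pathPt_natCast Δ.bdry_isPath k

end TameFilling

namespace TameFilling

universe u v
variable {G : Type u} {A : Type v} [Group G]

/-! ### From disk homotopies to edge homotopies -/

/-- The phase `[(k / 3), (k + 1) / 3]` of the unit interval, rescaled to `[0, 1]`. -/
noncomputable def phase (k : ℝ) (t : ℝ) : ℝ := max 0 (min 1 (3 * t - k))

theorem continuous_phase (k : ℝ) : Continuous (phase k) := by
  unfold phase
  fun_prop

theorem monotone_phase (k : ℝ) : Monotone (phase k) := by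
  intro s t hst
  unfold phase
  gcongr

theorem phase_mem (k t : ℝ) : 0 ≤ phase k t ∧ phase k t ≤ 1 :=
  ⟨le_max_left _ _, max_le zero_le_one (min_le_left _ _)⟩

theorem phase_eq_zero {k t : ℝ} (h : 3 * t ≤ k) : phase k t = 0 :=
  max_eq_left ((min_le_right _ _).trans (by linarith))

theorem phase_eq_one {k t : ℝ} (h : k + 1 ≤ 3 * t) : phase k t = 1 := by
  rw [phase, min_eq_left (by linarith), max_eq_right zero_le_one]

theorem phase_eq {k t : ℝ} (h : k ≤ 3 * t) (h' : 3 * t ≤ k + 1) : phase k t = 3 * t - k := by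
  rw [phase, min_eq_right (by linarith), max_eq_right (by linarith)]

/-- The number `u` moved into the interval `[τ n₁, n₁ + 1 + n₂ - τ n₂]`. -/
noncomputable def clampPos (n₁ n₂ u τ : ℝ) : ℝ := max (τ * n₁) (min u (n₁ + 1 + n₂ - τ * n₂))

/-- The distance to the interval `[n₁, n₁ + 1]`. -/
noncomputable def distPos (n₁ q : ℝ) : ℝ := max 0 (max (n₁ - q) (q - n₁ - 1))

/-- As `τ` grows, the clamping interval shrinks but never loses a point of `[n₁, n₁ + 1]`, so the
clamped point only comes closer to that interval. -/
theorem distPos_clampPos_le {n₁ n₂ u τ τ' : ℝ} (h1 : 0 ≤ n₁) (h2 : 0 ≤ n₂)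
    (ht : τ ≤ τ') (ht1 : τ' ≤ 1) :
    distPos n₁ (clampPos n₁ n₂ u τ') ≤ distPos n₁ (clampPos n₁ n₂ u τ) := by
  have a1 : τ * n₁ ≤ τ' * n₁ := mul_le_mul_of_nonneg_right ht h1
  have a2 : τ' * n₁ ≤ n₁ := mul_le_of_le_one_left h1 ht1
  have b1 : τ * n₂ ≤ τ' * n₂ := mul_le_mul_of_nonneg_right ht h2
  have b2 : τ' * n₂ ≤ n₂ := mul_le_of_le_one_left h2 ht1
  unfold clampPos distPos
  generalize τ * n₁ = a at *
  generalize τ' * n₁ = a' at *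
  generalize hB : n₁ + 1 + n₂ - τ * n₂ = B
  generalize hB' : n₁ + 1 + n₂ - τ' * n₂ = B'
  have hBB : B' ≤ B := by linarith
  refine max_le (le_max_left _ _) (max_le ?_ ?_)
  · have h3 : n₁ - max a (min u B) ≤
        max 0 (max (n₁ - max a (min u B)) (max a (min u B) - n₁ - 1)) :=
      (le_max_left _ _).trans (le_max_right _ _)
    have h4 : (0 : ℝ) ≤ max 0 (max (n₁ - max a (min u B)) (max a (min u B) - n₁ - 1)) :=
      le_max_left _ _
    have h5 : a' ≤ max a' (min u B') := le_max_left _ _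
    have h6 : min u B' ≤ max a' (min u B') := le_max_right _ _
    rcases max_choice a (min u B) with h | h
    · rw [h] at h3 ⊢
      linarith
    · have h7 : min u B ≤ u := min_le_left _ _
      rcases le_total u B' with h8 | h8
      · rw [min_eq_left h8] at h5 h6 ⊢
        rw [h] at h3 ⊢
        linarith
      · rw [min_eq_right h8] at h5 h6 ⊢
        linarith
  · have h3 : max a (min u B) - n₁ - 1 ≤
        max 0 (max (n₁ - max a (min u B)) (max a (min u B) - n₁ - 1)) :=
      (le_max_right _ _).trans (le_max_right _ _)
    have h4 : (0 : ℝ) ≤ max 0 (max (n₁ - max a (min u B)) (max a (min u B) - n₁ - 1)) :=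
      le_max_left _ _
    have h5 : min u B ≤ max a (min u B) := le_max_right _ _
    have h6 : min u B' ≤ min u B := min_le_min_left u hBB
    rcases max_choice a' (min u B') with h | h <;> rw [h] <;> linarith

/-- The position at time `t` of the `x`-th path: it starts at `(n₁ + 1 + n₂) x`, is pushed towards
the interval `[n₁, n₁ + 1]`, and ends at `n₁ + x`. -/
noncomputable def combPos (n₁ n₂ x t : ℝ) : ℝ :=
  (1 - phase 2 t) * clampPos n₁ n₂ ((n₁ + 1 + n₂) * x) (phase 1 t) + phase 2 t * (n₁ + x)

theorem clampPos_mem {n₁ n₂ u τ : ℝ} (h1 : 0 ≤ n₁) (h2 : 0 ≤ n₂) (ht : 0 ≤ τ) (ht1 : τ ≤ 1) :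
    0 ≤ clampPos n₁ n₂ u τ ∧ clampPos n₁ n₂ u τ ≤ n₁ + 1 + n₂ := by
  have a1 : 0 ≤ τ * n₁ := mul_nonneg ht h1
  have a2 : τ * n₁ ≤ n₁ := mul_le_of_le_one_left h1 ht1
  have b1 : 0 ≤ τ * n₂ := mul_nonneg ht h2
  unfold clampPos
  refine ⟨a1.trans (le_max_left _ _), max_le (by linarith) ((min_le_right _ _).trans (by linarith))⟩

theorem combPos_mem {n₁ n₂ x : ℝ} (h1 : 0 ≤ n₁) (h2 : 0 ≤ n₂) (hx : 0 ≤ x) (hx1 : x ≤ 1) (t : ℝ) :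
    0 ≤ combPos n₁ n₂ x t ∧ combPos n₁ n₂ x t ≤ n₁ + 1 + n₂ := by
  obtain ⟨c1, c2⟩ := clampPos_mem (u := (n₁ + 1 + n₂) * x) h1 h2 (phase_mem 1 t).1 (phase_mem 1 t).2
  obtain ⟨p1, p2⟩ := phase_mem 2 t
  unfold combPos
  constructor
  · have := mul_nonneg (sub_nonneg.2 p2) c1
    have := mul_nonneg p1 (add_nonneg h1 hx)
    linarith
  · nlinarith [mul_nonneg (sub_nonneg.2 p2) (sub_nonneg.2 c2),
      mul_nonneg p1 (show (0 : ℝ) ≤ n₁ + 1 + n₂ - (n₁ + x) by linarith)]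

/-- During the first third the position does not move; that time is reserved for running the disk
homotopy. -/
theorem combPos_of_le {n₁ n₂ x t : ℝ} (h1 : 0 ≤ n₁) (h2 : 0 ≤ n₂) (hx : 0 ≤ x) (hx1 : x ≤ 1)
    (ht : 3 * t ≤ 1) : combPos n₁ n₂ x t = (n₁ + 1 + n₂) * x := by
  rw [combPos, phase_eq_zero ht, phase_eq_zero (by linarith), clampPos]
  have a : 0 ≤ (n₁ + 1 + n₂) * x := mul_nonneg (by linarith) hx
  have b : (n₁ + 1 + n₂) * x ≤ n₁ + 1 + n₂ := mul_le_of_le_one_right (by linarith) hx1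
  simp only [zero_mul, sub_zero, one_mul, add_zero]
  rw [min_eq_left b, max_eq_right a]

/-- At an end of the edge the clamp takes the end point of its interval and the final slide is void.
Hence the curve to a vertex simply follows its normal form, whichever edge is combed. -/
theorem combPos_zero {n₁ n₂ t : ℝ} (h1 : 0 ≤ n₁) (h2 : 0 ≤ n₂) :
    combPos n₁ n₂ 0 t = phase 1 t * n₁ := by
  obtain ⟨p1, p2⟩ := phase_mem 1 t
  have a1 : 0 ≤ phase 1 t * n₁ := mul_nonneg p1 h1
  have b2 : phase 1 t * n₂ ≤ n₂ := mul_le_of_le_one_left h2 p2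
  rw [combPos, clampPos, mul_zero, min_eq_left (by linarith), max_eq_left a1]
  rcases le_total (3 * t) 2 with ht | ht
  · rw [phase_eq_zero (k := 2) ht]; ring
  · rw [phase_eq_one (k := 1) (by linarith)]; ring

theorem combPos_one {n₁ n₂ t : ℝ} (h1 : 0 ≤ n₁) (h2 : 0 ≤ n₂) :
    combPos n₁ n₂ 1 t = n₁ + 1 + n₂ - phase 1 t * n₂ := by
  obtain ⟨p1, p2⟩ := phase_mem 1 t
  have a1 : phase 1 t * n₁ ≤ n₁ := mul_le_of_le_one_left h1 p2
  have a2 : 0 ≤ phase 1 t * n₂ := mul_nonneg p1 h2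
  have b2 : phase 1 t * n₂ ≤ n₂ := mul_le_of_le_one_left h2 p2
  rw [combPos, clampPos, mul_one, min_eq_right (by linarith), max_eq_right (by linarith)]
  rcases le_total (3 * t) 2 with ht | ht
  · rw [phase_eq_zero (k := 2) ht]; ring
  · rw [phase_eq_one (k := 1) (by linarith)]; ring

/-- Until time 2/3 this is the monotonicity of clamping. Afterwards the position is a convex
combination of points of `[n₁, n₁ + 1]`, so its distance is zero. -/
theorem distPos_combPos_le {n₁ n₂ x s t : ℝ} (h1 : 0 ≤ n₁) (h2 : 0 ≤ n₂) (hx : 0 ≤ x)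
    (hx1 : x ≤ 1) (hst : s ≤ t) :
    distPos n₁ (combPos n₁ n₂ x t) ≤ distPos n₁ (combPos n₁ n₂ x s) := by
  rcases le_total (3 * t) 2 with ht | ht
  · rw [combPos, combPos, phase_eq_zero (k := 2) ht, phase_eq_zero (k := 2) (by linarith)]
    simp only [sub_zero, one_mul, zero_mul, add_zero]
    exact distPos_clampPos_le h1 h2 (monotone_phase 1 hst) (phase_mem 1 t).2
  · have h0 : distPos n₁ (combPos n₁ n₂ x t) = 0 := by
      have hc : n₁ ≤ clampPos n₁ n₂ ((n₁ + 1 + n₂) * x) 1 ∧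
          clampPos n₁ n₂ ((n₁ + 1 + n₂) * x) 1 ≤ n₁ + 1 := by
        rw [clampPos]
        refine ⟨(le_max_left _ _).trans' (by linarith), max_le (by linarith) ?_⟩
        exact (min_le_right _ _).trans (by linarith)
      obtain ⟨p1, p2⟩ := phase_mem 2 t
      rw [combPos, phase_eq_one (k := 1) (by linarith), distPos]
      refine max_eq_left (max_le ?_ ?_)
      · nlinarith [mul_nonneg (sub_nonneg.2 p2) (sub_nonneg.2 hc.1), mul_nonneg p1 hx]
      · nlinarith [mul_nonneg (sub_nonneg.2 p2) (sub_nonneg.2 hc.2),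
          mul_nonneg p1 (sub_nonneg.2 hx1)]
    rw [h0]
    exact le_max_left _ _

namespace VanKampenDiagram

variable {P : SymmetrizedPresentation G A}

/-- Along each geodesic side the height equals the distance travelled from the base point up to 1,
and the lengths of the two sides differ by at most 1, being distances of adjacent vertices. The
error 3 covers both, as well as the edge between the sides. -/
theorem height_bdry_bounds {y₁ y₂ : List A} {a : A}
    (Δ : VanKampenDiagram P (y₁ ++ a :: P.invWord y₂))
    (h₁ : P.IsGeodesic y₁) (h₂ : P.IsGeodesic y₂) (he : P.eval y₁ * P.val a = P.eval y₂) {q : ℝ}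
    (h0 : 0 ≤ q) (h1 : q ≤ y₁.length + 1 + y₂.length) :
    y₁.length - distPos y₁.length q - 3 ≤
        ((P.height (Δ.proj (Δ.pathPt Δ.base Δ.bdry q)) : ℚ) : ℝ) ∧
      ((P.height (Δ.proj (Δ.pathPt Δ.base Δ.bdry q)) : ℚ) : ℝ) ≤
        y₁.length - distPos y₁.length q + 3 := by
  obtain ⟨p₁, d, p₂, hb, hp₁, hd, hp₂⟩ := exists_bdry_eq Δ
  have hl₁ : (p₁.length : ℝ) = y₁.length := by
    simpa using congrArg (fun l => (l.length : ℝ)) hp₁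
  have hl₂ : (p₂.length : ℝ) = y₂.length := by
    simpa using congrArg (fun l => (l.length : ℝ)) hp₂
  obtain ⟨hpath₁, hpath₂⟩ := Δ.isPath_of_bdry_eq hb
  have hd' : Δ.IsPath (Δ.src d) (d :: Δ.revPath p₂) Δ.base := ⟨rfl, hpath₂.revPath⟩
  have hgeo : ∀ {y : List A}, P.IsGeodesic y → ∀ {s : ℝ}, 0 ≤ s → s ≤ y.length →
      s - 1 ≤ ((P.height (P.cayley.pathPt (1 : G) (P.pathFrom 1 y) s) : ℚ) : ℝ) ∧
      ((P.height (P.cayley.pathPt (1 : G) (P.pathFrom 1 y) s) : ℚ) : ℝ) ≤ s + 1 := by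
    intro y hy s hs hs'
    have := TwoComplex.coarseDist_pathPt (K := P.cayley) (y := (1 : G)) (m := 0)
      (P.isPath_pathFrom 1 y) (by
        intro k hk
        rw [P.length_cayleyPath] at hk
        rw [P.take_cayleyPath, P.pathEnd_pathFrom, one_mul, hy.dist_take hk, zero_add]) hs
        (by rwa [P.length_cayleyPath])
    simpa [SymmetrizedPresentation.height] using this
  have hn₁ : P.cayley.dist (1 : G) (P.eval y₁) = y₁.length := h₁.symm
  have hn₂ : P.cayley.dist (1 : G) (P.eval y₂) = y₂.length := h₂.symm
  have ha := P.reachable.dist_tgt_le (P.eval y₁, a)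
  have ha' := P.reachable.dist_src_le (P.eval y₁, a)
  rw [P.tgt_cayley] at ha ha'
  change P.cayley.dist (1 : G) (P.eval y₁ * P.val a) ≤ P.cayley.dist (1 : G) (P.eval y₁) + 1 at ha
  change P.cayley.dist (1 : G) (P.eval y₁) ≤ P.cayley.dist (1 : G) (P.eval y₁ * P.val a) + 1 at ha'
  rw [he, hn₁, hn₂] at ha ha'
  have hc : (y₂.length : ℝ) ≤ y₁.length + 1 := by exact_mod_cast ha
  have hc' : (y₁.length : ℝ) ≤ y₂.length + 1 := by exact_mod_cast ha'
  rw [hb]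
  rcases le_total q y₁.length with hq | hq
  · rw [TwoComplex.pathPt_append_left hpath₁ hd' (by rwa [hl₁]), Δ.proj_pathPt hpath₁, hp₁,
      Δ.pos_base]
    have hD : distPos y₁.length q = y₁.length - q := by
      rw [distPos, max_eq_left (b := q - y₁.length - 1) (by linarith), max_eq_right (by linarith)]
    obtain ⟨b1, b2⟩ := hgeo h₁ h0 hq
    rw [hD]
    constructor <;> linarith
  · rw [TwoComplex.pathPt_append_right hpath₁ hd' (by rwa [hl₁]), hl₁]
    rcases le_total q (y₁.length + 1) with hq' | hq'
    · rw [TwoComplex.pathPt, if_pos (by linarith), Δ.proj_onEdge]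
      have hD : distPos y₁.length q = 0 := by
        rw [distPos]
        exact max_eq_left (max_le (by linarith) (by linarith))
      have hdist : P.cayley.dist (1 : G) (P.cayley.src (Δ.dart d)) = y₁.length := by
        have : P.cayley.src (Δ.dart d) = P.eval y₁ := by
          have := Δ.pos_isPath hpath₁
          rw [Δ.pos_base, one_mul, hp₁] at this
          exact this
        rw [this, hn₁]
      have := P.reachable.coarseDist_onEdge_bounds (Δ.dart d)
        (Set.projIcc 0 1 zero_le_one (q - y₁.length))
      rw [hdist] at this
      obtain ⟨b1, b2⟩ := this
      have b1' : ((y₁.length : ℚ) : ℝ) - 1 ≤ ((P.height (P.cayley.onEdge (Δ.dart d)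
        (Set.projIcc 0 1 zero_le_one (q - y₁.length))) : ℚ) : ℝ) := by exact_mod_cast b1
      have b2' : ((P.height (P.cayley.onEdge (Δ.dart d)
        (Set.projIcc 0 1 zero_le_one (q - y₁.length))) : ℚ) : ℝ) ≤ ((y₁.length : ℚ) : ℝ) + 1 := by
          exact_mod_cast b2
      rw [hD]
      push_cast at b1' b2'
      constructor <;> linarith
    · have hs : Δ.pathPt (Δ.src d) (d :: Δ.revPath p₂) (q - y₁.length) =
          Δ.pathPt Δ.base p₂ (y₂.length - (q - y₁.length - 1)) := by
        have h3 : Δ.IsPath (Δ.src d) [d] (Δ.tgt d) := ⟨rfl, rfl⟩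
        have := TwoComplex.pathPt_append_right h3 hpath₂.revPath (s := q - y₁.length)
          (by simp; linarith)
        rw [List.singleton_append] at this
        rw [this, TwoComplex.pathPt_revPath hpath₂, hl₂]
        simp
      rw [hs, Δ.proj_pathPt hpath₂, hp₂, Δ.pos_base]
      have hD : distPos y₁.length q = q - y₁.length - 1 := by
        rw [distPos, max_eq_right (a := y₁.length - q) (by linarith), max_eq_right (by linarith)]
      obtain ⟨b1, b2⟩ := hgeo h₂ (s := y₂.length - (q - y₁.length - 1)) (by linarith)
        (by linarith)
      rw [hD]
      constructor <;> linarith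

/-- A tame disk homotopy for a word `y₁ a y₂⁻¹`, where `y₁` and `y₂` are geodesics, can be changed
into a tame edge homotopy. -/
theorem exists_edgeHomotopy {f : QuarterNat → QuarterNat} (hf : Monotone f)
    (hlow : ∀ q ∈ P.cayley.skeletonOne, (P.height q : ℚ) ≤ f (P.height q) + 2)
    {y₁ y₂ : List A} {a : A} (Δ : VanKampenDiagram P (y₁ ++ a :: P.invWord y₂))
    (h₁ : P.IsGeodesic y₁) (h₂ : P.IsGeodesic y₂) (he : P.eval y₁ * P.val a = P.eval y₂)
    {φ : Circle × I → Δ.Realization} (hφ : Δ.IsDiskHomotopy φ) (ht : Δ.ExtrinsicallyTame φ f) :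
    ∃ θ : I × I → Δ.Realization, Δ.IsEdgeHomotopy y₁ a y₂ θ ∧
      Δ.ExtrinsicallyTame θ (shift 8 f) ∧
      (∀ t : I, Δ.proj (θ (0, t)) =
        P.cayley.pathPt (1 : G) (P.pathFrom 1 y₁) (phase 1 t * y₁.length)) ∧
      ∀ t : I, Δ.proj (θ (1, t)) =
        P.cayley.pathPt (1 : G) (P.pathFrom 1 y₂) (phase 1 t * y₂.length) := by
  obtain ⟨p₁, d, p₂, hb, hp₁, hd, hp₂⟩ := exists_bdry_eq Δ
  have hl₁ : (p₁.length : ℝ) = y₁.length := by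
    simpa using congrArg (fun l => (l.length : ℝ)) hp₁
  have hl₂ : (p₂.length : ℝ) = y₂.length := by
    simpa using congrArg (fun l => (l.length : ℝ)) hp₂
  obtain ⟨hpath₁, hpath₂⟩ := Δ.isPath_of_bdry_eq hb
  have hd' : Δ.IsPath (Δ.src d) (d :: Δ.revPath p₂) Δ.base := ⟨rfl, hpath₂.revPath⟩
  have hlen : ((y₁ ++ a :: P.invWord y₂).length : ℝ) = y₁.length + 1 + y₂.length := by
    rw [List.length_append, List.length_cons, P.length_invWord]
    push_cast
    ring
  have hB := fun {q : ℝ} => height_bdry_bounds Δ h₁ h₂ he (q := q)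
  have hn₁ : (0 : ℝ) ≤ y₁.length := Nat.cast_nonneg _
  have hn₂ : (0 : ℝ) ≤ y₂.length := Nat.cast_nonneg _
  generalize hN₁ : (y₁.length : ℝ) = n₁ at *
  generalize hN₂ : (y₂.length : ℝ) = n₂ at *
  have hn : 0 < n₁ + 1 + n₂ := by linarith
  -- The disk homotopy, with circle points parametrized by arc length along the boundary path.
  set Φ : ℝ → I → Δ.Realization := fun q t => φ (circlePt (q / (n₁ + 1 + n₂)), t) with hΦ
  have hΦ1 : ∀ q : ℝ, 0 ≤ q → q ≤ n₁ + 1 + n₂ → Φ q 1 = Δ.pathPt Δ.base Δ.bdry q := by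
    intro q h0 h1
    rw [hΦ]
    simp only
    rw [hφ.one, Δ.wrap_circlePt (by positivity) ((div_le_one hn).2 h1), hlen]
    congr 1
    field_simp
  have hΦ0 : ∀ t, Φ 0 t = Δ.basePt := by
    intro t
    refine hφ.base _ t ?_
    rw [zero_div, circlePt_zero, coe_circlePt_one]
  have hΦn : ∀ t, Φ (n₁ + 1 + n₂) t = Δ.basePt := by
    intro t
    refine hφ.base _ t ?_
    rw [div_self hn.ne', coe_circlePt_one]
  -- The clock of the disk homotopy: it runs during the first third and then stays at 1, so that
  -- afterwards all points are on the boundary path.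
  let v : I → I := fun t => ⟨phase 0 t, phase_mem 0 t⟩
  have hv1 : ∀ t : I, 1 ≤ 3 * (t : ℝ) → v t = 1 := fun t h =>
    Subtype.ext (phase_eq_one (k := 0) (by linarith))
  have hv : Continuous v :=
    Continuous.subtype_mk ((continuous_phase 0).comp continuous_subtype_val) _
  let θ : I × I → Δ.Realization := fun z => Φ (combPos n₁ n₂ z.1 z.2) (v z.2)
  have hθ0 : ∀ t : I, θ (0, t) = Δ.pathPt Δ.base p₁ (phase 1 t * n₁) := by
    intro t
    have hm : phase 1 t * n₁ ≤ n₁ := mul_le_of_le_one_left hn₁ (phase_mem 1 t).2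
    have hm0 : 0 ≤ phase 1 t * n₁ := mul_nonneg (phase_mem 1 t).1 hn₁
    change Φ (combPos n₁ n₂ ((0 : I) : ℝ) t) (v t) = _
    rw [Set.Icc.coe_zero, combPos_zero hn₁ hn₂]
    rcases le_total (3 * (t : ℝ)) 1 with h | h
    · rw [phase_eq_zero h, zero_mul, hΦ0, TwoComplex.pathPt_nonpos hpath₁ le_rfl]
      rfl
    · rw [hv1 t h, hΦ1 _ hm0 (by linarith), hb,
        TwoComplex.pathPt_append_left hpath₁ hd' (by linarith)]
  have hθ1 : ∀ t : I, θ (1, t) = Δ.pathPt Δ.base p₂ (phase 1 t * n₂) := by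
    intro t
    have hm : phase 1 t * n₂ ≤ n₂ := mul_le_of_le_one_left hn₂ (phase_mem 1 t).2
    have hm0 : 0 ≤ phase 1 t * n₂ := mul_nonneg (phase_mem 1 t).1 hn₂
    change Φ (combPos n₁ n₂ ((1 : I) : ℝ) t) (v t) = _
    rw [Set.Icc.coe_one, combPos_one hn₁ hn₂]
    rcases le_total (3 * (t : ℝ)) 1 with h | h
    · rw [phase_eq_zero h, zero_mul, sub_zero, hΦn, TwoComplex.pathPt_nonpos hpath₂ le_rfl]
      rfl
    -- The path `p₂` starts at the base point but is traversed backwards at the end of the boundary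
    -- path, so the boundary is read in reverse.
    · have h4 : Δ.bdry = Δ.revPath (p₂ ++ Δ.rev d :: Δ.revPath p₁) := by
        rw [TwoComplex.revPath_append, TwoComplex.revPath_cons, TwoComplex.revPath_revPath,
          Δ.rev_rev, hb]
        simp
      have h5 : Δ.IsPath (Δ.tgt d) (Δ.rev d :: Δ.revPath p₁) Δ.base := by
        refine ⟨rfl, ?_⟩
        rw [TwoComplex.tgt_rev]
        exact hpath₁.revPath
      have h6 : ((p₂ ++ Δ.rev d :: Δ.revPath p₁).length : ℝ) = n₁ + 1 + n₂ := by
        simp only [List.length_append, List.length_cons, TwoComplex.length_revPath]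
        push_cast
        rw [hl₁, hl₂]
        ring
      rw [hv1 t h, hΦ1 _ (by linarith) (by linarith), h4,
        TwoComplex.pathPt_revPath (hpath₂.append h5), h6, sub_sub_cancel,
        TwoComplex.pathPt_append_left hpath₂ h5 (by linarith)]
  refine ⟨θ, ⟨p₁, d, p₂, hb, hp₁, hd, hp₂, ?_, ?_, ?_, ?_, ?_⟩, ?_, ?_, ?_⟩
  · refine hφ.continuous.comp (Continuous.prodMk ?_ (hv.comp continuous_snd))
    refine continuous_circlePt.comp (Continuous.div_const ?_ _)
    have h1 := continuous_phase 1
    have h2 := continuous_phase 2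
    unfold combPos clampPos
    fun_prop
  · intro x
    have : v 0 = 0 := Subtype.ext (phase_eq_zero (k := 0) (by simp))
    change Φ _ (v 0) = _
    rw [this]
    exact hφ.zero _
  · intro x
    change Φ (combPos n₁ n₂ x ((1 : I) : ℝ)) (v 1) = _
    rw [hv1 1 (by norm_num)]
    have hpos : combPos n₁ n₂ x ((1 : I) : ℝ) = n₁ + x := by
      rw [combPos, phase_eq_one (k := 2) (by norm_num)]
      ring
    rw [hpos, hΦ1 _ (by linarith [x.2.1]) (by linarith [x.2.2]), hb,
      TwoComplex.pathPt_append_right hpath₁ hd' (by linarith [x.2.1]), hl₁, add_sub_cancel_left,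
      TwoComplex.pathPt, if_pos x.2.2]
    congr 1
    exact Set.projIcc_of_mem _ x.2
  · refine ⟨fun t => phase 1 t * n₁, ?_, ?_, ?_, ?_, hθ0⟩
    · have h1 := continuous_phase 1
      fun_prop
    · intro s t hst
      exact mul_le_mul_of_nonneg_right (monotone_phase 1 hst) hn₁
    · simp [phase_eq_zero]
    · have : phase 1 ((1 : I) : ℝ) = 1 := phase_eq_one (by norm_num)
      simp only [this, one_mul, hl₁]
  · refine ⟨fun t => phase 1 t * n₂, ?_, ?_, ?_, ?_, hθ1⟩
    · have h1 := continuous_phase 1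
      fun_prop
    · intro s t hst
      exact mul_le_mul_of_nonneg_right (monotone_phase 1 hst) hn₂
    · simp [phase_eq_zero]
    · have : phase 1 ((1 : I) : ℝ) = 1 := phase_eq_one (by norm_num)
      simp only [this, one_mul, hl₂]
  · intro x s t hst
    have hst' : (s : ℝ) < t := hst
    -- Coming closer to the edge costs at most 6 in height, twice the error in `height_bdry_bounds`.
    have hcomp : ∀ q q' : ℝ, 0 ≤ q → q ≤ n₁ + 1 + n₂ → 0 ≤ q' → q' ≤ n₁ + 1 + n₂ →
        distPos n₁ q' ≤ distPos n₁ q →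
        (P.height (Δ.proj (Δ.pathPt Δ.base Δ.bdry q)) : ℚ) ≤
          P.height (Δ.proj (Δ.pathPt Δ.base Δ.bdry q')) + 6 := by
      intro q q' h0 h1 h0' h1' hD
      have e1 := (hB h0 h1).2
      have e2 := (hB h0' h1').1
      have : ((P.height (Δ.proj (Δ.pathPt Δ.base Δ.bdry q)) : ℚ) : ℝ) ≤
          ((P.height (Δ.proj (Δ.pathPt Δ.base Δ.bdry q')) : ℚ) : ℝ) + 6 := by linarith
      exact_mod_cast this
    have hms := combPos_mem hn₁ hn₂ x.2.1 x.2.2 s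
    have hmt := combPos_mem hn₁ hn₂ x.2.1 x.2.2 t
    have hDst := distPos_combPos_le hn₁ hn₂ x.2.1 x.2.2 hst'.le
    -- If `s` lies in the first third, the clock `v` is strictly larger at `t`, so tameness of the
    -- disk homotopy applies, and a later `t` adds the comparison along the boundary.
    rcases lt_or_ge (3 * (s : ℝ)) 1 with hs | hs
    · have hst2 : v s < v t := by
        change phase 0 s < phase 0 t
        rw [phase_eq (k := 0) (by linarith [s.2.1]) (by linarith)]
        rcases le_total (3 * (t : ℝ)) 1 with h | h
        · rw [phase_eq (k := 0) (by linarith [t.2.1]) (by linarith)]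
          linarith
        · rw [phase_eq_one (k := 0) (by linarith)]
          linarith
      have hps := combPos_of_le hn₁ hn₂ x.2.1 x.2.2 hs.le
      rcases le_total (3 * (t : ℝ)) 1 with h | h
      · refine (ht (circlePt (combPos n₁ n₂ x s / (n₁ + 1 + n₂))) _ _ hst2).trans ?_
        rw [hps, ← combPos_of_le hn₁ hn₂ x.2.1 x.2.2 h]
        exact le_shift_self hf 8 _
      · rw [hv1 t h] at hst2
        have e1 := ht (circlePt (combPos n₁ n₂ x s / (n₁ + 1 + n₂))) _ _ hst2
        change _ ≤ f (P.height (Δ.proj (Φ (combPos n₁ n₂ x s) 1))) at e1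
        rw [hΦ1 _ hms.1 hms.2] at e1
        have e2 := hcomp _ _ hms.1 hms.2 hmt.1 hmt.2 hDst
        have e3 : (P.height (Δ.proj (θ (x, s))) : ℚ) ≤ _ := e1
        refine le_shift hf (b := P.height (Δ.proj (Δ.pathPt Δ.base Δ.bdry (combPos n₁ n₂ x s))))
          ?_ (e3.trans (by simp))
        change _ ≤ (P.height (Δ.proj (Φ (combPos n₁ n₂ x t) (v t))) : ℚ) + _
        rw [hv1 t h, hΦ1 _ hmt.1 hmt.2]
        push_cast
        linarith
    -- Both points lie on the boundary path and tameness of the disk homotopy says nothing. The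
    -- constant 8 is made up of 6 from `hcomp` and 2 from the lower bound on `f`.
    · have ht' : 1 ≤ 3 * (t : ℝ) := by linarith
      have e2 := hcomp _ _ hms.1 hms.2 hmt.1 hmt.2 hDst
      change P.height (Δ.proj (Φ (combPos n₁ n₂ x s) (v s))) ≤
        shift 8 f (P.height (Δ.proj (Φ (combPos n₁ n₂ x t) (v t))))
      rw [hv1 t ht', hΦ1 _ hmt.1 hmt.2, hv1 s hs, hΦ1 _ hms.1 hms.2]
      refine le_shift hf (b := P.height (Δ.proj (Δ.pathPt Δ.base Δ.bdry (combPos n₁ n₂ x t))))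
        (by simp) ?_
      have := hlow _ (Δ.cell.map_skeletonOne
        (TwoComplex.pathPt_mem_skeletonOne Δ.base Δ.bdry (combPos n₁ n₂ x t)))
      change (P.height (Δ.proj _) : ℚ) ≤ f (P.height (Δ.proj _)) + 2 at this
      push_cast
      linarith
  · intro t
    rw [hθ0, Δ.proj_pathPt hpath₁, hp₁, Δ.pos_base]
  · intro t
    rw [hθ1, Δ.proj_pathPt hpath₂, hp₂, Δ.pos_base]

end VanKampenDiagram

/-- Disk homotopies that are tame bound the tameness function from below. -/
theorem ExtrinsicRelaxedTameFilling.exists_le {P : SymmetrizedPresentation G A}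
    {f : QuarterNat → QuarterNat} (h : ExtrinsicRelaxedTameFilling P f) (g : G) :
    ∃ q : QuarterNat, (P.cayley.dist (1 : G) g : ℚ) ≤ q + 1 ∧
      q ≤ f (ofQuarters (4 * P.cayley.dist (1 : G) g)) := by
  obtain ⟨y, rfl⟩ := P.exists_eval_eq g
  -- In the trivial word `y y⁻¹` the end of `y` sits exactly at half a turn, so the curve over that
  -- circle point ends at a vertex representing the given element.
  obtain ⟨Δ, φ, hφ, ht⟩ := h (y ++ P.invWord y) (by rw [P.eval_append, P.eval_invWord]; simp)
  have hlen : ((y ++ P.invWord y).length : ℝ) * (1 / 2) = y.length := by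
    rw [List.length_append, P.length_invWord]
    push_cast
    ring
  obtain ⟨p₁, l, h1, h2, -⟩ := List.map_eq_append_iff.1 Δ.bdry_label
  refine P.exists_le_of_tame (c := fun t => Δ.proj (φ (circlePt (1 / 2), t))) ?_ ?_
    (fun s t hst => ht _ s t hst)
  · exact Δ.continuous_proj.comp (hφ.continuous.comp (by fun_prop))
  · have h4 := Δ.bdry_isPath
    rw [h1, TwoComplex.isPath_append] at h4
    change Δ.proj (φ (circlePt (1 / 2), 1)) = _
    rw [hφ.one, Δ.wrap_circlePt (by norm_num) (by norm_num), hlen,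
      TwoComplex.pathPt_natCast Δ.bdry_isPath, Δ.proj_vtx, h1,
      List.take_left' (by simpa using congrArg List.length h2)]
    rw [Δ.pos_isPath h4.1, Δ.pos_base, one_mul, h2]

/-- Every edge can be treated separately, because the end curves produced by `exists_edgeHomotopy`
are prescribed by the normal forms alone. -/
theorem ExtrinsicRelaxedTameFilling.geodesicNormal {P : SymmetrizedPresentation G A}
    {f : QuarterNat → QuarterNat} (hf : Monotone f) (h : ExtrinsicRelaxedTameFilling P f) :
    ExtrinsicGeodesicTameNormal P (shift 8 f) := by
  have hlow := fun q => P.height_le_of_vertices hf h.exists_le (q := q)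
  choose nf hnf hgeo using P.exists_isGeodesic
  have key : ∀ e : G × A, ∃ (Δ : VanKampenDiagram P
      (nf e.1 ++ e.2 :: P.invWord (nf (e.1 * P.val e.2)))) (θ : I × I → Δ.Realization),
      Δ.IsEdgeHomotopy (nf e.1) e.2 (nf (e.1 * P.val e.2)) θ ∧
      Δ.ExtrinsicallyTame θ (shift 8 f) ∧
      (∀ t : I, Δ.proj (θ (0, t)) = P.cayley.pathPt (1 : G) (P.pathFrom 1 (nf e.1))
        (phase 1 t * (nf e.1).length)) ∧
      ∀ t : I, Δ.proj (θ (1, t)) = P.cayley.pathPt (1 : G)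
        (P.pathFrom 1 (nf (e.1 * P.val e.2))) (phase 1 t * (nf (e.1 * P.val e.2)).length) := by
    intro e
    obtain ⟨Δ, φ, hφ, ht⟩ := h (nf e.1 ++ e.2 :: P.invWord (nf (e.1 * P.val e.2))) (by
      rw [P.eval_append, P.eval_cons, P.eval_invWord, hnf, hnf]
      group)
    exact ⟨Δ, Δ.exists_edgeHomotopy hf hlow (hgeo _) (hgeo _) (by rw [hnf, hnf]) hφ ht⟩
  choose Δ θ hθ htame h0 h1 using key
  -- An edge of the Cayley complex is not a loop, so a point over a vertex has parameter 0 or 1, and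
  -- in either case the curve is the standard one for that vertex.
  have hends : ∀ (e : G × A) (x : I) (g : G), P.cayley.onEdge e x = P.cayley.vtx g → ∀ t : I,
      (Δ e).proj (θ e (x, t)) =
        P.cayley.pathPt (1 : G) (P.pathFrom 1 (nf g)) (phase 1 t * (nf g).length) := by
    intro e x g hx t
    have hne : P.cayley.src e ≠ P.cayley.tgt e := by
      intro h
      have h' : e.1 = e.1 * P.val e.2 := h
      exact P.val_ne_one e.2 (by simpa using h'.symm)
    rcases TwoComplex.onEdge_eq_vtx hne hx with ⟨rfl, h2⟩ | ⟨rfl, h2⟩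
    · have h2' : e.1 = g := h2
      rw [h0, h2']
    · have h2' : e.1 * P.val e.2 = g := h2
      rw [h1, h2']
  exact ⟨{  nf := nf
            nf_eval := hnf
            nf_simple := fun g => (hgeo g).isSimple
            dir := fun e => Quot.out (r := fun d d' : P.cayley.D => d' = P.cayley.rev d) e
            dir_spec := fun e => Quot.out_eq e
            diagram := fun e => Δ _
            homotopy := fun e => θ _
            isEdgeHomotopy := fun e => hθ _
            consistent := fun g e e' x x' hx hx' t => by
              rw [hends _ x g hx, hends _ x' g hx'] }, hgeo, fun e => htame _⟩

theorem ExtrinsicGeodesicTameNormal.tameNormal {P : SymmetrizedPresentation G A}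
    {f : QuarterNat → QuarterNat} (h : ExtrinsicGeodesicTameNormal P f) :
    ExtrinsicTameNormal P f := by
  obtain ⟨E, -, h⟩ := h
  exact ⟨E, h⟩

end TameFilling

namespace TameFilling

universe u v
variable {G : Type u} {A : Type v} [Group G]

/-! ### Cyclically consecutive entries of lists -/

/-- `b` follows `a` in the cyclic list `l`. -/
def CycNext {D : Type*} (l : List D) (a b : D) : Prop :=
  ∃ k : Fin l.length, l.get k = a ∧ l.get (cycSucc k) = b

theorem cycNext_iff {D : Type*} {l : List D} {a b : D} : CycNext l a b ↔
    (∃ s t, l = s ++ a :: b :: t) ∨ (l.head? = some b ∧ l.getLast? = some a) := by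
  constructor
  · rintro ⟨⟨k, hk⟩, rfl, rfl⟩
    rcases Nat.lt_or_ge (k + 1) l.length with h | h
    · left
      have e : cycSucc (⟨k, hk⟩ : Fin l.length) = ⟨k + 1, h⟩ := Fin.ext (Nat.mod_eq_of_lt h)
      refine ⟨l.take k, l.drop (k + 2), ?_⟩
      rw [e]
      simp
    · right
      have h' : k + 1 = l.length := by omega
      have e : cycSucc (⟨k, hk⟩ : Fin l.length) = ⟨0, by omega⟩ :=
        Fin.ext (by simp [cycSucc, h'])
      rw [e]
      constructor
      · rw [List.head?_eq_getElem?]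
        simp
      · have h2 : l.length - 1 = k := by omega
        rw [List.getLast?_eq_getElem?, h2]
        simp
  · rintro (⟨s, t, rfl⟩ | ⟨h1, h2⟩)
    · refine ⟨⟨s.length, by simp⟩, by simp, ?_⟩
      have e : cycSucc (⟨s.length, by simp⟩ : Fin (s ++ a :: b :: t).length) =
          ⟨s.length + 1, by simp⟩ := Fin.ext (Nat.mod_eq_of_lt (by simp))
      rw [e]
      simp
    · have hne : l ≠ [] := by rintro rfl; simp at h1
      have hl : 0 < l.length := List.length_pos_of_ne_nil hne
      refine ⟨⟨l.length - 1, by omega⟩, ?_, ?_⟩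
      · rw [List.getLast?_eq_getElem?, List.getElem?_eq_getElem (by omega)] at h2
        simpa using h2
      · have e : cycSucc (⟨l.length - 1, by omega⟩ : Fin l.length) = ⟨0, hl⟩ :=
          Fin.ext (by simp [cycSucc, Nat.sub_add_cancel hl])
        rw [e]
        rw [List.head?_eq_getElem?, List.getElem?_eq_getElem hl] at h1
        simpa using h1

theorem CycNext.map {D D' : Type*} {l : List D} {a b : D} (h : CycNext l a b) (f : D → D') :
    CycNext (l.map f) (f a) (f b) := by
  rw [cycNext_iff] at h ⊢
  rcases h with ⟨s, t, rfl⟩ | ⟨h1, h2⟩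
  · exact Or.inl ⟨s.map f, t.map f, by simp⟩
  · exact Or.inr ⟨by simp [h1], by simp [h2]⟩

theorem CycNext.reverse {D : Type*} {l : List D} {a b : D} (h : CycNext l a b) :
    CycNext l.reverse b a := by
  rw [cycNext_iff] at h ⊢
  rcases h with ⟨s, t, rfl⟩ | ⟨h1, h2⟩
  · exact Or.inl ⟨t.reverse, s.reverse, by simp⟩
  · exact Or.inr ⟨by simp [h2], by simp [h1]⟩

theorem corner_iff {F D : Type} {rev : D → D} {cw : F → List D} {b : List D} {d d' : D} :
    Corner rev cw b d d' ↔ (∃ f, CycNext (cw f) (rev d) d') ∨ CycNext b (rev d) d' := Iff.rfl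

theorem eqvGen_of_forall {D : Type*} {r s : D → D → Prop}
    (h : ∀ x y, r x y → Relation.EqvGen s x y) {x y : D} (hxy : Relation.EqvGen r x y) :
    Relation.EqvGen s x y := by
  induction hxy with
  | rel _ _ h' => exact h _ _ h'
  | refl => exact Relation.EqvGen.refl _
  | symm _ _ _ ih => exact Relation.EqvGen.symm _ _ ih
  | trans _ _ _ _ _ ih1 ih2 => exact Relation.EqvGen.trans _ _ _ ih1 ih2

/-! ### Sides of cells, and mirror images -/

namespace VanKampenDiagram

variable {P : SymmetrizedPresentation G A} {w : List A}

/-- The sides of the 2-cells and of the outer region fit the directed edges if each directed edge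
is a side and their numbers agree. -/
theorem sides_of_card {F D : Type} [Finite F] {cw : F → List D} {b : List D}
    (h : ∀ d, (∃ f, d ∈ cw f) ∨ d ∈ b)
    (hc : Nat.card ((Σ f : F, Fin (cw f).length) ⊕ Fin b.length) = Nat.card D) :
    Function.Bijective
      (Sum.elim (fun s : Σ f : F, Fin (cw f).length => (cw s.1).get s.2) b.get) := by
  rw [Nat.bijective_iff_surjective_and_card]
  refine ⟨fun d => ?_, hc⟩
  rcases h d with ⟨f, hf⟩ | hb
  · obtain ⟨i, hi⟩ := List.get_of_mem hf
    exact ⟨Sum.inl ⟨f, i⟩, hi⟩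
  · obtain ⟨i, hi⟩ := List.get_of_mem hb
    exact ⟨Sum.inr i, hi⟩

variable (Δ : VanKampenDiagram P w)

theorem mem_side (d : Δ.D) : (∃ f, d ∈ Δ.cw f) ∨ d ∈ Δ.bdry := by
  obtain ⟨⟨f, i⟩ | i, h⟩ := Δ.sides.2 d
  · exact Or.inl ⟨f, h ▸ List.get_mem _ _⟩
  · exact Or.inr (h ▸ List.get_mem _ _)

theorem card_sides :
    Nat.card ((Σ f : Δ.F, Fin (Δ.cw f).length) ⊕ Fin Δ.bdry.length) = Nat.card Δ.D :=
  Nat.card_congr (Equiv.ofBijective _ Δ.sides)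

/-- The mirror image of a diagram. -/
def mirror {w' : List A} (hw : P.invWord w = w') : VanKampenDiagram P w' where
  toTwoComplex := Δ.toTwoComplex
  finite_V := Δ.finite_V
  finite_D := Δ.finite_D
  finite_F := Δ.finite_F
  base := Δ.base
  label := Δ.label
  label_rev := Δ.label_rev
  label_face := Δ.label_face
  pos := Δ.pos
  pos_base := Δ.pos_base
  pos_tgt := Δ.pos_tgt
  cw f := Δ.revPath (Δ.cw f)
  cw_spec f := by
    rcases Δ.cw_spec f with h | h
    · exact Or.inr (congrArg Δ.revPath h)
    · exact Or.inl ((congrArg Δ.revPath h).trans (TwoComplex.revPath_revPath _))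
  bdry := Δ.revPath Δ.bdry
  bdry_isPath := Δ.bdry_isPath.revPath
  bdry_label := by rw [map_label_revPath, Δ.bdry_label, hw]
  connected := Δ.connected
  sides := by
    have := Δ.finite_F
    refine sides_of_card (fun d => ?_) ?_
    · rcases Δ.mem_side (Δ.rev d) with ⟨f, h⟩ | h
      · exact Or.inl ⟨f, TwoComplex.mem_revPath.2 h⟩
      · exact Or.inr (TwoComplex.mem_revPath.2 h)
    · rw [← Δ.card_sides]
      exact Nat.card_congr (Equiv.sumCongr (Equiv.sigmaCongrRight fun f =>
        finCongr (TwoComplex.length_revPath _)) (finCongr (TwoComplex.length_revPath _)))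
  link := by
    -- Reversing all boundary paths exchanges the two edges of each corner, so the rotation about a
    -- vertex changes its sense but keeps its orbits.
    have key : ∀ {l : List Δ.D} {d d' : Δ.D}, CycNext l (Δ.rev d) d' →
        CycNext (Δ.revPath l) (Δ.rev d') d := by
      intro l d d' h
      have := (h.map Δ.rev).reverse
      rwa [Δ.rev_rev] at this
    intro d d' h
    refine Relation.EqvGen.symm _ _ ?_
    refine eqvGen_of_forall (fun x y hxy => ?_) (Δ.link d' d h.symm)
    refine Relation.EqvGen.symm _ _ (Relation.EqvGen.rel _ _ ?_)
    rw [corner_iff] at hxy ⊢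
    rcases hxy with ⟨f, h⟩ | h
    · exact Or.inl ⟨f, key h⟩
    · exact Or.inr (key h)
  euler := Δ.euler

/-- A filling provides only one direction for each undirected edge, whereas a combing needs diagrams
for both. -/
theorem IsEdgeHomotopy.mirror {Δ : VanKampenDiagram P w} {w₁ w₂ w' : List A} {a : A}
    (hw : P.invWord w = w') {θ : I × I → Δ.Realization} (h : Δ.IsEdgeHomotopy w₁ a w₂ θ) :
    (Δ.mirror hw).IsEdgeHomotopy w₂ (P.inv a) w₁ (fun z => θ (σ z.1, z.2)) := by
  obtain ⟨p₁, d, p₂, hb, h1, h2, h3, h4, h5, h6, h7, h8⟩ := h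
  refine ⟨p₂, Δ.rev d, p₁, ?_, h3, ?_, h1, ?_, fun x => h5 _, fun x => ?_, ?_, ?_⟩
  · change Δ.revPath Δ.bdry = p₂ ++ Δ.rev d :: Δ.revPath p₁
    rw [hb, TwoComplex.revPath_append, TwoComplex.revPath_cons, TwoComplex.revPath_revPath]
    simp
  · exact (Δ.label_rev d).trans (by rw [h2])
  · exact h4.comp (by fun_prop)
  · exact (h6 _).trans (TwoComplex.onEdge_rev' d x).symm
  · change Δ.Follows (fun t => θ (σ 0, t)) Δ.base p₂
    rwa [unitInterval.symm_zero]
  · change Δ.Follows (fun t => θ (σ 1, t)) Δ.base p₁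
    rwa [unitInterval.symm_one]

end VanKampenDiagram

end TameFilling

namespace TameFilling

universe u v
variable {G : Type u} {A : Type v} [Group G]

/-! ### Maps on the product of the 1-skeleton with the interval, and combings -/

namespace TwoComplex

universe u' v' w'
variable {K : TwoComplex.{u', v', w'}}

/-- The 1-skeleton as the image of the vertices and the closed edges. -/
def skeletonMap (K : TwoComplex.{u', v', w'}) :
    (Σ _ : K.V, Unit) ⊕ (Σ _ : K.D, I) → K.skeletonOne
  | .inl x => ⟨K.vtx x.1, Or.inl ⟨_, rfl⟩⟩
  | .inr z => ⟨K.onEdge z.1 z.2, Or.inr ⟨_, _, rfl⟩⟩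

theorem continuous_skeletonMap : Continuous K.skeletonMap := by
  refine continuous_sum_dom.2 ⟨continuous_sigma fun x => ?_, continuous_sigma fun d => ?_⟩
  · exact continuous_of_discreteTopology
  · exact (continuous_onEdge d).subtype_mk _

/-- The subspace topology of the 1-skeleton has to agree with its own quotient topology: a set open
along all edges is extended radially into the 2-cells to an open set of the whole complex. -/
theorem isQuotientMap_skeletonMap : Topology.IsQuotientMap K.skeletonMap := by
  have hs : Function.Surjective K.skeletonMap := by
    rintro ⟨q, ⟨x, rfl⟩ | ⟨d, x, rfl⟩⟩
    · exact ⟨Sum.inl ⟨x, ()⟩, rfl⟩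
    · exact ⟨Sum.inr ⟨d, x⟩, rfl⟩
  refine ⟨Topology.isCoinducing_iff.2 fun U =>
    ⟨fun h => ?_, fun h => h.preimage continuous_skeletonMap⟩, hs⟩
  -- The radial extension leaves out the centres of the 2-cells, where the radial projection to the
  -- boundary is undefined.
  let W : K.Realization → Prop := Quot.lift (fun a => match a with
    | .inl ⟨x, _⟩ => ∃ h : K.vtx x ∈ K.skeletonOne, ⟨K.vtx x, h⟩ ∈ U
    | .inr (.inl ⟨d, x⟩) => ∃ h : K.onEdge d x ∈ K.skeletonOne, ⟨K.onEdge d x, h⟩ ∈ U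
    | .inr (.inr ⟨⟨f, k⟩, (x, r)⟩) => r ≠ 0 ∧
      ∃ h : K.onEdge ((K.bd f).get k) x ∈ K.skeletonOne,
        ⟨K.onEdge ((K.bd f).get k) x, h⟩ ∈ U) (by
      intro p q hpq
      cases hpq with
      | start d => simp only [onEdge_zero]
      | rev d x => simp only [onEdge_rev]
      | centre f k k' x x' => simp
      | ray f k r =>
        have : K.onEdge ((K.bd f).get k) 1 = K.onEdge ((K.bd f).get (cycSucc k)) 0 := by
          rw [onEdge_one, onEdge_zero, tgt, K.bd_closed]
        simp only [this]
      | side f k x => simp)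
  have hW : IsOpen {q | W q} := by
    rw [isOpen_iff_cells]
    have he : ∀ d, IsOpen {x : I | ∃ h : K.onEdge d x ∈ K.skeletonOne, ⟨K.onEdge d x, h⟩ ∈ U} := by
      intro d
      have h2 : IsOpen ((fun x : I => (Sum.inr ⟨d, x⟩ : (Σ _ : K.V, Unit) ⊕ (Σ _ : K.D, I))) ⁻¹'
          (K.skeletonMap ⁻¹' U)) := h.preimage (continuous_inr.comp continuous_sigmaMk)
      convert h2 using 1
      ext x
      exact ⟨fun ⟨_, h⟩ => h, fun h => ⟨_, h⟩⟩
    refine ⟨fun d => he d, fun f k => ?_⟩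
    exact IsOpen.inter (isOpen_ne.preimage continuous_snd) ((he _).preimage continuous_fst)
  have hU : U = Subtype.val ⁻¹' {q | W q} := by
    ext ⟨q, hq⟩
    rcases hq with ⟨x, rfl⟩ | ⟨d, x, rfl⟩
    · exact ⟨fun h => ⟨_, h⟩, fun ⟨_, h⟩ => h⟩
    · exact ⟨fun h => ⟨_, h⟩, fun ⟨_, h⟩ => h⟩
  rw [hU]
  exact hW.preimage continuous_subtype_val

/-- A compatible family of maps `I × I → Y` on the edges induces a continuous map on the product of
the 1-skeleton with `I`. -/
theorem exists_continuous_skeletonOne {Y : Type*} [TopologicalSpace Y] (V : K.V → I → Y)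
    (T : K.D → I → I → Y) (hV : ∀ x, Continuous (V x))
    (hT : ∀ d, Continuous fun z : I × I => T d z.1 z.2)
    (h0 : ∀ d t, T d 0 t = V (K.src d) t) (hr : ∀ d x t, T (K.rev d) (σ x) t = T d x t) :
    ∃ Υ : K.skeletonOne × I → Y, Continuous Υ ∧
      (∀ x h t, Υ (⟨K.vtx x, h⟩, t) = V x t) ∧
      ∀ d x h t, Υ (⟨K.onEdge d x, h⟩, t) = T d x t := by
  have hT' : ∀ d x, Continuous (T d x) := fun d x =>
    (hT d).comp (by fun_prop : Continuous fun t : I => (x, t))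
  -- Currying avoids products of quotient maps: a map into the space of paths is continuous once it
  -- is so on each edge, and it uncurries because the interval is locally compact. Values inside
  -- 2-cells are placeholders, as only the restriction to the 1-skeleton is used.
  let F : K.Realization → C(I, Y) := Quot.lift (fun a => match a with
    | .inl ⟨x, _⟩ => ⟨V x, hV x⟩
    | .inr (.inl ⟨d, x⟩) => ⟨T d x, hT' d x⟩
    | .inr (.inr ⟨⟨f, k⟩, (x, r)⟩) => if r = 1 then ⟨T ((K.bd f).get k) x,
        hT' ((K.bd f).get k) x⟩ else
          ⟨V (K.src ((K.bd f).head (K.bd_ne_nil f))), hV _⟩) (by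
      intro p q hpq
      cases hpq with
      | start d => ext t; exact h0 d t
      | rev d x => ext t; exact (hr d x t).symm
      | centre f k k' x x' => simp
      | ray f k r =>
        have : ∀ t, T ((K.bd f).get k) 1 t = T ((K.bd f).get (cycSucc k)) 0 t := by
          intro t
          rw [← hr, unitInterval.symm_one, h0, h0, K.bd_closed]
        by_cases hr1 : r = 1
        · simp only [hr1, if_true]
          ext t
          exact this t
        · simp only [hr1, if_false]
      | side f k x => simp)
  have hF : Continuous fun p : K.skeletonOne => F p := by
    rw [isQuotientMap_skeletonMap.continuous_iff]
    refine continuous_sum_dom.2 ⟨continuous_sigma fun x => ?_, continuous_sigma fun d => ?_⟩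
    · exact continuous_of_discreteTopology
    · exact (ContinuousMap.curry ⟨fun z : I × I => T d z.1 z.2, hT d⟩).continuous
  refine ⟨fun z => F z.1 z.2, ?_, fun _ _ _ => rfl, fun _ _ _ _ => rfl⟩
  exact ContinuousMap.continuous_uncurry_of_continuous
    (⟨fun p : K.skeletonOne => F p, hF⟩ : C(K.skeletonOne, C(I, Y)))

/-- The set `{d, rev d}` is an invariant of the undirected edge. -/
theorem edge_eq_or {d d' : K.D} (h : (Quot.mk _ d : K.Edge) = Quot.mk _ d') :
    d = d' ∨ d = K.rev d' := by
  let F : K.Edge → Set K.D := Quot.lift (fun d => {d, K.rev d}) (by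
    rintro a b rfl
    rw [K.rev_rev, Set.pair_comm])
  have h1 : F (Quot.mk _ d) = F (Quot.mk _ d') := congrArg F h
  have h2 : d ∈ F (Quot.mk _ d') := h1 ▸ Set.mem_insert d _
  exact h2

end TwoComplex

/-- The projected edge homotopies fit together because the filling is consistent at vertices.
Nothing is lost in the tameness function, since every curve of the combing is one of theirs. -/
theorem ExtrinsicTameNormal.radial {P : SymmetrizedPresentation G A}
    {f : QuarterNat → QuarterNat} (h : ExtrinsicTameNormal P f) : RadialTameCombing P f := by
  classical
  obtain ⟨E, hE⟩ := h
  have hnf1 : E.nf 1 = [] := (E.nf_simple 1).eq_nil (E.nf_eval 1)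
  rcases isEmpty_or_nonempty A with hA | ⟨⟨a₀⟩⟩
  -- Without letters the group is trivial and the 1-skeleton is a point. Otherwise every vertex is
  -- an end point of some edge, which is used to define its curve.
  · have hG : ∀ g : G, g = 1 := by
      intro g
      rw [← E.nf_eval g, Subsingleton.elim (E.nf g) []]
      rfl
    have hS' : ∀ p : P.cayley.skeletonOne, (p : P.cayley.Realization) = P.cayley.vtx (1 : G) := by
      rintro ⟨q, ⟨x, rfl⟩ | ⟨d, x, rfl⟩⟩
      · exact congrArg P.cayley.vtx (hG x)
      · exact hA.elim d.2
    refine ⟨fun _ => P.cayley.vtx (1 : G), ⟨continuous_const, fun _ => rfl,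
      fun p => (hS' p).symm, fun _ _ => Or.inl ⟨_, rfl⟩, fun _ => rfl, fun _ => [], fun g => ?_,
      fun g a => hA.elim a⟩, fun p s t _ => ?_⟩
    · exact ⟨(hG g).symm, by simp [SymmetrizedPresentation.IsSimple], fun _ => 0,
        continuous_const, monotone_const, rfl, by simp [SymmetrizedPresentation.pathFrom],
        fun _ => rfl⟩
    · change (P.height (P.cayley.vtx (1 : G)) : ℚ) ≤ f (P.height (P.cayley.vtx (1 : G)))
      refine le_trans ?_ (QuarterNat.coe_nonneg _)
      have h0 := TwoComplex.coarseDist_vtx (K := P.cayley) (1 : G) (1 : G)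
      exact (h0.trans (by exact_mod_cast TwoComplex.dist_self (K := P.cayley) (1 : G))).le
  let c : P.cayley.D → P.cayley.Edge := fun d => Quot.mk _ d
  have hdir : ∀ d, E.dir (c d) = d ∨ E.dir (c d) = P.cayley.rev d := fun d =>
    TwoComplex.edge_eq_or (E.dir_spec (c d))
  have hcrev : ∀ d, c (P.cayley.rev d) = c d := fun d =>
    (Quot.sound (r := fun d d' : P.cayley.D => d' = P.cayley.rev d) rfl).symm
  obtain ⟨S, hS⟩ : ∃ S : P.cayley.Edge → I → I → P.cayley.Realization,
      ∀ e x t, S e x t = (E.diagram e).proj (E.homotopy e (x, t)) := ⟨_, fun _ _ _ => rfl⟩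
  let T : P.cayley.D → I → I → P.cayley.Realization := fun d x t =>
    if E.dir (c d) = d then S (c d) x t else S (c d) (σ x) t
  -- By consistency any edge leaving `g` gives the same curve; the letter `a₀` is arbitrary.
  let V : P.cayley.V → I → P.cayley.Realization := fun g t => T (g, a₀) 0 t
  have hhom : ∀ e, Continuous fun z : I × I => S e z.1 z.2 := by
    intro e
    simp only [hS]
    obtain ⟨_, _, _, _, _, _, _, hc, _⟩ := E.isEdgeHomotopy e
    exact (E.diagram e).continuous_proj.comp hc
  have hTc : ∀ d, Continuous fun z : I × I => T d z.1 z.2 := by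
    intro d
    by_cases hd : E.dir (c d) = d
    · simp only [T, if_pos hd]
      exact hhom (c d)
    · simp only [T, if_neg hd]
      exact (hhom (c d)).comp (by fun_prop : Continuous fun z : I × I => (σ z.1, z.2))
  have hTr : ∀ d x t, T (P.cayley.rev d) (σ x) t = T d x t := by
    intro d x t
    simp only [T]
    rw [hcrev, unitInterval.symm_symm]
    rcases hdir d with h | h
    · rw [if_pos h, if_neg]
      rw [h]
      exact (P.cayley.rev_ne d).symm
    · rw [if_pos h, if_neg]
      rw [h]
      exact P.cayley.rev_ne d
  have hT0 : ∀ d t, T d 0 t = V (P.cayley.src d) t := by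
    have key : ∀ d : P.cayley.D, ∃ x : I, (∀ t, T d 0 t = S (c d) x t) ∧
        P.cayley.onEdge (E.dir (c d)) x = P.cayley.vtx (P.cayley.src d) := by
      intro d
      by_cases h : E.dir (c d) = d
      · refine ⟨0, fun t => by simp only [T, if_pos h], ?_⟩
        rw [h]
        exact TwoComplex.onEdge_zero d
      · refine ⟨1, fun t => by simp only [T, if_neg h, unitInterval.symm_zero], ?_⟩
        rw [(hdir d).resolve_left h, TwoComplex.onEdge_one, TwoComplex.tgt_rev]
    intro d t
    obtain ⟨x, h1, h2⟩ := key d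
    obtain ⟨x', h3, h4⟩ := key (d.1, a₀)
    change T d 0 t = T (d.1, a₀) 0 t
    rw [h1, h3, hS, hS]
    exact E.consistent d.1 _ _ x x' h2 h4 t
  have hV : ∀ g : P.cayley.V, Continuous (V g) := fun g =>
    (hTc (g, a₀)).comp (by fun_prop : Continuous fun t : I => ((0 : I), t))
  obtain ⟨Υ, hΥ, hΥv, hΥe⟩ := TwoComplex.exists_continuous_skeletonOne V T hV hTc hT0 hTr
  have hdiag : ∀ d : G × A, ∃ (Δ : VanKampenDiagram P
      (E.nf d.1 ++ d.2 :: P.invWord (E.nf (d.1 * P.val d.2)))) (θ : I × I → Δ.Realization),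
      Δ.IsEdgeHomotopy (E.nf d.1) d.2 (E.nf (d.1 * P.val d.2)) θ ∧
      ∀ x t, T d x t = Δ.proj (θ (x, t)) := by
    intro d
    by_cases hd : E.dir (c d) = d
    -- The type of the diagram depends on the chosen direction, so the directed edge is generalized
    -- before the equation is substituted.
    · have : ∀ d', E.dir (c d) = d' → ∃ (Δ : VanKampenDiagram P
          (E.nf d'.1 ++ d'.2 :: P.invWord (E.nf (d'.1 * P.val d'.2)))) (θ : I × I → Δ.Realization),
          Δ.IsEdgeHomotopy (E.nf d'.1) d'.2 (E.nf (d'.1 * P.val d'.2)) θ ∧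
          ∀ x t, T d x t = Δ.proj (θ (x, t)) := by
        rintro _ rfl
        exact ⟨E.diagram (c d), E.homotopy (c d), E.isEdgeHomotopy (c d), fun x t => (if_pos hd).trans (hS _ _ _)⟩
      exact this d hd
    · have : ∀ d', P.cayley.rev (E.dir (c d)) = d' → ∃ (Δ : VanKampenDiagram P
          (E.nf d'.1 ++ d'.2 :: P.invWord (E.nf (d'.1 * P.val d'.2)))) (θ : I × I → Δ.Realization),
          Δ.IsEdgeHomotopy (E.nf d'.1) d'.2 (E.nf (d'.1 * P.val d'.2)) θ ∧
          ∀ x t, T d x t = Δ.proj (θ (x, t)) := by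
        rintro _ rfl
        -- The reversed edge ends where the chosen one starts; this identifies the word required by
        -- the reversed direction with that of the mirror image.
        have hmul : (P.cayley.rev (E.dir (c d))).1 * P.val (P.cayley.rev (E.dir (c d))).2 =
            (E.dir (c d)).1 := by
          change ((E.dir (c d)).1 * P.val (E.dir (c d)).2) * P.val (P.inv (E.dir (c d)).2) = _
          rw [P.val_inv]
          group
        rw [hmul]
        have hw : P.invWord (E.nf (E.dir (c d)).1 ++ (E.dir (c d)).2 ::
            P.invWord (E.nf ((E.dir (c d)).1 * P.val (E.dir (c d)).2))) =
            E.nf (P.cayley.rev (E.dir (c d))).1 ++ (P.cayley.rev (E.dir (c d))).2 ::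
              P.invWord (E.nf (E.dir (c d)).1) := by
          have := P.invWord_invWord (E.nf ((E.dir (c d)).1 * P.val (E.dir (c d)).2))
          simp only [SymmetrizedPresentation.invWord] at this ⊢
          simp [SymmetrizedPresentation.cayley, Function.comp_def, P.inv_inv]
        refine ⟨(E.diagram (c d)).mirror hw, fun z => E.homotopy (c d) (σ z.1, z.2),
          (E.isEdgeHomotopy (c d)).mirror hw, fun x t => (if_neg hd).trans (hS _ _ _)⟩
      exact this d ((congrArg P.cayley.rev ((hdir d).resolve_left hd)).trans (P.cayley.rev_rev d))
  have hdart : ∀ d : G × A, ∃ ρ : I → ℝ, Continuous ρ ∧ Monotone ρ ∧ ρ 0 = 0 ∧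
      ρ 1 = (E.nf d.1).length ∧ (∀ t, T d 0 t =
        P.cayley.pathPt (1 : G) (P.pathFrom 1 (E.nf d.1)) (ρ t)) ∧
      (∀ x, T d x 0 = P.cayley.vtx (1 : G)) ∧ ∀ x, T d x 1 = P.cayley.onEdge d x := by
    intro d
    obtain ⟨Δ, θ, ⟨p₁, d', p₂, hb, h1, h2, h3, h4, h5, h6, ⟨ρ, r1, r2, r3, r4, r5⟩, -⟩, h8⟩ := hdiag d
    have hp := Δ.isPath_of_bdry_eq hb
    refine ⟨ρ, r1, r2, r3, ?_, fun t => ?_, fun x => ?_, fun x => ?_⟩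
    · rw [r4]
      simpa using congrArg (fun l => (l.length : ℝ)) h1
    · have := r5 t
      simp only at this
      rw [h8, this, Δ.proj_pathPt hp.1, h1, Δ.pos_base]
    · rw [h8, h5, Δ.proj_basePt]
    · rw [h8, h6, Δ.proj_onEdge]
      congr 1
      refine Prod.ext ?_ h2
      change Δ.pos (Δ.src d') = d.1
      rw [Δ.pos_isPath hp.1, h1, Δ.pos_base, one_mul, E.nf_eval]
  refine ⟨Υ, ⟨hΥ, ?_, ?_, ?_, ?_, E.nf, fun g => ⟨E.nf_eval g, E.nf_simple g, ?_⟩, fun g a => ?_⟩,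
    ?_⟩
  · rintro ⟨q, ⟨g, rfl⟩ | ⟨d, x, rfl⟩⟩
    · obtain ⟨ρ, -, -, -, -, -, h, -⟩ := hdart (g, a₀)
      exact (hΥv _ _ _).trans (h 0)
    · obtain ⟨ρ, -, -, -, -, -, h, -⟩ := hdart d
      exact (hΥe _ _ _ _).trans (h x)
  · rintro ⟨q, ⟨g, rfl⟩ | ⟨d, x, rfl⟩⟩
    · obtain ⟨ρ, -, -, -, -, -, -, h⟩ := hdart (g, a₀)
      exact ((hΥv _ _ _).trans (h 0)).trans (TwoComplex.onEdge_zero (K := P.cayley) (g, a₀))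
    · obtain ⟨ρ, -, -, -, -, -, -, h⟩ := hdart d
      exact (hΥe _ _ _ _).trans (h x)
  · intro g t
    obtain ⟨ρ, -, -, -, -, h, -, -⟩ := hdart (g, a₀)
    exact ((hΥv g _ t).trans (h t)) ▸ TwoComplex.pathPt_mem_skeletonOne _ _ _
  · intro t
    obtain ⟨ρ, -, -, -, -, h, -, -⟩ := hdart (1, a₀)
    refine ((hΥv (1 : G) _ t).trans (h t)).trans ?_
    change P.cayley.pathPt (1 : G) (P.pathFrom 1 (E.nf 1)) (ρ t) = _
    rw [hnf1]
    rfl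
  · obtain ⟨ρ, r1, r2, r3, r4, h, -, -⟩ := hdart (g, a₀)
    refine ⟨ρ, r1, r2, r3, ?_, fun t => ?_⟩
    · rw [P.length_cayleyPath]
      exact r4
    · exact (hΥv g _ t).trans (h t)
  · obtain ⟨Δ, θ, h1, h2⟩ := hdiag (g, a)
    refine ⟨Δ, θ, h1, fun x t => ?_⟩
    exact (hΥe (g, a) x _ t).trans (h2 x t)
  · have hT : ∀ d x s t, s < t → P.height (T d x s) ≤ f (P.height (T d x t)) := by
      intro d x s t hst
      by_cases h : E.dir (c d) = d
      · simp only [T, if_pos h, hS]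
        exact hE (c d) x s t hst
      · simp only [T, if_neg h, hS]
        exact hE (c d) (σ x) s t hst
    rintro ⟨q, ⟨g, rfl⟩ | ⟨d, x, rfl⟩⟩ s t hst
    · have := hT (g, a₀) 0 s t hst
      rwa [← show Υ (⟨_, _⟩, s) = T (g, a₀) 0 s from hΥv g (Or.inl ⟨g, rfl⟩) s,
        ← show Υ (⟨_, _⟩, t) = T (g, a₀) 0 t from hΥv g (Or.inl ⟨g, rfl⟩) t] at this
    · have := hT d x s t hst
      rwa [← hΥe d x (Or.inr ⟨d, x, rfl⟩) s, ← hΥe d x (Or.inr ⟨d, x, rfl⟩) t] at this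

end TameFilling

namespace TameFilling

universe u v
variable {G : Type u} {A : Type v} [Group G]

/-! ### The rotation of directed edges about a vertex -/

theorem cycSucc_bijective {n : ℕ} : Function.Bijective (cycSucc : Fin n → Fin n) := by
  rw [← Finite.injective_iff_bijective]
  intro i j h
  have h' : (i.1 + 1) % n = (j.1 + 1) % n := congrArg Fin.val h
  have := i.2
  have := j.2
  apply Fin.ext
  rcases Nat.lt_or_ge (i.1 + 1) n with h1 | h1 <;> rcases Nat.lt_or_ge (j.1 + 1) n with h2 | h2
  · rw [Nat.mod_eq_of_lt h1, Nat.mod_eq_of_lt h2] at h'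
    omega
  · rw [Nat.mod_eq_of_lt h1, show j.1 + 1 = n by omega, Nat.mod_self] at h'
    omega
  · rw [Nat.mod_eq_of_lt h2, show i.1 + 1 = n by omega, Nat.mod_self] at h'
    omega
  · omega

theorem TwoComplex.IsPath.src_of_cycNext {K : TwoComplex} {x : K.V} {l : List K.D}
    (h : K.IsPath x l x) {a b : K.D} (hab : CycNext l a b) : K.src b = K.tgt a := by
  rw [cycNext_iff] at hab
  rcases hab with ⟨s, t, rfl⟩ | ⟨h1, h2⟩
  · rw [TwoComplex.isPath_append] at h
    exact h.2.2.1
  · obtain ⟨l', rfl⟩ := List.getLast?_eq_some_iff.1 h2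
    have h3 := h
    rw [TwoComplex.isPath_append] at h
    have h4 : K.tgt a = x := h.2.2
    rw [h4]
    cases l' with
    | nil =>
      obtain rfl : a = b := by simpa using h1
      exact h3.1
    | cons c l' =>
      obtain rfl : c = b := by simpa using h1
      exact h3.1

/-- On a finite set an injective map permutes its orbits as cycles. A cycle with at most one link
removed is still connected, the other way round. -/
theorem Function.Injective.eqvGen_avoiding {D : Type*} [Finite D] {p : D → D}
    (hp : Function.Injective p) {X : Set D} {C : D → D → Prop}
    (hC : ∀ d, ∀ k, C d (p^[k] d)) (hX : ∀ x ∈ X, ∀ y ∈ X, C x y → x = y) {a b : D}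
    (h : Relation.EqvGen (fun a b => p a = b) a b) :
    Relation.EqvGen (fun a b => p a = b ∧ a ∉ X) a b := by
  refine eqvGen_of_forall ?_ h
  rintro x _ rfl
  by_cases hx : x ∈ X
  · obtain ⟨n, hn, hn'⟩ : ∃ n, 0 < n ∧ p^[n] x = x := by
      have := hp.mem_periodicPts x
      exact ⟨Function.minimalPeriod p x, Function.minimalPeriod_pos_of_mem_periodicPts this,
        Function.iterate_minimalPeriod⟩
    have key : ∀ k, Relation.EqvGen (fun a b => p a = b ∧ a ∉ X) (p x) (p^[k + 1] x) := by
      intro k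
      induction k with
      | zero => exact Relation.EqvGen.refl _
      | succ k ih =>
        by_cases hk : p^[k + 1] x ∈ X
        · rw [Function.iterate_succ_apply', ← hX x hx _ hk (hC x _)]
          exact Relation.EqvGen.refl _
        · refine Relation.EqvGen.trans _ _ _ ih (Relation.EqvGen.rel _ _ ⟨?_, hk⟩)
          rw [← Function.iterate_succ_apply' p]
    have := key (n - 1)
    rw [Nat.sub_add_cancel hn, hn'] at this
    exact this.symm
  · exact Relation.EqvGen.rel _ _ ⟨rfl, hx⟩

namespace VanKampenDiagram

variable {P : SymmetrizedPresentation G A} {w : List A} (Δ : VanKampenDiagram P w)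

theorem src_of_cycNext_cw {f : Δ.F} {a b : Δ.D} (h : CycNext (Δ.cw f) a b) :
    Δ.src b = Δ.tgt a := by
  have hbd : ∀ {a b : Δ.D}, CycNext (Δ.bd f) a b → Δ.src b = Δ.tgt a := by
    rintro a b ⟨k, rfl, rfl⟩
    exact (Δ.bd_closed f k).symm
  rcases Δ.cw_spec f with hf | hf
  · rw [hf] at h
    exact hbd h
  · rw [hf] at h
    have h1 := (h.map Δ.rev).reverse
    rw [List.map_reverse, List.reverse_reverse, List.map_map,
      show Δ.rev ∘ Δ.rev = id from funext Δ.rev_rev, List.map_id] at h1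
    have := hbd h1
    rw [TwoComplex.tgt_rev] at this
    exact this.symm

/-- The sides of the 2-cells and of the outer region correspond to the directed edges. -/
noncomputable def sidesEquiv :
    ((Σ f : Δ.F, Fin (Δ.cw f).length) ⊕ Fin Δ.bdry.length) ≃ Δ.D :=
  Equiv.ofBijective _ Δ.sides

/-- The next directed edge around the initial vertex. -/
noncomputable def next (d : Δ.D) : Δ.D :=
  Δ.sidesEquiv (Sum.map (fun s => ⟨s.1, cycSucc s.2⟩) cycSucc (Δ.sidesEquiv.symm (Δ.rev d)))

theorem next_injective : Function.Injective Δ.next := by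
  refine Δ.sidesEquiv.injective.comp (Function.Injective.comp ?_
    (Δ.sidesEquiv.symm.injective.comp (Function.LeftInverse.injective Δ.rev_rev)))
  refine Function.Injective.sumMap ?_ cycSucc_bijective.1
  rintro ⟨f, i⟩ ⟨f', j⟩ h
  obtain ⟨rfl, h2⟩ := Sigma.mk.inj_iff.1 h
  exact congrArg (Sigma.mk f) (cycSucc_bijective.1 (eq_of_heq h2))

/-- Each directed edge is a side exactly once, so the corner relation is the graph of a function. -/
theorem corner_iff_next {d d' : Δ.D} : Corner Δ.rev Δ.cw Δ.bdry d d' ↔ Δ.next d = d' := by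
  constructor
  · rintro (⟨f, k, h1, h2⟩ | ⟨k, h1, h2⟩)
    · have : Δ.sidesEquiv.symm (Δ.rev d) = Sum.inl ⟨f, k⟩ := by
        rw [Equiv.symm_apply_eq]
        exact h1.symm
      rw [next, this]
      exact h2
    · have : Δ.sidesEquiv.symm (Δ.rev d) = Sum.inr k := by
        rw [Equiv.symm_apply_eq]
        exact h1.symm
      rw [next, this]
      exact h2
  · rintro rfl
    have h1 := Δ.sidesEquiv.apply_symm_apply (Δ.rev d)
    rw [next]
    generalize Δ.sidesEquiv.symm (Δ.rev d) = s at h1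
    rcases s with ⟨f, k⟩ | k
    · exact Or.inl ⟨f, k, h1, rfl⟩
    · exact Or.inr ⟨k, h1, rfl⟩

theorem src_next (d : Δ.D) : Δ.src (Δ.next d) = Δ.src d := by
  rcases corner_iff.1 (Δ.corner_iff_next.2 (rfl : Δ.next d = _)) with ⟨f, h⟩ | h
  · exact (Δ.src_of_cycNext_cw h).trans (TwoComplex.tgt_rev d)
  · exact (Δ.bdry_isPath.src_of_cycNext h).trans (TwoComplex.tgt_rev d)

/-- The directed edges at a vertex stay linked if one corner at each vertex is removed. -/
theorem link_avoiding {X : Set Δ.D} (hX : ∀ x ∈ X, ∀ y ∈ X, Δ.src x = Δ.src y → x = y)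
    {d d' : Δ.D} (h : Δ.src d = Δ.src d') :
    Relation.EqvGen (fun a b => Corner Δ.rev Δ.cw Δ.bdry a b ∧ a ∉ X) d d' := by
  have := Δ.finite_D
  have hl := Δ.link d d' h
  rw [show Corner Δ.rev Δ.cw Δ.bdry = fun a b => Δ.next a = b from
    funext₂ fun _ _ => propext Δ.corner_iff_next] at hl ⊢
  refine Function.Injective.eqvGen_avoiding Δ.next_injective
    (C := fun a b => Δ.src a = Δ.src b) (fun d k => ?_) hX hl
  induction k with
  | zero => rfl
  | succ k ih => rw [Function.iterate_succ_apply', src_next, ← ih]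

theorem nodup_bdry : Δ.bdry.Nodup := by
  rw [List.nodup_iff_injective_get]
  exact Δ.sides.1.comp Sum.inr_injective

/-- The 2-cell (or the outer region `none`) that has a directed edge as a side. -/
noncomputable def face (d : Δ.D) : Option Δ.F :=
  Sum.elim (fun s => some s.1) (fun _ => none) (Δ.sidesEquiv.symm d)

theorem face_eq_some {d : Δ.D} {f : Δ.F} (h : d ∈ Δ.cw f) : Δ.face d = some f := by
  obtain ⟨k, rfl⟩ := List.get_of_mem h
  rw [face, show (Δ.cw f).get k = Δ.sidesEquiv (Sum.inl ⟨f, k⟩) from rfl, Equiv.symm_apply_apply]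
  rfl

theorem face_eq_none {d : Δ.D} (h : d ∈ Δ.bdry) : Δ.face d = none := by
  obtain ⟨k, rfl⟩ := List.get_of_mem h
  rw [face, show Δ.bdry.get k = Δ.sidesEquiv (Sum.inr k) from rfl, Equiv.symm_apply_apply]
  rfl

/-- The corner between `d` and `next d` lies in one region, of which `rev d` and `next d` are
consecutive sides. -/
theorem face_next (d : Δ.D) : Δ.face (Δ.next d) = Δ.face (Δ.rev d) := by
  rw [face, face, next, Equiv.symm_apply_apply]
  rcases Δ.sidesEquiv.symm (Δ.rev d) with s | k <;> rfl

theorem mem_bdry_of_face {d : Δ.D} (h : Δ.face d = none) : d ∈ Δ.bdry := by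
  rcases Δ.mem_side d with ⟨f, hf⟩ | hb
  · rw [Δ.face_eq_some hf] at h
    simp at h
  · exact hb

end VanKampenDiagram

end TameFilling

namespace TameFilling

universe u v
variable {G : Type u} {A : Type v} [Group G]

/-! ### Images of relations and of cyclic lists -/

theorem eqvGen_map {D D' : Type*} {r : D → D → Prop} {s : D' → D' → Prop} (f : D → D')
    (h : ∀ x y, r x y → Relation.EqvGen s (f x) (f y)) {x y : D} (hxy : Relation.EqvGen r x y) :
    Relation.EqvGen s (f x) (f y) := by
  induction hxy with
  | rel _ _ h' => exact h _ _ h'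
  | refl => exact Relation.EqvGen.refl _
  | symm _ _ _ ih => exact Relation.EqvGen.symm _ _ ih
  | trans _ _ _ _ _ ih1 ih2 => exact Relation.EqvGen.trans _ _ _ ih1 ih2

/-- Consecutive entries of the image come from consecutive entries upstairs. This carries closedness
of 2-cell boundaries over to folded and wedged complexes. -/
theorem closed_map {V D V' D' : Type*} {src : D → V} {rev : D → D} {src' : D' → V'}
    {rev' : D' → D'} (hV : V → V') (hD : D → D') (h1 : ∀ d, src' (hD d) = hV (src d))
    (h2 : ∀ d, rev' (hD d) = hD (rev d)) {l : List D}
    (hl : ∀ k : Fin l.length, src (rev (l.get k)) = src (l.get (cycSucc k)))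
    (k : Fin (l.map hD).length) :
    src' (rev' ((l.map hD).get k)) = src' ((l.map hD).get (cycSucc k)) := by
  have e : ∀ a b, CycNext (l.map hD) a b → src' (rev' a) = src' b := by
    intro a b hab
    have hl' : ∀ a b, CycNext l a b → src (rev a) = src b := by
      rintro _ _ ⟨k, rfl, rfl⟩
      exact hl k
    rw [cycNext_iff] at hab
    rcases hab with ⟨s, t, hst⟩ | ⟨h3, h4⟩
    · obtain ⟨s', l', rfl, rfl, h5⟩ := List.map_eq_append_iff.1 hst
      obtain ⟨a', l'', rfl, rfl, h6⟩ := List.map_eq_cons_iff.1 h5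
      obtain ⟨b', t', rfl, rfl, rfl⟩ := List.map_eq_cons_iff.1 h6
      rw [h2, h1, h1, hl' a' b' (cycNext_iff.2 (Or.inl ⟨_, _, rfl⟩))]
    · rw [List.head?_map, Option.map_eq_some_iff] at h3
      rw [List.getLast?_map, Option.map_eq_some_iff] at h4
      obtain ⟨b', h5, rfl⟩ := h3
      obtain ⟨a', h6, rfl⟩ := h4
      rw [h2, h1, h1, hl' a' b' (cycNext_iff.2 (Or.inr ⟨h5, h6⟩))]
  exact e _ _ ⟨k, rfl, rfl⟩

theorem CycNext.append_comm {D : Type*} {s t : List D} {a b : D} (h : CycNext (s ++ t) a b) :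
    CycNext (t ++ s) a b := by
  have key : ∀ (c : D) (l : List D), CycNext (c :: l) a b → CycNext (l ++ [c]) a b := by
    intro c l h
    rw [cycNext_iff] at h ⊢
    rcases h with ⟨s, t, h⟩ | ⟨h1, h2⟩
    · cases s with
      | nil =>
        obtain ⟨rfl, rfl⟩ := List.cons.inj h
        exact Or.inr ⟨rfl, List.getLast?_concat⟩
      | cons e s =>
        obtain ⟨rfl, rfl⟩ := List.cons.inj h
        exact Or.inl ⟨s, t ++ [c], by simp⟩
    · obtain rfl : c = b := by simpa using h1
      rcases List.eq_nil_or_concat l with rfl | ⟨l', e, rfl⟩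
      · exact Or.inr ⟨rfl, h2⟩
      · obtain rfl : e = a := by
          rw [List.concat_eq_append, ← List.cons_append, List.getLast?_concat] at h2
          exact Option.some.inj h2
        exact Or.inl ⟨l', [], by simp⟩
  induction s generalizing t with
  | nil => simpa using h
  | cons c s ih =>
    have := ih (t := t ++ [c]) (by simpa using key c (s ++ t) h)
    simpa using this

theorem CycNext.of_append {D : Type*} {m l : List D} {a b : D} (h : CycNext (m ++ l) a b)
    (ha : a ∉ m) (hb : b ∉ m) (hm : m ≠ []) : ∃ s t, l = s ++ a :: b :: t := by
  rw [cycNext_iff] at h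
  rcases h with ⟨s, t, h⟩ | ⟨h1, -⟩
  · clear hm
    induction m generalizing s with
    | nil => exact ⟨s, t, h⟩
    | cons c m ih =>
      cases s with
      | nil => exact absurd (List.cons.inj h).1.symm (fun e => ha (by simp [e]))
      | cons e s =>
        exact ih (fun h => ha (List.mem_cons_of_mem _ h)) (fun h => hb (List.mem_cons_of_mem _ h)) s
          (List.cons.inj h).2
  · obtain ⟨c, m, rfl⟩ := List.exists_cons_of_ne_nil hm
    obtain rfl : c = b := by simpa using h1
    exact absurd (List.mem_cons_self) hb

/-- Rotate the list so that `m` comes first. As neither entry lies in `m`, their succession is not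
the one across the end of the list and takes place in the remaining part. -/
theorem CycNext.mono_append {D : Type*} {s m t : List D} {a b : D}
    (h : CycNext (s ++ m ++ t) a b) (ha : a ∉ m) (hb : b ∉ m) (hm : m ≠ []) :
    CycNext (s ++ t) a b := by
  rw [List.append_assoc] at h
  have h1 := h.append_comm
  rw [List.append_assoc] at h1
  obtain ⟨x, y, hxy⟩ := h1.of_append ha hb hm
  exact CycNext.append_comm (cycNext_iff.2 (Or.inl ⟨x, y, hxy⟩))

theorem TwoComplex.onSector_congr {K : TwoComplex} {f f' : K.F} (h : f = f')
    {k : Fin (K.bd f).length} {k' : Fin (K.bd f').length} (hk : k.1 = k'.1) (z : I × I) :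
    K.onSector f k z = K.onSector f' k' z := by
  subst h
  rw [Fin.ext hk]

/-! ### Label-preserving maps between diagrams -/

namespace VanKampenDiagram

variable {P : SymmetrizedPresentation G A} {w w' w'' : List A}

/-- A cellular map of diagrams that preserves labels and base points. -/
structure Morphism (Δ : VanKampenDiagram P w) (Δ' : VanKampenDiagram P w')
    extends TwoComplex.Hom Δ.toTwoComplex Δ'.toTwoComplex where
  onV_base : onV Δ.base = Δ'.base
  label_onD : ∀ d, Δ'.label (onD d) = Δ.label d

namespace Morphism

variable {Δ : VanKampenDiagram P w} {Δ' : VanKampenDiagram P w'} {Δ'' : VanKampenDiagram P w''}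
  (φ : Morphism Δ Δ')

/-- The identity morphism. -/
def refl (Δ : VanKampenDiagram P w) : Morphism Δ Δ where
  onV := id
  onD := id
  onF := id
  src_onD _ := rfl
  rev_onD _ := rfl
  bd_onF _ := (List.map_id _).symm
  onV_base := rfl
  label_onD _ := rfl

/-- The composition of two morphisms. -/
def comp (ψ : Morphism Δ' Δ'') (φ : Morphism Δ Δ') : Morphism Δ Δ'' where
  onV := ψ.onV ∘ φ.onV
  onD := ψ.onD ∘ φ.onD
  onF := ψ.onF ∘ φ.onF
  src_onD d := (ψ.src_onD _).trans (congrArg ψ.onV (φ.src_onD d))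
  rev_onD d := (ψ.rev_onD _).trans (congrArg ψ.onD (φ.rev_onD d))
  bd_onF f := by
    rw [Function.comp_apply, ψ.bd_onF, φ.bd_onF, List.map_map]
  onV_base := (congrArg ψ.onV φ.onV_base).trans ψ.onV_base
  label_onD d := (ψ.label_onD _).trans (φ.label_onD d)

theorem map_label (l : List Δ.D) : (l.map φ.onD).map Δ'.label = l.map Δ.label := by
  rw [List.map_map]
  exact congrArg (fun g => l.map g) (funext φ.label_onD)

theorem pos_onV (x : Δ.V) : Δ'.pos (φ.onV x) = Δ.pos x := by
  obtain ⟨l, hl⟩ := Δ.connected x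
  rw [Δ'.pos_isPath (φ.toHom.isPath hl), Δ.pos_isPath hl, φ.map_label, φ.onV_base, Δ.pos_base,
    Δ'.pos_base]

/-- The position of a vertex is read off from the labels of a path from the base point, and
morphisms preserve labels and base points. Hence heights, and with them tameness, survive all
gluing. -/
theorem proj_map (q : Δ.Realization) : Δ'.proj (φ.toHom.map q) = Δ.proj q := by
  refine TwoComplex.Realization.ind (p := fun q => Δ'.proj (φ.toHom.map q) = Δ.proj q)
    (fun x => ?_) (fun d x => ?_) (fun f k z => ?_) q
  · exact congrArg P.cayley.vtx (φ.pos_onV x)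
  · change P.cayley.onEdge (Δ'.dart (φ.onD d)) x = P.cayley.onEdge (Δ.dart d) x
    rw [show Δ'.dart (φ.onD d) = Δ.dart d from Prod.ext
      ((congrArg Δ'.pos (φ.src_onD d)).trans (φ.pos_onV _)) (φ.label_onD d)]
  · change Δ'.cell.map (φ.toHom.map _) = Δ.cell.map _
    rw [TwoComplex.Hom.map_onSector, TwoComplex.Hom.map_onSector, TwoComplex.Hom.map_onSector]
    refine TwoComplex.onSector_congr (K := P.cayley) (f := Δ'.cell.onF (φ.onF f))
      (f' := Δ.cell.onF f) (Prod.ext ?_ (Subtype.ext ?_)) rfl z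
    · change Δ'.pos (Δ'.src ((Δ'.bd (φ.onF f)).head _)) = Δ.pos (Δ.src ((Δ.bd f).head _))
      have : (Δ'.bd (φ.onF f)).head (Δ'.bd_ne_nil _) =
          φ.onD ((Δ.bd f).head (Δ.bd_ne_nil _)) := by
        simp only [φ.bd_onF, List.head_map]
      rw [this, φ.src_onD, φ.pos_onV]
    · change (Δ'.bd (φ.onF f)).map Δ'.label = (Δ.bd f).map Δ.label
      rw [φ.bd_onF, φ.map_label]

theorem map_basePt : φ.toHom.map Δ.basePt = Δ'.basePt := congrArg Δ'.vtx φ.onV_base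

end Morphism

/-! ### Folding two consecutive boundary edges with inverse labels -/

section Fold

variable (Δ : VanKampenDiagram P w) {s t : List Δ.D} {d d' : Δ.D}

theorem card_ne_ne {D : Type*} [Finite D] {a b : D} (h : a ≠ b) :
    Nat.card {x : D // x ≠ a ∧ x ≠ b} + 2 = Nat.card D := by
  have h1 := Set.ncard_add_ncard_compl ({a, b} : Set D)
  rw [Set.ncard_pair h] at h1
  rw [← h1, add_comm, ← Nat.card_coe_set_eq]
  congr 1
  exact Nat.card_congr (Equiv.subtypeEquivRight (by simp))

theorem card_ne {D : Type*} [Finite D] (a : D) :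
    Nat.card {x : D // x ≠ a} + 1 = Nat.card D := by
  have h1 := Set.ncard_add_ncard_compl ({a} : Set D)
  rw [Set.ncard_singleton] at h1
  rw [← h1, add_comm, ← Nat.card_coe_set_eq]
  rfl

open Classical in
/-- The map of vertices for folding `d` and `rev d'`. -/
noncomputable def foldV (d d' : Δ.D) (h : Δ.src d ≠ Δ.tgt d') (x : Δ.V) :
    {x // x ≠ Δ.tgt d'} :=
  if hx : x = Δ.tgt d' then ⟨Δ.src d, h⟩ else ⟨x, hx⟩

open Classical in
/-- The map of directed edges for folding `d` and `rev d'`. -/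
noncomputable def foldD (d d' : Δ.D) (h1 : d ≠ d') (h2 : d ≠ Δ.rev d') (x : Δ.D) :
    {x // x ≠ d' ∧ x ≠ Δ.rev d'} :=
  if hx : x = d' then ⟨Δ.rev d, fun h => h2 (h ▸ (Δ.rev_rev d).symm), fun h => h1 (by
    rw [← Δ.rev_rev d, h, Δ.rev_rev])⟩
  else if hx' : x = Δ.rev d' then ⟨d, h1, h2⟩ else ⟨x, hx, hx'⟩

theorem foldV_of_ne {h : Δ.src d ≠ Δ.tgt d'} {x : Δ.V} (hx : x ≠ Δ.tgt d') :
    Δ.foldV d d' h x = ⟨x, hx⟩ := dif_neg hx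

theorem foldV_tgt {h : Δ.src d ≠ Δ.tgt d'} : Δ.foldV d d' h (Δ.tgt d') = ⟨Δ.src d, h⟩ :=
  dif_pos rfl

theorem foldV_eq {h : Δ.src d ≠ Δ.tgt d'} {x y : Δ.V} (e : Δ.foldV d d' h x = Δ.foldV d d' h y) :
    x = y ∨ (x = Δ.tgt d' ∧ y = Δ.src d) ∨ (x = Δ.src d ∧ y = Δ.tgt d') := by
  by_cases hx : x = Δ.tgt d' <;> by_cases hy : y = Δ.tgt d'
  · exact Or.inl (hx.trans hy.symm)
  · rw [hx, foldV_tgt, Δ.foldV_of_ne hy] at e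
    exact Or.inr (Or.inl ⟨hx, (congrArg Subtype.val e).symm⟩)
  · rw [hy, foldV_tgt, Δ.foldV_of_ne hx] at e
    exact Or.inr (Or.inr ⟨congrArg Subtype.val e, hy⟩)
  · rw [Δ.foldV_of_ne hx, Δ.foldV_of_ne hy] at e
    exact Or.inl (congrArg Subtype.val e)

theorem foldD_of_ne {h1 : d ≠ d'} {h2 : d ≠ Δ.rev d'} {x : Δ.D} (hx : x ≠ d')
    (hx' : x ≠ Δ.rev d') : Δ.foldD d d' h1 h2 x = ⟨x, hx, hx'⟩ := by
  rw [foldD, dif_neg hx, dif_neg hx']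

theorem val_foldD_self {h1 : d ≠ d'} {h2 : d ≠ Δ.rev d'} :
    (Δ.foldD d d' h1 h2 d').1 = Δ.rev d := by rw [foldD, dif_pos rfl]

theorem val_foldD_rev {h1 : d ≠ d'} {h2 : d ≠ Δ.rev d'} :
    (Δ.foldD d d' h1 h2 (Δ.rev d')).1 = d := by
  rw [foldD, dif_neg (Δ.rev_ne d'), dif_pos rfl]

theorem foldD_cases {h1 : d ≠ d'} {h2 : d ≠ Δ.rev d'} (x : Δ.D) :
    (x = d' ∧ (Δ.foldD d d' h1 h2 x).1 = Δ.rev d) ∨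
    (x = Δ.rev d' ∧ (Δ.foldD d d' h1 h2 x).1 = d) ∨
    (x ≠ d' ∧ x ≠ Δ.rev d' ∧ (Δ.foldD d d' h1 h2 x).1 = x) := by
  by_cases hx : x = d'
  · subst hx
    exact Or.inl ⟨rfl, Δ.val_foldD_self⟩
  · by_cases hx' : x = Δ.rev d'
    · subst hx'
      exact Or.inr (Or.inl ⟨rfl, Δ.val_foldD_rev⟩)
    · exact Or.inr (Or.inr ⟨hx, hx', by rw [Δ.foldD_of_ne hx hx']⟩)

/-- The edges `d` and `rev d'` leave for the same vertex, and identifying them removes one vertex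
and two directed edges, so the Euler count persists. If their initial vertices already agreed, the
fold would close up a sphere, hence `hd`. The boundary word is left existential, which avoids
transports between equal words. -/
theorem exists_fold (hb : Δ.bdry = s ++ d :: d' :: t) (hl : Δ.label d' = P.inv (Δ.label d))
    (hd : Δ.src d ≠ Δ.tgt d') :
    ∃ (w' : List A) (W : VanKampenDiagram P w') (φ : Morphism Δ W),
      W.bdry = (s ++ t).map φ.onD ∧ φ.onD d' = W.rev (φ.onD d) ∧
      ∀ x y, φ.onV x = φ.onV y →
        x = y ∨ (x = Δ.tgt d' ∧ y = Δ.src d) ∨ (x = Δ.src d ∧ y = Δ.tgt d') := by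
  have hfV := Δ.finite_V
  have hfD := Δ.finite_D
  have hfF := Δ.finite_F
  have hp := Δ.bdry_isPath
  rw [hb, TwoComplex.isPath_append] at hp
  obtain ⟨hp1, hp2, hp3, hp4⟩ := hp
  rw [← hp2] at hp1
  have h1 : d ≠ d' := by
    rintro rfl
    exact Δ.src_ne_tgt d hp3
  have h2 : d ≠ Δ.rev d' := by
    rintro rfl
    exact hd rfl
  have hne : Δ.tgt d ≠ Δ.tgt d' := fun h => Δ.src_ne_tgt d' (hp3.trans h)
  have hsrcD : ∀ x, Δ.foldV d d' hd (Δ.src (Δ.foldD d d' h1 h2 x).1) =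
      Δ.foldV d d' hd (Δ.src x) := by
    intro x
    rcases Δ.foldD_cases (h1 := h1) (h2 := h2) x with ⟨rfl, e⟩ | ⟨rfl, e⟩ | ⟨-, -, e⟩
    · rw [e, hp3]
      rfl
    · rw [e, Δ.foldV_of_ne hd]
      exact (Δ.foldV_tgt).symm
    · rw [e]
  have hrevD : ∀ x, Δ.foldD d d' h1 h2 (Δ.rev (Δ.foldD d d' h1 h2 x).1) =
      Δ.foldD d d' h1 h2 (Δ.rev x) := by
    have hdd : Δ.foldD d d' h1 h2 d = ⟨d, h1, h2⟩ := Δ.foldD_of_ne h1 h2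
    intro x
    rcases Δ.foldD_cases (h1 := h1) (h2 := h2) x with ⟨rfl, e⟩ | ⟨rfl, e⟩ | ⟨-, -, e⟩
    · rw [e, Δ.rev_rev, hdd]
      exact Subtype.ext Δ.val_foldD_rev.symm
    · rw [e, Δ.rev_rev]
      refine Subtype.ext ?_
      rw [Δ.val_foldD_self, Δ.foldD_of_ne]
      · rintro rfl
        exact h2 (Δ.rev_rev d).symm
      · intro h
        exact h1 (by rw [← Δ.rev_rev d, h, Δ.rev_rev])
    · rw [e]
  let L : TwoComplex := {
    V := {x // x ≠ Δ.tgt d'}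
    D := {x // x ≠ d' ∧ x ≠ Δ.rev d'}
    F := Δ.F
    src x := Δ.foldV d d' hd (Δ.src x.1)
    rev x := Δ.foldD d d' h1 h2 (Δ.rev x.1)
    rev_rev x := by
      rw [hrevD, Δ.rev_rev, Δ.foldD_of_ne x.2.1 x.2.2]
    rev_ne x h := by
      have e := congrArg Subtype.val h
      rw [Δ.foldD_of_ne (fun h => x.2.2
        ((Δ.rev_rev x.1).symm.trans (congrArg Δ.rev h))) (fun h => x.2.1
        ((Function.LeftInverse.injective Δ.rev_rev) h))] at e
      exact Δ.rev_ne _ e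
    bd f := (Δ.bd f).map (Δ.foldD d d' h1 h2)
    bd_ne_nil f := by simpa using Δ.bd_ne_nil f
    bd_closed f := closed_map
      (src' := fun x : {x // x ≠ d' ∧ x ≠ Δ.rev d'} => Δ.foldV d d' hd (Δ.src x.1))
      (rev' := fun x : {x // x ≠ d' ∧ x ≠ Δ.rev d'} => Δ.foldD d d' h1 h2 (Δ.rev x.1))
      (Δ.foldV d d' hd) (Δ.foldD d d' h1 h2) hsrcD hrevD (Δ.bd_closed f) }
  let φ : TwoComplex.Hom Δ.toTwoComplex L := {
    onV := Δ.foldV d d' hd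
    onD := Δ.foldD d d' h1 h2
    onF := id
    src_onD := hsrcD
    rev_onD := hrevD
    bd_onF _ := rfl }
  have hlab : ∀ x, Δ.label (Δ.foldD d d' h1 h2 x).1 = Δ.label x := by
    intro x
    rcases Δ.foldD_cases (h1 := h1) (h2 := h2) x with ⟨rfl, e⟩ | ⟨rfl, e⟩ | ⟨-, -, e⟩
    · rw [e, Δ.label_rev, hl]
    · rw [e, Δ.label_rev, hl, P.inv_inv]
    · rw [e]
  have hpos : ∀ x, Δ.pos (Δ.foldV d d' hd x).1 = Δ.pos x := by
    intro x
    by_cases hx : x = Δ.tgt d'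
    · rw [hx, foldV_tgt]
      have e1 : Δ.pos (Δ.tgt d) = Δ.pos (Δ.src d) * P.val (Δ.label d) := Δ.pos_tgt d
      have e2 : Δ.pos (Δ.tgt d') = Δ.pos (Δ.src d') * P.val (Δ.label d') := Δ.pos_tgt d'
      rw [e2, hl, P.val_inv, hp3, e1]
      group
    · rw [Δ.foldV_of_ne hx]
  -- Successions that do not involve `d` or `d'` survive their deletion. A succession into `d'` can
  -- only come from `d`, by injectivity of the rotation.
  have hwrap : ∀ {x y : Δ.D}, CycNext Δ.bdry x y → x ≠ d → x ≠ d' → y ≠ d →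
      CycNext ((s ++ t).map φ.onD) (φ.onD x) (φ.onD y) := by
    intro x y hxy hx hx' hy
    by_cases hy' : y = d'
    · exfalso
      have hc1 : Δ.next (Δ.rev x) = d' := Δ.corner_iff_next.1 (Or.inr (by
        rw [Δ.rev_rev, ← hy']; exact hxy))
      have hc2 : Δ.next (Δ.rev d) = d' := Δ.corner_iff_next.1 (Or.inr (by
        rw [Δ.rev_rev, hb]; exact cycNext_iff.2 (Or.inl ⟨s, t, rfl⟩)))
      have := Δ.next_injective (hc1.trans hc2.symm)
      exact hx (by rw [← Δ.rev_rev x, this, Δ.rev_rev])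
    · refine CycNext.map ?_ _
      refine CycNext.mono_append (m := [d, d']) ?_ (by simp [hx, hx']) (by simp [hy, hy']) (by simp)
      rw [hb] at hxy
      simpa using hxy
  -- The corners lost by deleting `d d'` from the boundary path: those from `d` to `d'`, after `d'`
  -- and before `d`. They sit at the three vertices `tgt d`, `tgt d'` and `src d`, which are
  -- distinct, so each vertex loses only one.
  let X : Set Δ.D := {x | x = Δ.rev d ∨ x = Δ.rev d' ∨ Δ.next x = d}
  have hX : ∀ x ∈ X, ∀ y ∈ X, Δ.src x = Δ.src y → x = y := by
    have e1 : ∀ x, Δ.next x = d → Δ.src x = Δ.src d := by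
      rintro x rfl
      exact (Δ.src_next x).symm
    rintro x (rfl | rfl | hx) y (rfl | rfl | hy) h
    · rfl
    · exact absurd h hne
    · exact absurd (h.trans (e1 y hy)).symm (Δ.src_ne_tgt d)
    · exact absurd h.symm hne
    · rfl
    · exact absurd (h.trans (e1 y hy)).symm hd
    · exact absurd ((e1 x hx).symm.trans h) (Δ.src_ne_tgt d)
    · exact absurd ((e1 x hx).symm.trans h) hd
    · exact Δ.next_injective (hx.trans hy.symm)
  have hlink : ∀ {x y : Δ.D}, Δ.src x = Δ.src y → Relation.EqvGen
      (Corner L.rev (fun f => (Δ.cw f).map φ.onD) ((s ++ t).map φ.onD)) (φ.onD x) (φ.onD y) := by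
    intro x y hxy
    refine eqvGen_map φ.onD ?_ (Δ.link_avoiding hX hxy)
    rintro x y ⟨hxy, hxX⟩
    simp only [X, Set.mem_ofPred_eq, not_or] at hxX
    refine Relation.EqvGen.rel _ _ ?_
    rw [corner_iff] at hxy ⊢
    rw [φ.rev_onD]
    rcases hxy with ⟨f, h⟩ | h
    · exact Or.inl ⟨f, h.map _⟩
    · refine Or.inr (hwrap h ?_ ?_ ?_)
      · rintro rfl
        exact hxX.1 (Δ.rev_rev x).symm
      · rintro rfl
        exact hxX.2.1 (Δ.rev_rev x).symm
      · rintro rfl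
        exact hxX.2.2 (Δ.corner_iff_next.1 (Or.inr h))
  have hφd : φ.onD (Δ.rev d') = φ.onD d := by
    refine Subtype.ext ((Δ.val_foldD_rev (h1 := h1) (h2 := h2)).trans ?_)
    change d = (Δ.foldD d d' h1 h2 d).1
    rw [Δ.foldD_of_ne h1 h2]
  let W : VanKampenDiagram P ((s ++ t).map Δ.label) := {
    toTwoComplex := L
    finite_V := inferInstanceAs (Finite {x // x ≠ Δ.tgt d'})
    finite_D := inferInstanceAs (Finite {x // x ≠ d' ∧ x ≠ Δ.rev d'})
    finite_F := Δ.finite_F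
    base := φ.onV Δ.base
    label x := Δ.label x.1
    label_rev x := (hlab _).trans (Δ.label_rev x.1)
    label_face f := by
      change ((Δ.bd f).map φ.onD).map _ ∈ _
      rw [List.map_map]
      have := Δ.label_face f
      rwa [← show (fun x => Δ.label x.1) ∘ φ.onD = Δ.label from funext hlab] at this
    pos x := Δ.pos x.1
    pos_base := (hpos _).trans Δ.pos_base
    pos_tgt x := by
      change Δ.pos (Δ.foldV d d' hd (Δ.src (Δ.foldD d d' h1 h2 (Δ.rev x.1)).1)).1 =
        Δ.pos (Δ.foldV d d' hd (Δ.src x.1)).1 * _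
      rw [hsrcD, hpos, hpos, Δ.pos_tgt]
    cw f := (Δ.cw f).map φ.onD
    cw_spec f := by
      rcases Δ.cw_spec f with h | h
      · exact Or.inl (congrArg (List.map φ.onD) h)
      · refine Or.inr ?_
        rw [h]
        exact (φ.revPath_map (Δ.bd f)).symm
    bdry := (s ++ t).map φ.onD
    bdry_isPath := by
      rw [List.map_append]
      refine (φ.isPath hp1).append ?_
      have e : φ.onV (Δ.src d) = φ.onV (Δ.tgt d') :=
        (Δ.foldV_of_ne hd).trans (Δ.foldV_tgt).symm
      rw [e]
      exact φ.isPath hp4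
    bdry_label := by
      rw [List.map_map]
      exact congrArg (fun g => (s ++ t).map g) (funext hlab)
    connected := by
      intro x
      obtain ⟨l, hl⟩ := Δ.connected x.1
      refine ⟨l.map φ.onD, ?_⟩
      have := φ.isPath hl
      rwa [show φ.onV x.1 = x from Δ.foldV_of_ne x.2] at this
    sides := by
      have key : ∀ y, y ≠ d → y ≠ d' → (∃ f, φ.onD y ∈ (Δ.cw f).map φ.onD) ∨
          φ.onD y ∈ (s ++ t).map φ.onD := by
        intro y hy hy'
        rcases Δ.mem_side y with ⟨f, h⟩ | h
        · exact Or.inl ⟨f, List.mem_map_of_mem h⟩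
        · refine Or.inr (List.mem_map_of_mem ?_)
          rw [hb] at h
          simpa [hy, hy'] using h
      refine sides_of_card (fun x => ?_) ?_
      -- The side `d` was deleted from the boundary; in the folded diagram this directed edge is
      -- represented by the side `rev d'` instead.
      · by_cases hx : x.1 = d
        · have := key (Δ.rev d') h2.symm (Δ.rev_ne d')
          rwa [hφd, show φ.onD d = x from
            (Δ.foldD_of_ne (h1 := h1) (h2 := h2) h1 h2).trans (Subtype.ext hx.symm)] at this
        · have := key x.1 hx x.2.1
          rwa [show φ.onD x.1 = x from
            Δ.foldD_of_ne (h1 := h1) (h2 := h2) x.2.1 x.2.2] at this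
      · have e1 := Δ.card_sides
        have e2 : Nat.card {x // x ≠ d' ∧ x ≠ Δ.rev d'} + 2 = Nat.card Δ.D :=
          card_ne_ne (Δ.rev_ne d').symm
        rw [Nat.card_sum, Nat.card_eq_fintype_card (α := Fin _), Fintype.card_fin, hb] at e1
        rw [Nat.card_sum, Nat.card_eq_fintype_card (α := Fin _), Fintype.card_fin]
        rw [Nat.card_congr (Equiv.sigmaCongrRight (fun f : Δ.F => finCongr
          (List.length_map (as := Δ.cw f) φ.onD)))]
        change _ = Nat.card {x // x ≠ d' ∧ x ≠ Δ.rev d'}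
        simp only [List.length_append, List.length_cons, List.length_map] at e1 ⊢
        omega
    link := by
      intro x y hxy
      have hx : φ.onD x.1 = x := Δ.foldD_of_ne (h1 := h1) (h2 := h2) x.2.1 x.2.2
      have hy : φ.onD y.1 = y := Δ.foldD_of_ne (h1 := h1) (h2 := h2) y.2.1 y.2.2
      rw [← hx, ← hy]
      have e : ∀ {x : Δ.D}, Δ.src x = Δ.tgt d' → Δ.src x = Δ.src (Δ.rev d') := fun h => h
      -- The directed edges at the two merged vertices are linked to each other because `rev d'` and
      -- `d` have the same image.
      rcases Δ.foldV_eq hxy with h | ⟨h3, h4⟩ | ⟨h3, h4⟩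
      · exact hlink h
      · refine (hlink (e h3)).trans _ _ _ ?_
        rw [hφd]
        exact hlink h4.symm
      · refine (hlink h3).trans _ _ _ ?_
        rw [← hφd]
        exact hlink (e h4).symm
    euler := by
      have e1 := Δ.euler
      have e2 : Nat.card {x // x ≠ d' ∧ x ≠ Δ.rev d'} + 2 = Nat.card Δ.D :=
        card_ne_ne (Δ.rev_ne d').symm
      have e3 := card_ne (Δ.tgt d')
      change 2 * Nat.card {x // x ≠ Δ.tgt d'} + 2 * Nat.card Δ.F =
        Nat.card {x // x ≠ d' ∧ x ≠ Δ.rev d'} + 2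
      omega }
  refine ⟨_, W, ⟨φ, rfl, hlab⟩, rfl, ?_, fun x y => Δ.foldV_eq⟩
  change φ.onD d' = L.rev (φ.onD d)
  rw [← hφd, φ.rev_onD, Δ.rev_rev]

end Fold

end VanKampenDiagram

end TameFilling

namespace TameFilling

universe u v
variable {G : Type u} {A : Type v} [Group G]

namespace VanKampenDiagram

variable {P : SymmetrizedPresentation G A} {w w' : List A}

/-! ### Wedges of diagrams -/

section Wedge

open Classical in
/-- The vertices of the second diagram in a wedge. -/
noncomputable def wedgeV (Δ : VanKampenDiagram P w) (Δ' : VanKampenDiagram P w') (x : Δ'.V) :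
    Δ.V ⊕ {x // x ≠ Δ'.base} :=
  if hx : x = Δ'.base then Sum.inl Δ.base else Sum.inr ⟨x, hx⟩

theorem wedgeV_base (Δ : VanKampenDiagram P w) (Δ' : VanKampenDiagram P w') :
    wedgeV Δ Δ' Δ'.base = Sum.inl Δ.base := dif_pos rfl

theorem wedgeV_of_ne (Δ : VanKampenDiagram P w) (Δ' : VanKampenDiagram P w') {x : Δ'.V}
    (hx : x ≠ Δ'.base) : wedgeV Δ Δ' x = Sum.inr ⟨x, hx⟩ := dif_neg hx

theorem wedgeV_injective (Δ : VanKampenDiagram P w) (Δ' : VanKampenDiagram P w') :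
    Function.Injective (wedgeV Δ Δ') := by
  intro x y h
  by_cases hx : x = Δ'.base <;> by_cases hy : y = Δ'.base
  · exact hx.trans hy.symm
  · rw [hx, wedgeV_base, wedgeV_of_ne Δ Δ' hy] at h
    exact absurd h (by simp)
  · rw [hy, wedgeV_base, wedgeV_of_ne Δ Δ' hx] at h
    exact absurd h (by simp)
  · rw [wedgeV_of_ne Δ Δ' hx, wedgeV_of_ne Δ Δ' hy] at h
    exact congrArg Subtype.val (Sum.inr_injective h)

theorem eq_base_of_wedgeV (Δ : VanKampenDiagram P w) (Δ' : VanKampenDiagram P w') {x : Δ.V}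
    {y : Δ'.V} (h : Sum.inl x = wedgeV Δ Δ' y) : x = Δ.base ∧ y = Δ'.base := by
  by_cases hy : y = Δ'.base
  · rw [hy, wedgeV_base] at h
    exact ⟨Sum.inl_injective h, hy⟩
  · rw [wedgeV_of_ne Δ Δ' hy] at h
    exact absurd h (by simp)

/-- At the common vertex each rotation is cut open at its outer corner, and the two resulting chains
are joined where one boundary path passes into the other. Such a corner exists because neither
boundary path is empty. -/
theorem exists_wedge (Δ : VanKampenDiagram P w) (Δ' : VanKampenDiagram P w')
    (h : Δ.bdry ≠ []) (h' : Δ'.bdry ≠ []) :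
    ∃ (W : VanKampenDiagram P (w ++ w')) (φ : Morphism Δ W) (φ' : Morphism Δ' W),
      W.bdry = Δ.bdry.map φ.onD ++ Δ'.bdry.map φ'.onD ∧
      ∀ x y, φ.onV x = φ'.onV y → x = Δ.base ∧ y = Δ'.base := by
  have := Δ.finite_V
  have := Δ.finite_D
  have := Δ.finite_F
  have := Δ'.finite_V
  have := Δ'.finite_D
  have := Δ'.finite_F
  let L : TwoComplex := {
    V := Δ.V ⊕ {x // x ≠ Δ'.base}
    D := Δ.D ⊕ Δ'.D
    F := Δ.F ⊕ Δ'.F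
    src := Sum.elim (fun d => Sum.inl (Δ.src d)) (fun d => wedgeV Δ Δ' (Δ'.src d))
    rev := Sum.map Δ.rev Δ'.rev
    rev_rev := by
      rintro (d | d)
      · exact congrArg Sum.inl (Δ.rev_rev d)
      · exact congrArg Sum.inr (Δ'.rev_rev d)
    rev_ne := by
      rintro (d | d) h
      · exact Δ.rev_ne d (Sum.inl_injective h)
      · exact Δ'.rev_ne d (Sum.inr_injective h)
    bd := Sum.elim (fun f => (Δ.bd f).map Sum.inl) (fun f => (Δ'.bd f).map Sum.inr)
    bd_ne_nil := by
      rintro (f | f)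
      · simpa using Δ.bd_ne_nil f
      · simpa using Δ'.bd_ne_nil f
    bd_closed := by
      rintro (f | f)
      · exact closed_map (src' := Sum.elim (fun d => Sum.inl (Δ.src d))
          (fun d => wedgeV Δ Δ' (Δ'.src d))) (rev' := Sum.map Δ.rev Δ'.rev)
          Sum.inl Sum.inl (fun _ => rfl) (fun _ => rfl) (Δ.bd_closed f)
      · exact closed_map (src' := Sum.elim (fun d => Sum.inl (Δ.src d))
          (fun d => wedgeV Δ Δ' (Δ'.src d))) (rev' := Sum.map Δ.rev Δ'.rev)
          (wedgeV Δ Δ') Sum.inr (fun _ => rfl) (fun _ => rfl) (Δ'.bd_closed f) }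
  let φ : TwoComplex.Hom Δ.toTwoComplex L := {
    onV := Sum.inl
    onD := Sum.inl
    onF := Sum.inl
    src_onD _ := rfl
    rev_onD _ := rfl
    bd_onF _ := rfl }
  let φ' : TwoComplex.Hom Δ'.toTwoComplex L := {
    onV := wedgeV Δ Δ'
    onD := Sum.inr
    onF := Sum.inr
    src_onD _ := rfl
    rev_onD _ := rfl
    bd_onF _ := rfl }
  let cw : Δ.F ⊕ Δ'.F → List (Δ.D ⊕ Δ'.D) :=
    Sum.elim (fun f => (Δ.cw f).map Sum.inl) (fun f => (Δ'.cw f).map Sum.inr)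
  let b : List (Δ.D ⊕ Δ'.D) := Δ.bdry.map Sum.inl ++ Δ'.bdry.map Sum.inr
  obtain ⟨s, e, hse⟩ := (List.eq_nil_or_concat Δ.bdry).resolve_left h
  obtain ⟨s', e', hse'⟩ := (List.eq_nil_or_concat Δ'.bdry).resolve_left h'
  obtain ⟨c, t, hct⟩ := List.exists_cons_of_ne_nil h'
  rw [List.concat_eq_append] at hse hse'
  -- Only the succession from the last to the first boundary edge is broken by concatenation, so one
  -- corner in each diagram has to be avoided.
  have hlast : ∀ {D : Type} {l m : List D} {e x y : D}, l = m ++ [e] → CycNext l x y → x ≠ e →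
      ∃ p q, l = p ++ x :: y :: q := by
    intro D l m e x y hl hxy hx
    rcases cycNext_iff.1 hxy with h1 | ⟨-, h2⟩
    · exact h1
    · rw [hl, List.getLast?_concat] at h2
      exact absurd (Option.some.inj h2).symm hx
  have hlink1 : ∀ {x y : Δ.D}, Δ.src x = Δ.src y →
      Relation.EqvGen (Corner L.rev cw b) (Sum.inl x) (Sum.inl y) := by
    intro x y hxy
    refine eqvGen_map Sum.inl ?_ (Δ.link_avoiding (X := {Δ.rev e}) ?_ hxy)
    · rintro x y ⟨hxy, hx⟩
      refine Relation.EqvGen.rel _ _ ?_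
      rw [corner_iff] at hxy ⊢
      rcases hxy with ⟨f, h1⟩ | h1
      · exact Or.inl ⟨Sum.inl f, h1.map _⟩
      · obtain ⟨p, q, hpq⟩ := hlast hse h1 (fun h2 => hx (by
          rw [Set.mem_singleton_iff, ← h2, Δ.rev_rev]))
        refine Or.inr (cycNext_iff.2 (Or.inl ⟨p.map Sum.inl, q.map Sum.inl ++
          Δ'.bdry.map Sum.inr, ?_⟩))
        simp only [b, hpq, List.map_append, List.map_cons, List.append_assoc, List.cons_append]
        rfl
    · rintro _ rfl _ rfl _
      rfl
  have hlink2 : ∀ {x y : Δ'.D}, Δ'.src x = Δ'.src y →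
      Relation.EqvGen (Corner L.rev cw b) (Sum.inr x) (Sum.inr y) := by
    intro x y hxy
    refine eqvGen_map Sum.inr ?_ (Δ'.link_avoiding (X := {Δ'.rev e'}) ?_ hxy)
    · rintro x y ⟨hxy, hx⟩
      refine Relation.EqvGen.rel _ _ ?_
      rw [corner_iff] at hxy ⊢
      rcases hxy with ⟨f, h1⟩ | h1
      · exact Or.inl ⟨Sum.inr f, h1.map _⟩
      · obtain ⟨p, q, hpq⟩ := hlast hse' h1 (fun h2 => hx (by
          rw [Set.mem_singleton_iff, ← h2, Δ'.rev_rev]))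
        refine Or.inr (cycNext_iff.2 (Or.inl ⟨Δ.bdry.map Sum.inl ++ p.map Sum.inr,
          q.map Sum.inr, ?_⟩))
        simp only [b, hpq, List.map_append, List.map_cons, List.append_assoc]
        rfl
    · rintro _ rfl _ rfl _
      rfl
  have he : Δ.src (Δ.rev e) = Δ.base := by
    have h1 := Δ.bdry_isPath
    rw [hse, TwoComplex.isPath_append] at h1
    exact h1.2.2
  have hc : Δ'.src c = Δ'.base := by
    have h1 := Δ'.bdry_isPath
    rw [hct] at h1
    exact h1.1
  -- The new corner between the last edge of the first boundary path and the first edge of the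
  -- second.
  have hec : Corner L.rev cw b (Sum.inl (Δ.rev e)) (Sum.inr c) := by
    rw [corner_iff]
    refine Or.inr (cycNext_iff.2 (Or.inl ⟨s.map Sum.inl, t.map Sum.inr, ?_⟩))
    have : L.rev (Sum.inl (Δ.rev e)) = Sum.inl e := congrArg Sum.inl (Δ.rev_rev e)
    rw [this]
    simp [b, hse, hct]
  have hlink12 : ∀ {x : Δ.D} {y : Δ'.D}, Δ.src x = Δ.base → Δ'.src y = Δ'.base →
      Relation.EqvGen (Corner L.rev cw b) (Sum.inl x) (Sum.inr y) := fun hx hy =>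
    ((hlink1 (hx.trans he.symm)).trans _ _ _ (Relation.EqvGen.rel _ _ hec)).trans _ _ _
      (hlink2 (hc.trans hy.symm))
  have hpos : ∀ x, Sum.elim Δ.pos (fun x => Δ'.pos x.1) (wedgeV Δ Δ' x) = Δ'.pos x := by
    intro x
    by_cases hx : x = Δ'.base
    · rw [hx, wedgeV_base]
      exact Δ.pos_base.trans Δ'.pos_base.symm
    · rw [wedgeV_of_ne Δ Δ' hx]
      rfl
  have hcard : Nat.card {x // x ≠ Δ'.base} + 1 = Nat.card Δ'.V := card_ne _
  let W : VanKampenDiagram P (w ++ w') := {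
    toTwoComplex := L
    finite_V := inferInstanceAs (Finite (Δ.V ⊕ {x // x ≠ Δ'.base}))
    finite_D := inferInstanceAs (Finite (Δ.D ⊕ Δ'.D))
    finite_F := inferInstanceAs (Finite (Δ.F ⊕ Δ'.F))
    base := Sum.inl Δ.base
    label := Sum.elim Δ.label Δ'.label
    label_rev := by
      rintro (d | d)
      · exact Δ.label_rev d
      · exact Δ'.label_rev d
    label_face := by
      rintro (f | f)
      · change ((Δ.bd f).map Sum.inl).map _ ∈ _
        rw [List.map_map]
        exact Δ.label_face f
      · change ((Δ'.bd f).map Sum.inr).map _ ∈ _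
        rw [List.map_map]
        exact Δ'.label_face f
    pos := Sum.elim Δ.pos (fun x => Δ'.pos x.1)
    pos_base := Δ.pos_base
    pos_tgt := by
      rintro (d | d)
      · exact Δ.pos_tgt d
      · change Sum.elim Δ.pos (fun x => Δ'.pos x.1) (wedgeV Δ Δ' (Δ'.src (Δ'.rev d))) =
          Sum.elim Δ.pos (fun x => Δ'.pos x.1) (wedgeV Δ Δ' (Δ'.src d)) * _
        rw [hpos, hpos]
        exact Δ'.pos_tgt d
    cw := cw
    cw_spec := by
      rintro (f | f)
      · rcases Δ.cw_spec f with h1 | h1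
        · exact Or.inl (congrArg (List.map Sum.inl) h1)
        · exact Or.inr ((congrArg (List.map Sum.inl) h1).trans (φ.revPath_map (Δ.bd f)).symm)
      · rcases Δ'.cw_spec f with h1 | h1
        · exact Or.inl (congrArg (List.map Sum.inr) h1)
        · exact Or.inr ((congrArg (List.map Sum.inr) h1).trans (φ'.revPath_map (Δ'.bd f)).symm)
    bdry := b
    bdry_isPath := by
      refine (φ.isPath Δ.bdry_isPath).append ?_
      have := φ'.isPath Δ'.bdry_isPath
      rwa [show φ'.onV Δ'.base = Sum.inl Δ.base from wedgeV_base Δ Δ'] at this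
    bdry_label := by
      rw [List.map_append, List.map_map, List.map_map]
      exact congrArg₂ _ Δ.bdry_label Δ'.bdry_label
    connected := by
      rintro (x | x)
      · obtain ⟨l, hl⟩ := Δ.connected x
        exact ⟨_, φ.isPath hl⟩
      · obtain ⟨l, hl⟩ := Δ'.connected x.1
        have := φ'.isPath hl
        rw [show φ'.onV Δ'.base = Sum.inl Δ.base from wedgeV_base Δ Δ',
          show φ'.onV x.1 = Sum.inr x from wedgeV_of_ne Δ Δ' x.2] at this
        exact ⟨_, this⟩
    sides := by
      have : Finite L.F := inferInstanceAs (Finite (Δ.F ⊕ Δ'.F))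
      refine sides_of_card ?_ ?_
      · rintro (d | d)
        · rcases Δ.mem_side d with ⟨f, h1⟩ | h1
          · exact Or.inl ⟨Sum.inl f, List.mem_map_of_mem h1⟩
          · exact Or.inr (List.mem_append_left _ (List.mem_map_of_mem h1))
        · rcases Δ'.mem_side d with ⟨f, h1⟩ | h1
          · exact Or.inl ⟨Sum.inr f, List.mem_map_of_mem h1⟩
          · exact Or.inr (List.mem_append_right _ (List.mem_map_of_mem h1))
      · have e1 := Δ.card_sides
        have e2 := Δ'.card_sides
        have e3 : Nat.card (Σ f : Δ.F ⊕ Δ'.F, Fin (cw f).length) =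
            Nat.card (Σ f : Δ.F, Fin (Δ.cw f).length) +
              Nat.card (Σ f : Δ'.F, Fin (Δ'.cw f).length) := by
          rw [← Nat.card_sum]
          refine Nat.card_congr ((Equiv.sumSigmaDistrib _).trans (Equiv.sumCongr
            (Equiv.sigmaCongrRight fun f => finCongr ?_)
            (Equiv.sigmaCongrRight fun f => finCongr ?_)))
          · exact List.length_map _
          · exact List.length_map _
        rw [Nat.card_sum, Nat.card_eq_fintype_card (α := Fin _), Fintype.card_fin] at e1 e2
        rw [Nat.card_sum, Nat.card_eq_fintype_card (α := Fin _), Fintype.card_fin]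
        change Nat.card (Σ f : Δ.F ⊕ Δ'.F, Fin (cw f).length) + _ = Nat.card (Δ.D ⊕ Δ'.D)
        rw [e3, Nat.card_sum]
        simp only [b, List.length_append, List.length_map]
        omega
    link := by
      rintro (x | x) (y | y) hxy
      · exact hlink1 (Sum.inl_injective hxy)
      · obtain ⟨h1, h2⟩ := eq_base_of_wedgeV Δ Δ' hxy
        exact hlink12 h1 h2
      · obtain ⟨h1, h2⟩ := eq_base_of_wedgeV Δ Δ' hxy.symm
        exact (hlink12 h1 h2).symm
      · exact hlink2 (wedgeV_injective Δ Δ' hxy)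
    euler := by
      have e1 := Δ.euler
      have e2 := Δ'.euler
      change 2 * Nat.card (Δ.V ⊕ {x // x ≠ Δ'.base}) + 2 * Nat.card (Δ.F ⊕ Δ'.F) =
        Nat.card (Δ.D ⊕ Δ'.D) + 2
      rw [Nat.card_sum, Nat.card_sum, Nat.card_sum]
      omega }
  exact ⟨W, ⟨φ, rfl, fun _ => rfl⟩, ⟨φ', wedgeV_base Δ Δ', fun _ => rfl⟩, rfl,
    fun x y => eq_base_of_wedgeV Δ Δ'⟩

end Wedge

/-! ### Gluing two diagrams along a path -/

/-- Folding a boundary subpath `p⁻¹ q`, where `p` and `q` start at the same vertex and have the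
same label. -/
theorem exists_foldPath {w : List A} (W : VanKampenDiagram P w) {x y z : W.V}
    {b p q c : List W.D} (hb : W.bdry = b ++ W.revPath p ++ (q ++ c)) (hp : W.IsPath x p y)
    (hq : W.IsPath x q z) (hl : p.map W.label = q.map W.label) (hs : ∀ j ≤ p.length,
      ∀ k ≤ p.length, P.eval ((p.map W.label).take j) = P.eval ((p.map W.label).take k) → j = k)
    (hne : ∀ k, 0 < k → k ≤ p.length → W.pathEnd x (p.take k) ≠ W.pathEnd x (q.take k)) :
    ∃ (w' : List A) (W' : VanKampenDiagram P w') (φ : Morphism W W'),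
      W'.bdry = b.map φ.onD ++ c.map φ.onD ∧ p.map φ.onD = q.map φ.onD := by
  obtain ⟨n, hn⟩ : ∃ n, p.length = n := ⟨_, rfl⟩
  induction n generalizing w with
  | zero =>
    obtain rfl := List.eq_nil_of_length_eq_zero hn
    obtain rfl : q = [] := by simpa using hl.symm
    refine ⟨w, W, Morphism.refl W, ?_, rfl⟩
    rw [hb]
    simp [Morphism.refl, TwoComplex.revPath]
  | succ n ih =>
    obtain ⟨d, p, rfl⟩ := List.exists_cons_of_length_eq_add_one hn
    cases q with
    | nil => simp at hl
    | cons d' q =>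
      obtain ⟨hl1, hl2⟩ := List.cons.inj hl
      obtain ⟨rfl, hp2⟩ := hp
      obtain ⟨hq1, hq2⟩ := hq
      have h1 := hne 1 one_pos (by simp)
      obtain ⟨w', W', φ, e1, e2, e3⟩ := W.exists_fold (s := b ++ W.revPath p) (t := q ++ c)
        (d := W.rev d) (d' := d') (by rw [hb, TwoComplex.revPath_cons]; simp)
        (by rw [W.label_rev, P.inv_inv, ← hl1]) h1
      have hlab : ∀ l : List W.D, (l.map φ.onD).map W'.label = l.map W.label := φ.map_label
      rw [TwoComplex.Hom.rev_onD, W.rev_rev] at e2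
      have htgt : φ.onV (W.tgt d) = φ.onV (W.tgt d') := by
        rw [← φ.toHom.tgt_onD, ← φ.toHom.tgt_onD, e2]
      have hlen : p.length = q.length := by simpa using congrArg List.length hl2
      have hps : ∀ j ≤ p.length, ∀ k ≤ p.length, P.eval ((p.map W.label).take j) =
          P.eval ((p.map W.label).take k) → j = k := by
        intro j hj k hk e
        have := hs (j + 1) (by simpa using hj) (k + 1) (by simpa using hk) (by
          rw [List.map_cons, List.take_succ_cons, List.take_succ_cons, P.eval_cons, P.eval_cons,
            e])
        omega
      have hpos : ∀ {l : List W.D} {u v : W.V} (k : ℕ), W.IsPath u l v →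
          W.pos (W.pathEnd u (l.take k)) = W.pos u * P.eval ((l.map W.label).take k) := by
        intro l u v k h
        rw [← List.take_append_drop k l, TwoComplex.isPath_append] at h
        rw [W.pos_isPath h.1, List.map_take]
      obtain ⟨w'', W'', ψ, f1, f2⟩ := ih W' (x := φ.onV (W.tgt d)) (y := φ.onV y)
        (z := φ.onV z) (b := b.map φ.onD) (p := p.map φ.onD) (q := q.map φ.onD)
        (c := c.map φ.onD)
        (by rw [e1, φ.toHom.revPath_map]; simp) (φ.toHom.isPath hp2)
        (by rw [htgt]; exact φ.toHom.isPath hq2)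
        (by rw [hlab, hlab]; exact hl2) (by rw [hlab, List.length_map]; exact hps)
        (by
          intro k hk0 hk e
          rw [List.length_map] at hk
          rw [← List.map_take, ← List.map_take, φ.toHom.pathEnd_map, htgt,
            φ.toHom.pathEnd_map] at e
          have hk' := hpos k hp2
          -- The fold only identifies the end points of the first two edges. A later vertex of `p`
          -- cannot be one of them, as it has a different position by simplicity, so later end
          -- points remain distinct.
          have hlast : W.pos (W.pathEnd (W.tgt d) (p.take k)) = W.pos (W.tgt d) → False := by
            intro h
            rw [h] at hk'
            have : P.eval ((p.map W.label).take k) = P.eval ((p.map W.label).take 0) := by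
              simpa [P.eval_nil] using hk'.symm
            have := hps k hk 0 (Nat.zero_le _) this
            omega
          have hposd : W.pos (W.tgt d') = W.pos (W.tgt d) := by
            have e1 : W.pos (W.tgt d) = _ := W.pos_tgt d
            have e2 : W.pos (W.tgt d') = _ := W.pos_tgt d'
            rw [e1, e2, hq1, hl1]
          rcases e3 _ _ e with h | ⟨h, -⟩ | ⟨h, -⟩
          · exact hne (k + 1) (Nat.succ_pos _) (by simpa using hk) h
          · exact hlast (by rw [h, hposd])
          · exact hlast (by rw [h]; rfl))
        (by simpa using hn)
      refine ⟨w'', W'', ψ.comp φ, ?_, ?_⟩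
      · rw [f1, List.map_map, List.map_map]
        rfl
      · have : ψ.onD (φ.onD d) = ψ.onD (φ.onD d') := by rw [e2]
        rw [List.map_cons, List.map_cons]
        refine congrArg₂ _ this ?_
        rw [List.map_map, List.map_map] at f2
        exact f2

end VanKampenDiagram

end TameFilling

namespace TameFilling

universe u v
variable {G : Type u} {A : Type v} [Group G]

/-! ### Gluing diagrams together with their edge homotopies -/

theorem TwoComplex.Follows.map {K L : TwoComplex} (φ : TwoComplex.Hom K L)
    {c : I → K.Realization} {x : K.V} {l : List K.D} (h : K.Follows c x l) :
    L.Follows (fun t => φ.map (c t)) (φ.onV x) (l.map φ.onD) := by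
  obtain ⟨ρ, h1, h2, h3, h4, h5⟩ := h
  refine ⟨ρ, h1, h2, h3, by rw [h4, List.length_map], fun t => ?_⟩
  exact (congrArg φ.map (h5 t)).trans (φ.map_pathPt _ _ _)

namespace VanKampenDiagram

variable {P : SymmetrizedPresentation G A} {w w₁ w₂ : List A}

/-- Diagrams with boundary paths `b p⁻¹` and `q c`, where `p` and `q` have the same simple label,
can be glued to a diagram with boundary path `b c`. -/
theorem exists_glue (Δ₁ : VanKampenDiagram P w₁) (Δ₂ : VanKampenDiagram P w₂) {b p : List Δ₁.D}
    {q c : List Δ₂.D} (h₁ : Δ₁.bdry = b ++ Δ₁.revPath p) (h₂ : Δ₂.bdry = q ++ c)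
    (hl : p.map Δ₁.label = q.map Δ₂.label) (hs : P.IsSimple (p.map Δ₁.label)) (hb : b ≠ [])
    (hc : c ≠ []) :
    ∃ (w : List A) (W : VanKampenDiagram P w) (φ₁ : Morphism Δ₁ W) (φ₂ : Morphism Δ₂ W),
      W.bdry = b.map φ₁.onD ++ c.map φ₂.onD ∧ p.map φ₁.onD = q.map φ₂.onD := by
  obtain ⟨W, φ₁, φ₂, e1, e2⟩ := Δ₁.exists_wedge Δ₂ (by simp [h₁, hb]) (by simp [h₂, hc])
  have hp : Δ₁.IsPath Δ₁.base p (Δ₁.pathEnd Δ₁.base b) := by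
    have := Δ₁.bdry_isPath
    rw [h₁, TwoComplex.isPath_append] at this
    have := this.2.revPath
    rwa [TwoComplex.revPath_revPath] at this
  have hq : Δ₂.IsPath Δ₂.base q (Δ₂.pathEnd Δ₂.base q) := by
    have := Δ₂.bdry_isPath
    rw [h₂, TwoComplex.isPath_append] at this
    exact this.1
  have hp' := φ₁.toHom.isPath hp
  have hq' := φ₂.toHom.isPath hq
  rw [φ₁.onV_base] at hp'
  rw [φ₂.onV_base] at hq'
  obtain ⟨w', W', φ, f1, f2⟩ := W.exists_foldPath (b := b.map φ₁.onD) (p := p.map φ₁.onD)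
    (q := q.map φ₂.onD) (c := c.map φ₂.onD)
    (by rw [e1, h₁, h₂, φ₁.toHom.revPath_map]; simp) hp' hq'
    (by rw [φ₁.map_label, φ₂.map_label, hl])
    (by
      rw [φ₁.map_label, List.length_map]
      have := P.isSimple_iff.1 hs
      rwa [List.length_map] at this)
    (by
      intro k hk0 hk e
      rw [List.length_map] at hk
      rw [← φ₁.onV_base, ← List.map_take, φ₁.toHom.pathEnd_map, φ₁.onV_base, ← φ₂.onV_base,
        ← List.map_take, φ₂.toHom.pathEnd_map] at e
      have := Δ₁.pathEnd_take_inj hp hs hk (Nat.zero_le _) (e2 _ _ e).1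
      omega)
  refine ⟨w', W', φ.comp φ₁, φ.comp φ₂, ?_, ?_⟩
  · rw [f1, List.map_map, List.map_map]
    rfl
  · rw [List.map_map, List.map_map] at f2
    exact f2

/-- A simple path is traversed injectively in the Cayley complex, so equal projections force equal
reparametrizations. Once the two paths are glued, the curves themselves coincide. -/
theorem proj_follows_eq {Δ₁ : VanKampenDiagram P w₁} {Δ₂ : VanKampenDiagram P w₂}
    {W : VanKampenDiagram P w} (φ₁ : Morphism Δ₁ W) (φ₂ : Morphism Δ₂ W) {p : List Δ₁.D}
    {q : List Δ₂.D} {y : Δ₁.V} {z : Δ₂.V} (hp : Δ₁.IsPath Δ₁.base p y)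
    (hq : Δ₂.IsPath Δ₂.base q z) (hl : p.map Δ₁.label = q.map Δ₂.label)
    (hs : P.IsSimple (p.map Δ₁.label)) (h : p.map φ₁.onD = q.map φ₂.onD)
    {c₁ : I → Δ₁.Realization} {c₂ : I → Δ₂.Realization} (h₁ : Δ₁.Follows c₁ Δ₁.base p)
    (h₂ : Δ₂.Follows c₂ Δ₂.base q) (he : ∀ t, Δ₁.proj (c₁ t) = Δ₂.proj (c₂ t)) (t : I) :
    φ₁.toHom.map (c₁ t) = φ₂.toHom.map (c₂ t) := by
  obtain ⟨ρ₁, -, m1, a1, b1, e1⟩ := h₁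
  obtain ⟨ρ₂, -, m2, a2, b2, e2⟩ := h₂
  have e3 := he t
  rw [e1, e2, Δ₁.proj_pathPt hp, Δ₂.proj_pathPt hq, Δ₁.pos_base, Δ₂.pos_base, ← hl] at e3
  have hlen : (p.map Δ₁.label).length = p.length := List.length_map _
  have hlen' : (p.map Δ₁.label).length = q.length := by rw [hl, List.length_map]
  have e4 : ρ₁ t = ρ₂ t := by
    refine hs.pathPt_injOn ⟨?_, ?_⟩ ⟨?_, ?_⟩ e3
    · rw [← a1]
      exact m1 t.2.1
    · rw [hlen, ← b1]
      exact m1 t.2.2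
    · rw [← a2]
      exact m2 t.2.1
    · rw [hlen', ← b2]
      exact m2 t.2.2
  rw [e1, e2, φ₁.toHom.map_pathPt, φ₂.toHom.map_pathPt, φ₁.onV_base, φ₂.onV_base, h, e4]

/-- A sequence of homotopies `S j` that comb the edges of a path `b`, where the ends of `S j` are
the curves `C j` and `C (j + 1)`, and these curves follow edge paths with simple labels. -/
structure IsShell (Δ : VanKampenDiagram P w) (f : QuarterNat → QuarterNat) (b : List Δ.D)
    (C : ℕ → I → Δ.Realization) (S : ℕ → I × I → Δ.Realization) : Prop where
  continuous : ∀ j < b.length, Continuous (S j)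
  zero : ∀ j < b.length, ∀ x, S j (x, 0) = Δ.basePt
  one : ∀ j (hj : j < b.length) x, S j (x, 1) = Δ.onEdge b[j] x
  left : ∀ j < b.length, ∀ t, S j (0, t) = C j t
  right : ∀ j < b.length, ∀ t, S j (1, t) = C (j + 1) t
  tame : ∀ j < b.length, Δ.ExtrinsicallyTame (S j) f
  follows : ∀ j ≤ b.length, ∃ l y, Δ.IsPath Δ.base l y ∧ P.IsSimple (l.map Δ.label) ∧
    Δ.Follows (C j) Δ.base l

theorem IsShell.map {Δ : VanKampenDiagram P w₁} {W : VanKampenDiagram P w} (φ : Morphism Δ W)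
    {f : QuarterNat → QuarterNat} {b : List Δ.D} {C : ℕ → I → Δ.Realization}
    {S : ℕ → I × I → Δ.Realization} (h : Δ.IsShell f b C S) :
    W.IsShell f (b.map φ.onD) (fun j t => φ.toHom.map (C j t))
      (fun j z => φ.toHom.map (S j z)) := by
  refine ⟨?_, ?_, ?_, ?_, ?_, ?_, ?_⟩
  all_goals try rw [List.length_map]
  · exact fun j hj => φ.toHom.continuous_map.comp (h.continuous j hj)
  · exact fun j hj x => (congrArg _ (h.zero j hj x)).trans φ.map_basePt
  · intro j hj x
    rw [List.length_map] at hj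
    simp only [h.one j hj x, List.getElem_map]
    rfl
  · exact fun j hj t => congrArg _ (h.left j hj t)
  · exact fun j hj t => congrArg _ (h.right j hj t)
  · intro j hj x s t hst
    have := h.tame j hj x s t hst
    simpa only [φ.proj_map] using this
  · intro j hj
    obtain ⟨l, y, h1, h2, h3⟩ := h.follows j hj
    refine ⟨l.map φ.onD, φ.onV y, ?_, ?_, ?_⟩
    · rw [← φ.onV_base]
      exact φ.toHom.isPath h1
    · rwa [φ.map_label]
    · rw [← φ.onV_base]
      exact h3.map φ.toHom

/-- The only condition at the seam is that the last curve of the first sequence is the first curve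
of the new homotopy. -/
theorem isShell_append {Δ : VanKampenDiagram P w} {f : QuarterNat → QuarterNat} {b : List Δ.D}
    {d : Δ.D} {C : ℕ → I → Δ.Realization} {S : ℕ → I × I → Δ.Realization}
    (h : Δ.IsShell f b C S) {C' : ℕ → I → Δ.Realization} {S' : ℕ → I × I → Δ.Realization}
    (h' : Δ.IsShell f [d] C' S') (hC : ∀ t, C b.length t = C' 0 t) :
    Δ.IsShell f (b ++ [d]) (fun j => if j ≤ b.length then C j else C' 1)
      (fun j => if j < b.length then S j else S' 0) := by
  have h0 : 0 < [d].length := Nat.one_pos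
  have hlen : (b ++ [d]).length = b.length + 1 := by simp
  have key : ∀ {p : ℕ → Prop}, (∀ j < b.length, p j) → p b.length →
      ∀ j < (b ++ [d]).length, p j := by
    intro p h1 h2 j hj
    rcases (Nat.lt_succ_iff_lt_or_eq).1 (hlen ▸ hj) with h | rfl
    · exact h1 j h
    · exact h2
  refine ⟨key (fun j hj => ?_) ?_, key (fun j hj => ?_) ?_, fun j hj => ?_, key (fun j hj => ?_) ?_,
    key (fun j hj => ?_) ?_, key (fun j hj => ?_) ?_, fun j hj => ?_⟩
  · simpa only [if_pos hj] using h.continuous j hj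
  · simpa only [lt_irrefl, if_false] using h'.continuous 0 h0
  · simpa only [if_pos hj] using h.zero j hj
  · simpa only [lt_irrefl, if_false] using h'.zero 0 h0
  · rcases (Nat.lt_succ_iff_lt_or_eq).1 (hlen ▸ hj) with hj' | rfl
    · simpa only [if_pos hj', List.getElem_append_left hj'] using h.one j hj'
    · simpa only [lt_irrefl, if_false, List.getElem_append_right le_rfl, Nat.sub_self] using
        h'.one 0 h0
  · simpa only [if_pos hj, if_pos hj.le] using h.left j hj
  · simpa only [lt_irrefl, if_false, le_refl, if_true, hC] using h'.left 0 h0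
  · simpa only [if_pos hj, if_pos (Nat.succ_le_of_lt hj)] using h.right j hj
  · simpa only [lt_irrefl, if_false, if_neg (Nat.not_succ_le_self _)] using h'.right 0 h0
  · simpa only [if_pos hj] using h.tame j hj
  · simpa only [lt_irrefl, if_false] using h'.tame 0 h0
  · by_cases h1 : j ≤ b.length
    · simpa only [if_pos h1] using h.follows j h1
    · simpa only [if_neg h1] using h'.follows 1 le_rfl

theorem IsEdgeHomotopy.isShell {Δ : VanKampenDiagram P w} {f : QuarterNat → QuarterNat}
    {θ : I × I → Δ.Realization} (hθ : Continuous θ) (h0 : ∀ x, θ (x, 0) = Δ.basePt)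
    {d : Δ.D} (h1 : ∀ x, θ (x, 1) = Δ.onEdge d x) (ht : Δ.ExtrinsicallyTame θ f)
    {p q : List Δ.D} {y z : Δ.V} (hp : Δ.IsPath Δ.base p y) (hq : Δ.IsPath Δ.base q z)
    (hps : P.IsSimple (p.map Δ.label)) (hqs : P.IsSimple (q.map Δ.label))
    (hl : Δ.Follows (fun t => θ (0, t)) Δ.base p) (hr : Δ.Follows (fun t => θ (1, t)) Δ.base q) :
    Δ.IsShell f [d] (fun j t => if j = 0 then θ (0, t) else θ (1, t)) (fun _ => θ) := by
  refine ⟨fun _ _ => hθ, fun _ _ => h0, ?_, ?_, ?_, fun _ _ => ht, ?_⟩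
  · intro j hj x
    obtain rfl : j = 0 := Nat.lt_one_iff.1 hj
    exact h1 x
  · intro j hj t
    obtain rfl : j = 0 := Nat.lt_one_iff.1 hj
    rfl
  · intro j hj t
    rfl
  · intro j hj
    by_cases hj0 : j = 0
    · simp only [hj0, if_true]
      exact ⟨p, y, hp, hps, hl⟩
    · simp only [hj0, if_false]
      exact ⟨q, z, hq, hqs, hr⟩

/-- Edge homotopies with matching ends assemble to a sequence of homotopies for each nonempty
word `u`, in a diagram with boundary word `u (word g)⁻¹`, where `u` represents `g`. -/
theorem exists_isShell {f : QuarterNat → QuarterNat} {word : G → List A}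
    (hw : ∀ g, P.IsSimple (word g)) (hw1 : word 1 = [])
    {Y : G → I → P.cayley.Realization}
    (h : ∀ (g : G) (a : A), ∃ (w : List A) (Δ : VanKampenDiagram P w) (θ : I × I → Δ.Realization)
      (p : List Δ.D) (d : Δ.D) (q : List Δ.D), Δ.bdry = p ++ d :: Δ.revPath q ∧
      p.map Δ.label = word g ∧ Δ.label d = a ∧ q.map Δ.label = word (g * P.val a) ∧
      Δ.IsShell f [d] (fun j t => if j = 0 then θ (0, t) else θ (1, t)) (fun _ => θ) ∧
      Δ.Follows (fun t => θ (0, t)) Δ.base p ∧ Δ.Follows (fun t => θ (1, t)) Δ.base q ∧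
      (∀ t, Δ.proj (θ (0, t)) = Y g t) ∧ ∀ t, Δ.proj (θ (1, t)) = Y (g * P.val a) t)
    (u : List A) (hu : u ≠ []) :
    ∃ (w : List A) (Δ : VanKampenDiagram P w) (b p : List Δ.D) (C : ℕ → I → Δ.Realization)
      (S : ℕ → I × I → Δ.Realization), Δ.bdry = b ++ Δ.revPath p ∧ b.map Δ.label = u ∧
      p.map Δ.label = word (P.eval u) ∧ Δ.IsShell f b C S ∧
      Δ.Follows (C u.length) Δ.base p ∧ ∀ t, Δ.proj (C u.length t) = Y (P.eval u) t := by
  induction u using List.reverseRecOn with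
  | nil => exact absurd rfl hu
  | append_singleton u a ih =>
    have hev : P.eval (u ++ [a]) = P.eval u * P.val a := by
      rw [P.eval_append]
      simp [SymmetrizedPresentation.eval]
    obtain ⟨w₂, Δ₂, θ, q, d, p₂, hb₂, hq, hd, hp₂, hS₂, hF₂, hF₂', hY₂, hY₂'⟩ := h (P.eval u) a
    rcases eq_or_ne u [] with rfl | hu'
    -- The first letter starts at the identity, whose normal form is empty, so its diagram alone
    -- begins the induction.
    · obtain rfl : q = [] := by
        rw [show P.eval ([] : List A) = 1 from rfl, hw1] at hq
        simpa using hq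
      refine ⟨w₂, Δ₂, [d], p₂, _, _, hb₂, by simp [hd], ?_, hS₂, hF₂', ?_⟩
      · rw [hp₂, hev]
      · rw [hev]
        exact hY₂'
    · obtain ⟨w₁, Δ₁, b, p, C, S, hb₁, hb, hp, hS, hF, hY⟩ := ih hu'
      have hbu : b.length = u.length := by simpa using congrArg List.length hb
      have hsp : P.IsSimple (p.map Δ₁.label) := hp ▸ hw _
      obtain ⟨w, W, φ₁, φ₂, e1, e2⟩ := Δ₁.exists_glue Δ₂ hb₁ hb₂ (hp.trans hq.symm) hsp
        (by rintro rfl; simp at hb; exact hu' hb) (by simp)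
      have hp' : Δ₁.IsPath Δ₁.base p (Δ₁.pathEnd Δ₁.base b) := by
        have := Δ₁.bdry_isPath
        rw [hb₁, TwoComplex.isPath_append] at this
        have := this.2.revPath
        rwa [TwoComplex.revPath_revPath] at this
      -- Both curves project to the curve of the same group element, and the paths they follow have
      -- just been glued.
      have hm : ∀ t, φ₁.toHom.map (C b.length t) = φ₂.toHom.map (θ (0, t)) := by
        rw [hbu]
        exact proj_follows_eq φ₁ φ₂ hp' (Δ₂.isPath_of_bdry_eq hb₂).1 (hp.trans hq.symm) hsp e2 hF
          hF₂ (fun t => (hY t).trans (hY₂ t).symm)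
      have hsh := isShell_append (hS.map φ₁) (hS₂.map φ₂)
        (by rw [List.length_map]; exact hm)
      have hlen : ¬ (u ++ [a]).length ≤ (b.map φ₁.onD).length := by
        rw [List.length_map, hbu]
        simp
      refine ⟨w, W, b.map φ₁.onD ++ [φ₂.onD d], p₂.map φ₂.onD, _, _, ?_, ?_, ?_, hsh, ?_, ?_⟩
      · rw [e1, List.map_cons, φ₂.toHom.revPath_map]
        simp
      · rw [List.map_append, φ₁.map_label, hb, List.map_singleton, φ₂.label_onD, hd]
      · rw [φ₂.map_label, hp₂, hev]
      · rw [← φ₂.onV_base]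
        simp only [if_neg hlen]
        exact hF₂'.map φ₂.toHom
      · intro t
        simp only [if_neg hlen]
        rw [hev, ← hY₂']
        exact φ₂.proj_map _

end VanKampenDiagram

end TameFilling

namespace TameFilling

universe u v
variable {G : Type u} {A : Type v} [Group G]

/-! ### Vanishing rational homology of the sphere, and lobes of a diagram -/

namespace TwoComplex

variable {K : TwoComplex}

/-- Number the directed edges and keep from each pair the one with the smaller number. -/
theorem exists_orientation (K : TwoComplex) [Finite K.D] :
    ∃ O : Set K.D, (∀ d, K.rev d ∈ O ↔ d ∉ O) ∧ 2 * O.ncard = Nat.card K.D := by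
  obtain ⟨n, ⟨e⟩⟩ := Finite.exists_equiv_fin K.D
  refine ⟨{d | e d < e (K.rev d)}, fun d => ?_, ?_⟩
  · rw [Set.mem_ofPred_eq, Set.mem_ofPred_eq, K.rev_rev, not_lt]
    refine ⟨le_of_lt, fun h => lt_of_le_of_ne h fun h' => K.rev_ne d (e.injective h')⟩
  · rw [← Set.ncard_add_ncard_compl {d | e d < e (K.rev d)}, two_mul, add_right_inj]
    refine (Set.ncard_congr (fun d _ => K.rev d) (fun d hd => ?_)
      (fun d d' _ _ h => (Function.LeftInverse.injective K.rev_rev) h) fun d hd => ?_)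
    · rw [Set.mem_compl_iff, Set.mem_ofPred_eq, K.rev_rev, not_lt]
      exact le_of_lt hd
    · rw [Set.mem_compl_iff, Set.mem_ofPred_eq, not_lt] at hd
      refine ⟨K.rev d, ?_, K.rev_rev d⟩
      rw [Set.mem_ofPred_eq, K.rev_rev]
      exact lt_of_le_of_ne hd fun h => K.rev_ne d (e.injective h)

theorem IsPath.sum_sub {x y : K.V} {l : List K.D} (h : K.IsPath x l y) (φ : K.V → ℚ) :
    (l.map fun d => φ (K.tgt d) - φ (K.src d)).sum = φ y - φ x := by
  induction l generalizing x with
  | nil => rw [show x = y from h]; simp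
  | cons d l ih =>
    rw [List.map_cons, List.sum_cons, ih h.2, h.1]
    ring

end TwoComplex

namespace VanKampenDiagram

variable {P : SymmetrizedPresentation G A} {w : List A} (Δ : VanKampenDiagram P w)

/-- The coboundary of a function on the vertices. -/
def dV (φ : Δ.V → ℚ) (d : Δ.D) : ℚ := φ (Δ.tgt d) - φ (Δ.src d)

/-- The boundary of a function on the 2-cells and the outer region. -/
noncomputable def dF (s : Option Δ.F → ℚ) (d : Δ.D) : ℚ := s (Δ.face d) - s (Δ.face (Δ.rev d))

theorem dV_rev (φ : Δ.V → ℚ) (d : Δ.D) : Δ.dV φ (Δ.rev d) = -Δ.dV φ d := by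
  rw [dV, dV, TwoComplex.tgt_rev, ← TwoComplex.tgt]
  ring

theorem dF_rev (s : Option Δ.F → ℚ) (d : Δ.D) : Δ.dF s (Δ.rev d) = -Δ.dF s d := by
  rw [dF, dF, Δ.rev_rev]
  ring

theorem sum_rev [Fintype Δ.D] (g : Δ.D → ℚ) : ∑ d, g (Δ.rev d) = ∑ d, g d :=
  Function.Bijective.sum_comp (Function.Involutive.bijective Δ.rev_rev) g

/-- Summation by parts: reversal and rotation permute the directed edges, rotation fixes the initial
vertex, and `next d` borders the same region as `rev d`. This is the statement that a boundary has
no boundary. -/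
theorem sum_dV_mul_dF [Fintype Δ.D] (φ : Δ.V → ℚ) (s : Option Δ.F → ℚ) :
    ∑ d, Δ.dV φ d * Δ.dF s d = 0 := by
  have h1 := Δ.sum_rev fun d => φ (Δ.tgt d) * s (Δ.face d)
  have h2 := Δ.sum_rev fun d => φ (Δ.src d) * s (Δ.face d)
  have h3 : ∑ d, φ (Δ.src (Δ.next d)) * s (Δ.face (Δ.next d)) =
      ∑ d, φ (Δ.src d) * s (Δ.face d) :=
    Function.Bijective.sum_comp (Finite.injective_iff_bijective.1 Δ.next_injective)
      fun d => φ (Δ.src d) * s (Δ.face d)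
  simp only [src_next, face_next, TwoComplex.tgt_rev] at h1 h3
  have h4 : ∀ d, Δ.dV φ d * Δ.dF s d = φ (Δ.tgt d) * s (Δ.face d) +
      φ (Δ.src d) * s (Δ.face (Δ.rev d)) - φ (Δ.src d) * s (Δ.face d) -
        φ (Δ.src (Δ.rev d)) * s (Δ.face (Δ.rev d)) := by
    intro d
    rw [dV, dF, TwoComplex.tgt]
    ring
  simp only [h4, Finset.sum_sub_distrib, Finset.sum_add_distrib]
  linarith

theorem eq_of_dV_eq_zero {φ : Δ.V → ℚ} (h : ∀ d, Δ.dV φ d = 0) (x : Δ.V) :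
    φ x = φ Δ.base := by
  obtain ⟨l, hl⟩ := Δ.connected x
  have h1 := hl.sum_sub φ
  rw [show (fun d => φ (Δ.tgt d) - φ (Δ.src d)) = fun _ => (0 : ℚ) from funext h] at h1
  simp at h1
  linarith

/-- A function on the regions that does not change across edges is constant around each vertex,
hence along every edge path. A boundary edge brings in the outer region, and every 2-cell has a
side. -/
theorem eq_of_dF_eq_zero (hb : Δ.bdry ≠ []) {s : Option Δ.F → ℚ} (h : ∀ d, Δ.dF s d = 0)
    (o : Option Δ.F) : s o = s none := by
  have hrev : ∀ d, s (Δ.face d) = s (Δ.face (Δ.rev d)) := fun d => sub_eq_zero.1 (h d)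
  have hlink : ∀ d d', Δ.src d = Δ.src d' → s (Δ.face d) = s (Δ.face d') := by
    intro d d' hdd
    have hl := Δ.link d d' hdd
    clear hdd
    induction hl with
    | rel x y hxy => rw [hrev, ← Δ.face_next, Δ.corner_iff_next.1 hxy]
    | refl => rfl
    | symm _ _ _ ih => exact ih.symm
    | trans _ _ _ _ _ ih1 ih2 => exact ih1.trans ih2
  have hpath : ∀ l x y, Δ.IsPath x l y → ∀ d d', Δ.src d = x → Δ.src d' = y →
      s (Δ.face d) = s (Δ.face d') := by
    intro l
    induction l with
    | nil =>
      intro x y h d d' hd hd'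
      exact hlink d d' (hd.trans ((show x = y from h).trans hd'.symm))
    | cons e l ih =>
      intro x y h d d' hd hd'
      rw [hlink d e (hd.trans h.1.symm), hrev]
      exact ih _ y h.2 _ d' rfl hd'
  obtain ⟨c, t, hct⟩ := List.exists_cons_of_ne_nil hb
  have hc : Δ.src c = Δ.base := by
    have := Δ.bdry_isPath
    rw [hct] at this
    exact this.1
  have hall : ∀ d, s (Δ.face d) = s none := by
    intro d
    obtain ⟨l, hl⟩ := Δ.connected (Δ.src d)
    rw [← hpath l _ _ hl c d hc rfl, Δ.face_eq_none (by rw [hct]; exact List.mem_cons_self)]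
  cases o with
  | none => rfl
  | some f =>
    have hne : Δ.cw f ≠ [] := by
      rcases Δ.cw_spec f with h | h <;> rw [h]
      · exact Δ.bd_ne_nil f
      · simpa using Δ.bd_ne_nil f
    obtain ⟨d, _, hd⟩ := List.exists_cons_of_ne_nil hne
    rw [← hall d, Δ.face_eq_some (f := f) (by rw [hd]; exact List.mem_cons_self)]

/-- The coboundaries and the boundaries of functions on the 2-cells and the outer region span the
antisymmetric functions on the directed edges. -/
theorem exists_dV_add_dF (hb : Δ.bdry ≠ []) {c : Δ.D → ℚ} (hc : ∀ d, c (Δ.rev d) = -c d) :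
    ∃ (φ : Δ.V → ℚ) (s : Option Δ.F → ℚ), ∀ d, Δ.dV φ d + Δ.dF s d = c d := by
  have := Δ.finite_V
  have := Δ.finite_D
  have := Δ.finite_F
  have := Fintype.ofFinite Δ.V
  have := Fintype.ofFinite Δ.D
  have := Fintype.ofFinite Δ.F
  obtain ⟨O, hO, hcard⟩ := Δ.toTwoComplex.exists_orientation
  have := Fintype.ofFinite O
  let L : (Δ.V → ℚ) × (Option Δ.F → ℚ) →ₗ[ℚ] (O → ℚ) := {
    toFun z d := Δ.dV z.1 d + Δ.dF z.2 d
    map_add' z z' := by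
      ext d
      simp only [dV, dF, Prod.fst_add, Prod.snd_add, Pi.add_apply]
      ring
    map_smul' r z := by
      ext d
      simp only [dV, dF, Prod.smul_fst, Prod.smul_snd, Pi.smul_apply, smul_eq_mul, RingHom.id_apply]
      ring }
  have hext : ∀ {g g' : Δ.D → ℚ}, (∀ d, g (Δ.rev d) = -g d) → (∀ d, g' (Δ.rev d) = -g' d) →
      (∀ d ∈ O, g d = g' d) → ∀ d, g d = g' d := by
    intro g g' hg hg' h d
    by_cases hd : d ∈ O
    · exact h d hd
    · have := h _ ((hO d).2 hd)
      rw [hg, hg'] at this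
      exact neg_inj.1 this
  have hanti : ∀ φ s d, Δ.dV φ (Δ.rev d) + Δ.dF s (Δ.rev d) = -(Δ.dV φ d + Δ.dF s d) := by
    intro φ s d
    rw [dV_rev, dF_rev]
    ring
  let M : ℚ × ℚ →ₗ[ℚ] (Δ.V → ℚ) × (Option Δ.F → ℚ) := {
    toFun z := (fun _ => z.1, fun _ => z.2)
    map_add' _ _ := rfl
    map_smul' _ _ := rfl }
  -- Coboundaries and boundaries are orthogonal, so in a vanishing sum both terms vanish and both
  -- functions are constant.
  have hker : LinearMap.ker L ≤ LinearMap.range M := by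
    rintro ⟨φ, s⟩ hz
    have h0 : ∀ d, Δ.dV φ d + Δ.dF s d = 0 :=
      hext (hanti φ s) (fun _ => neg_zero.symm) fun d hd => congrFun (LinearMap.mem_ker.1 hz) ⟨d, hd⟩
    have h1 : ∑ d, Δ.dV φ d * Δ.dV φ d = 0 := by
      rw [← neg_eq_zero, ← Δ.sum_dV_mul_dF φ s, ← Finset.sum_neg_distrib]
      refine Finset.sum_congr rfl fun d _ => ?_
      rw [← mul_neg, eq_neg_of_add_eq_zero_right (h0 d)]
    have h2 : ∀ d, Δ.dV φ d = 0 := fun d => mul_self_eq_zero.1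
      ((Finset.sum_eq_zero_iff_of_nonneg fun d _ => mul_self_nonneg _).1 h1 d (Finset.mem_univ _))
    have h3 : ∀ d, Δ.dF s d = 0 := fun d => by simpa [h2] using h0 d
    exact ⟨(φ Δ.base, s none), Prod.ext (funext fun x => (Δ.eq_of_dV_eq_zero h2 x).symm)
      (funext fun o => (Δ.eq_of_dF_eq_zero hb h3 o).symm)⟩
  have hk : Module.finrank ℚ (LinearMap.ker L) ≤ 2 := by
    refine (Submodule.finrank_mono hker).trans ((LinearMap.finrank_range_le M).trans ?_)
    simp
  have hr := LinearMap.finrank_range_add_finrank_ker L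
  -- The kernel has dimension at most 2, so the range has dimension at least `|V| + (|F| + 1) - 2`,
  -- which by the Euler formula is the number of undirected edges.
  have htop : LinearMap.range L = ⊤ := by
    refine Submodule.eq_top_of_finrank_eq (le_antisymm (Submodule.finrank_le _) ?_)
    have e1 : Module.finrank ℚ ((Δ.V → ℚ) × (Option Δ.F → ℚ)) = Nat.card Δ.V + (Nat.card Δ.F + 1) := by
      rw [Module.finrank_prod, Module.finrank_fintype_fun_eq_card,
        Module.finrank_fintype_fun_eq_card, Fintype.card_option, Nat.card_eq_fintype_card,
        Nat.card_eq_fintype_card]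
    have e2 : Module.finrank ℚ (O → ℚ) = O.ncard := by
      rw [Module.finrank_fintype_fun_eq_card, ← Nat.card_eq_fintype_card, Nat.card_coe_set_eq]
    have e3 := Δ.euler
    omega
  obtain ⟨⟨φ, s⟩, hz⟩ : (fun d : O => c d) ∈ LinearMap.range L := htop ▸ Submodule.mem_top
  exact ⟨φ, s, hext (hanti φ s) hc fun d hd => congrFun hz ⟨d, hd⟩⟩

open Classical in
/-- A closed subpath of the boundary path bounds. -/
theorem exists_dF_eq (hb : Δ.bdry ≠ []) {β : List Δ.D} (hn : β.Nodup) {p : Δ.V}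
    (hβ : Δ.IsPath p β p) : ∃ s : Option Δ.F → ℚ, s none = 0 ∧ ∀ d, Δ.dF s d =
      (if d ∈ β then 1 else 0) - (if Δ.rev d ∈ β then 1 else 0) := by
  have := Δ.finite_D
  have := Fintype.ofFinite Δ.D
  obtain ⟨φ, s, h⟩ := Δ.exists_dV_add_dF hb
    (c := fun d => (if d ∈ β then 1 else 0) - (if Δ.rev d ∈ β then 1 else 0))
    (fun d => by rw [Δ.rev_rev]; ring)
  have h1 : ∑ d, Δ.dV φ d * (if d ∈ β then 1 else 0) = 0 := by
    simp only [mul_ite, mul_one, mul_zero]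
    rw [← Finset.sum_filter]
    have : Finset.univ.filter (fun d => d ∈ β) = β.toFinset := by ext; simp
    rw [this, List.sum_toFinset _ hn]
    exact (hβ.sum_sub φ).trans (sub_self _)
  have h2 : ∑ d, Δ.dV φ d * (if Δ.rev d ∈ β then 1 else 0) = 0 := by
    have := Δ.sum_rev fun d => Δ.dV φ d * (if Δ.rev d ∈ β then 1 else 0)
    simp only [dV_rev, Δ.rev_rev, neg_mul, Finset.sum_neg_distrib] at this
    linarith
  -- The cycle of `β` is orthogonal to coboundaries since `β` is closed, and so is `dF s`. Hence the
  -- component `dV φ` is orthogonal to itself. Subtracting a constant then normalizes `s` on the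
  -- outer region.
  have h3 : ∑ d, Δ.dV φ d * Δ.dV φ d = 0 := by
    have e : ∀ d, Δ.dV φ d * Δ.dV φ d = Δ.dV φ d * (if d ∈ β then 1 else 0) -
        Δ.dV φ d * (if Δ.rev d ∈ β then 1 else 0) - Δ.dV φ d * Δ.dF s d := by
      intro d
      rw [← mul_sub, ← h d]
      ring
    simp only [e, Finset.sum_sub_distrib, h1, h2, Δ.sum_dV_mul_dF, sub_zero]
  have h4 : ∀ d, Δ.dV φ d = 0 := fun d => mul_self_eq_zero.1
    ((Finset.sum_eq_zero_iff_of_nonneg fun d _ => mul_self_nonneg _).1 h3 d (Finset.mem_univ _))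
  refine ⟨fun o => s o - s none, sub_self _, fun d => ?_⟩
  rw [← h d, h4, zero_add, dF, dF]
  ring

/-- The edges on one side of a closed subpath `β` of the boundary path at the vertex `p`. -/
theorem exists_lobe {α β α' : List Δ.D} (hb : Δ.bdry = α ++ β ++ α') (hne : Δ.bdry ≠ [])
    {p : Δ.V} (hβ : Δ.IsPath p β p) :
    ∃ S : Set Δ.D, (∀ d, Δ.rev d ∈ S ↔ d ∈ S) ∧ (∀ d ∈ β, d ∈ S) ∧
      (∀ d ∈ Δ.bdry, d ∈ S → d ∈ β) ∧
      (∀ f, ∀ d ∈ Δ.cw f, ∀ d' ∈ Δ.cw f, d ∈ S → d' ∈ S) ∧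
      ∀ d d', Δ.src d = Δ.src d' → Δ.src d ≠ p → d ∈ S → d' ∈ S := by
  classical
  have hn : β.Nodup := by
    have := Δ.nodup_bdry
    rw [hb] at this
    exact this.of_append_left.of_append_right
  obtain ⟨s, h0, hs⟩ := Δ.exists_dF_eq hne hn hβ
  -- Correcting `s` on the sides in `β` makes it a function of undirected edges: the jump of `s`
  -- across `β` is cancelled. It is constant on the sides of each 2-cell, equals `-1` on `β` and is
  -- zero on the other boundary edges.
  let τ : Δ.D → ℚ := fun d => s (Δ.face d) - (if d ∈ β then 1 else 0)
  have hrev : ∀ d, τ (Δ.rev d) = τ d := by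
    intro d
    have := hs d
    rw [dF] at this
    simp only [τ]
    linarith
  have hmem : ∀ d ∈ β, d ∈ Δ.bdry := fun d hd => by
    rw [hb]
    exact List.mem_append_left _ (List.mem_append_right _ hd)
  have hout : ∀ d ∈ Δ.bdry, τ d = -(if d ∈ β then 1 else 0) := by
    intro d hd
    simp only [τ, Δ.face_eq_none hd, h0, zero_sub]
  have hin : ∀ {d : Δ.D} {f : Δ.F}, Δ.face d = some f → τ d = s (some f) := by
    intro d f hd
    have : d ∉ β := fun h => by
      rw [Δ.face_eq_none (hmem d h)] at hd
      simp at hd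
    simp only [τ, hd, if_neg this, sub_zero]
  have hnextβ : ∀ {a b : Δ.D} {x y : List Δ.D}, β = x ++ a :: b :: y →
      Δ.next (Δ.rev a) = b := by
    intro a b x y h
    refine Δ.corner_iff_next.1 (Or.inr ?_)
    rw [Δ.rev_rev, hb, h]
    exact cycNext_iff.2 (Or.inl ⟨α ++ x, y ++ α', by simp⟩)
  -- `rev d` and `next d` border the same region. For the outer region they lie in `β` together,
  -- except at the two ends of `β`, which are both at `p`.
  have hnext : ∀ d, Δ.src d ≠ p → τ (Δ.next d) = τ d := by
    intro d hd
    rw [← hrev d]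
    cases hf : Δ.face (Δ.rev d) with
    | some f => rw [hin hf, hin ((Δ.face_next d).trans hf)]
    | none =>
      have h1 := Δ.mem_bdry_of_face hf
      have h2 := Δ.mem_bdry_of_face ((Δ.face_next d).trans hf)
      rw [hout _ h1, hout _ h2]
      have : Δ.next d ∈ β ↔ Δ.rev d ∈ β := by
        constructor
        · intro h
          obtain ⟨x, y, hxy⟩ := List.append_of_mem h
          rcases List.eq_nil_or_concat x with rfl | ⟨x, c, rfl⟩
          · rw [hxy] at hβ
            exact absurd ((Δ.src_next d).symm.trans hβ.1) hd
          · rw [List.concat_eq_append, List.append_assoc] at hxy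
            have := Δ.next_injective (hnextβ hxy)
            rw [hxy, ← this, Δ.rev_rev]
            simp
        · intro h
          obtain ⟨x, y, hxy⟩ := List.append_of_mem h
          cases y with
          | nil =>
            rw [hxy, TwoComplex.isPath_append] at hβ
            exact absurd ((TwoComplex.tgt_rev d).symm.trans hβ.2.2) hd
          | cons c y =>
            have := hnextβ hxy
            rw [Δ.rev_rev] at this
            rw [hxy, this]
            simp
      simp only [this]
  -- The lobe is the support of `τ`.
  refine ⟨{d | τ d ≠ 0}, fun d => ?_, fun d hd => ?_, fun d hd h => ?_, fun f d hd d' hd' h => ?_,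
    fun d d' hdd hd h => ?_⟩
  · rw [Set.mem_ofPred_eq, hrev]
    rfl
  · rw [Set.mem_ofPred_eq, hout d (hmem d hd), if_pos hd]
    norm_num
  · by_contra h'
    rw [Set.mem_ofPred_eq, hout d hd, if_neg h'] at h
    simp at h
  · rw [Set.mem_ofPred_eq, hin (Δ.face_eq_some hd)] at h
    rwa [Set.mem_ofPred_eq, hin (Δ.face_eq_some hd')]
  · have key : ∀ a b, Relation.EqvGen (Corner Δ.rev Δ.cw Δ.bdry) a b →
        Δ.src a = Δ.src b ∧ (Δ.src a ≠ p → τ a = τ b) := by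
      intro a b hab
      induction hab with
      | rel a b h =>
        obtain rfl := Δ.corner_iff_next.1 h
        exact ⟨(Δ.src_next a).symm, fun h => (hnext a h).symm⟩
      | refl => exact ⟨rfl, fun _ => rfl⟩
      | symm _ _ _ ih => exact ⟨ih.1.symm, fun h => (ih.2 (ih.1 ▸ h)).symm⟩
      | trans _ _ _ _ _ ih1 ih2 =>
        exact ⟨ih1.1.trans ih2.1, fun h => (ih1.2 h).trans (ih2.2 (ih1.1 ▸ h))⟩
    rw [Set.mem_ofPred_eq, ← (key d d' (Δ.link d d' hdd)).2 hd]
    exact h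

end VanKampenDiagram

end TameFilling

namespace TameFilling

universe u v
variable {G : Type u} {A : Type v} [Group G]

/-! ### Collapsing a lobe to its cut vertex -/

namespace TwoComplex

variable {K : TwoComplex}

open Classical in
/-- The map of a complex before gluing that sends the closed cells in `S` to the vertex `p`. -/
noncomputable def preCollapse (S : Set K.D) (p : K.V) : K.Pre → K.Realization
  | .inl ⟨x, _⟩ => if ∃ d ∈ S, K.src d = x then K.vtx p else K.vtx x
  | .inr (.inl ⟨d, x⟩) => if d ∈ S then K.vtx p else K.onEdge d x
  | .inr (.inr ⟨⟨f, k⟩, z⟩) => if (K.bd f).get k ∈ S then K.vtx p else K.onSector f k z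

/-- If the part `S` of a complex meets its complement only in the vertex `p`, then it can be
collapsed to `p`. The sign of the function `m` tells the two parts apart. -/
theorem exists_collapse {S : Set K.D} {p : K.V} (hrev : ∀ d, K.rev d ∈ S ↔ d ∈ S)
    (hbd : ∀ f, ∀ d ∈ K.bd f, ∀ d' ∈ K.bd f, d ∈ S → d' ∈ S)
    (hv : ∀ d d', K.src d = K.src d' → K.src d ≠ p → d ∈ S → d' ∈ S)
    (hloop : ∀ d, K.src d ≠ K.tgt d) :
    ∃ (ρ : K.Realization → K.Realization) (m : K.Realization → ℝ), Continuous ρ ∧ Continuous m ∧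
      (∀ q, (ρ q = K.vtx p ∧ 0 ≤ m q) ∨ (ρ q = q ∧ m q ≤ 0)) ∧ (∀ q, m q = 0 → q = K.vtx p) ∧
      (∀ d ∈ S, ∀ x, ρ (K.onEdge d x) = K.vtx p) ∧
      ∀ x, (x ≠ p → ∃ d ∉ S, K.src d = x) → m (K.vtx x) ≤ 0 := by
  classical
  have hsrc : ∀ d, d ∉ S → K.src d ≠ p → ¬ ∃ d' ∈ S, K.src d' = K.src d := by
    rintro d hd hp ⟨d', h1, h2⟩
    exact hd (hv d' d h2 (h2 ▸ hp) h1)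
  have hvS : ∀ d ∉ S, (if ∃ d' ∈ S, K.src d' = K.src d then K.vtx p else K.vtx (K.src d)) =
      K.vtx (K.src d) := by
    intro d hd
    by_cases hp : K.src d = p
    · rw [hp, ite_self]
    · rw [if_neg (hsrc d hd hp)]
  have hglue : ∀ a b, K.Glue a b → preCollapse S p a = preCollapse S p b := by
    intro a b hab
    cases hab with
    | start d =>
      by_cases hd : d ∈ S
      · simp only [preCollapse, if_pos hd]
        rw [if_pos ⟨d, hd, rfl⟩]
      · simp only [preCollapse, if_neg hd]
        rw [hvS d hd, onEdge_zero]
    | rev d x => simp only [preCollapse, hrev, onEdge_rev]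
    | centre f k k' x x' =>
      have : (K.bd f).get k ∈ S ↔ (K.bd f).get k' ∈ S :=
        ⟨hbd f _ (List.get_mem _ _) _ (List.get_mem _ _),
          hbd f _ (List.get_mem _ _) _ (List.get_mem _ _)⟩
      have h2 : K.onSector f k (x, 0) = K.onSector f k' (x', 0) :=
        Quot.sound (Glue.centre f k k' x x')
      simp only [preCollapse, this, h2]
    | ray f k r =>
      have : (K.bd f).get k ∈ S ↔ (K.bd f).get (cycSucc k) ∈ S :=
        ⟨hbd f _ (List.get_mem _ _) _ (List.get_mem _ _),
          hbd f _ (List.get_mem _ _) _ (List.get_mem _ _)⟩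
      have h2 : K.onSector f k (1, r) = K.onSector f (cycSucc k) (0, r) :=
        Quot.sound (Glue.ray f k r)
      simp only [preCollapse, this, h2]
    | side f k x => simp only [preCollapse, onSector_one]
  let ρ : K.Realization → K.Realization := Quot.lift (preCollapse S p) hglue
  have ρv : ∀ x, ρ (K.vtx x) = if ∃ d ∈ S, K.src d = x then K.vtx p else K.vtx x := fun _ => rfl
  have ρd : ∀ d x, ρ (K.onEdge d x) = if d ∈ S then K.vtx p else K.onEdge d x := fun _ _ => rfl
  have ρf : ∀ f k z, ρ (K.onSector f k z) =
    if (K.bd f).get k ∈ S then K.vtx p else K.onSector f k z := fun _ _ _ => rfl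
  -- The function `m` extends these values: nonnegative on the collapsed part, nonpositive on the
  -- other, and zero at `p` only. It detects by its sign when a curve passes from one part to the
  -- other.
  let val : K.V → ℝ := fun x => if x = p then 0 else if ∃ d ∈ S, K.src d = x then 1 else -1
  let c : K.F → ℝ := fun f => if (K.bd f).head (K.bd_ne_nil f) ∈ S then 1 else -1
  let m := linExt val c
  have hvp : val p = 0 := if_pos rfl
  have hv1 : ∀ d ∈ S, K.src d ≠ p → val (K.src d) = 1 := fun d hd hp => by
    simp only [val, if_neg hp]
    exact if_pos ⟨d, hd, rfl⟩
  have hv2 : ∀ d ∉ S, K.src d ≠ p → val (K.src d) = -1 := fun d hd hp => by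
    simp only [val, if_neg hp]
    exact if_neg (hsrc d hd hp)
  -- Both parts are treated at once, with `e = 1` or `e = -1`. As there are no loops, at most one
  -- end of an edge is `p`, so `m` has no further zeros on it.
  have hedge : ∀ (e : ℝ), e ≠ 0 → ∀ d, (K.src d ≠ p → val (K.src d) = e) →
      (K.tgt d ≠ p → val (K.tgt d) = e) → ∀ x, (∃ r : ℝ, 0 ≤ r ∧ m (K.onEdge d x) = r * e) ∧
        (m (K.onEdge d x) = 0 → K.onEdge d x = K.vtx p) := by
    intro e he d h1 h2 x
    have hm : m (K.onEdge d x) = (1 - x) * val (K.src d) + x * val (K.tgt d) := rfl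
    have x0 := x.2.1
    have x1 := x.2.2
    rw [hm]
    by_cases hs : K.src d = p
    · have ht : K.tgt d ≠ p := fun h => hloop d (hs.trans h.symm)
      rw [hs, hvp, h2 ht]
      refine ⟨⟨x, x0, by ring⟩, fun h => ?_⟩
      have : (x : ℝ) = 0 := by
        rw [mul_zero, zero_add] at h
        exact (mul_eq_zero.1 h).resolve_right he
      rw [show x = 0 from Subtype.ext this, onEdge_zero, hs]
    · rw [h1 hs]
      by_cases ht : K.tgt d = p
      · rw [ht, hvp]
        refine ⟨⟨1 - x, by linarith, by ring⟩, fun h => ?_⟩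
        have : (x : ℝ) = 1 := by
          rw [mul_zero, add_zero] at h
          linarith [(mul_eq_zero.1 h).resolve_right he]
        rw [show x = 1 from Subtype.ext this, onEdge_one, ht]
      · rw [h2 ht]
        refine ⟨⟨1, zero_le_one, by ring⟩, fun h => ?_⟩
        exact absurd (by linarith : e = 0) he
  have hS : ∀ d ∈ S, ∀ x, (∃ r : ℝ, 0 ≤ r ∧ m (K.onEdge d x) = r * 1) ∧
      (m (K.onEdge d x) = 0 → K.onEdge d x = K.vtx p) := fun d hd =>
    hedge 1 one_ne_zero d (hv1 d hd) (hv1 (K.rev d) ((hrev d).2 hd))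
  have hS' : ∀ d ∉ S, ∀ x, (∃ r : ℝ, 0 ≤ r ∧ m (K.onEdge d x) = r * (-1)) ∧
      (m (K.onEdge d x) = 0 → K.onEdge d x = K.vtx p) := fun d hd =>
    hedge (-1) (by norm_num) d (hv2 d hd) (hv2 (K.rev d) fun h => hd ((hrev d).1 h))
  have hsector : ∀ (e : ℝ), e ≠ 0 → ∀ f k z, c f = e →
      ((∃ r : ℝ, 0 ≤ r ∧ m (K.onEdge ((K.bd f).get k) z.1) = r * e) ∧
        (m (K.onEdge ((K.bd f).get k) z.1) = 0 →
          K.onEdge ((K.bd f).get k) z.1 = K.vtx p)) →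
      (∃ r : ℝ, 0 ≤ r ∧ m (K.onSector f k z) = r * e) ∧
        (m (K.onSector f k z) = 0 → K.onSector f k z = K.vtx p) := by
    rintro e he f k ⟨x, r⟩ hc ⟨⟨y, hy0, hy⟩, h2⟩
    have hm : m (K.onSector f k (x, r)) =
      r * m (K.onEdge ((K.bd f).get k) x) + (1 - r) * c f := rfl
    have r0 := r.2.1
    have r1 := r.2.2
    simp only at hy h2
    rw [hm, hc, hy]
    have hnn := mul_nonneg r0 hy0
    refine ⟨⟨r * y + (1 - r), by linarith, by ring⟩, fun h => ?_⟩
    have h3 : (r * y + (1 - r) : ℝ) = 0 := by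
      refine (mul_eq_zero.1 (?_ : (r * y + (1 - r) : ℝ) * e = 0)).resolve_right he
      linarith
    have h4 : (r : ℝ) = 1 := by linarith
    have h5 : y = 0 := by
      rw [h4] at h3
      linarith
    rw [show r = 1 from Subtype.ext h4, onSector_one]
    exact h2 (by rw [hy, h5, zero_mul])
  have hhead : ∀ f k, (K.bd f).head (K.bd_ne_nil f) ∈ S ↔ (K.bd f).get k ∈ S := fun f k =>
    ⟨hbd f _ (List.head_mem _) _ (List.get_mem _ _), hbd f _ (List.get_mem _ _) _ (List.head_mem _)⟩
  refine ⟨ρ, m, ?_, continuous_linExt _ _, fun q => ?_, fun q => ?_, fun d hd x => ?_,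
    fun x hx => ?_⟩
  · refine continuous_of_cells (fun d => ?_) fun f k => ?_
    · simp only [ρd]
      split_ifs
      · exact continuous_const
      · exact continuous_onEdge d
    · simp only [ρf]
      split_ifs
      · exact continuous_const
      · exact continuous_onSector f k
  · refine Realization.ind (p := fun q => (ρ q = K.vtx p ∧ 0 ≤ m q) ∨ (ρ q = q ∧ m q ≤ 0))
      (fun x => ?_) (fun d x => ?_) (fun f k z => ?_) q
    · rw [ρv, show m (K.vtx x) = val x from rfl]
      by_cases hp : x = p
      · left
        rw [hp, ite_self, hvp]
        exact ⟨rfl, le_rfl⟩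
      · by_cases h : ∃ d ∈ S, K.src d = x
        · left
          simp only [val, if_neg hp, if_pos h]
          exact ⟨trivial, zero_le_one⟩
        · right
          simp only [val, if_neg hp, if_neg h]
          exact ⟨trivial, by norm_num⟩
    · rw [ρd]
      by_cases hd : d ∈ S
      · obtain ⟨⟨r, h0, h⟩, -⟩ := hS d hd x
        exact Or.inl ⟨if_pos hd, by linarith⟩
      · obtain ⟨⟨r, h0, h⟩, -⟩ := hS' d hd x
        exact Or.inr ⟨if_neg hd, by linarith⟩
    · rw [ρf]
      by_cases hd : (K.bd f).get k ∈ S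
      · obtain ⟨⟨r, h0, h⟩, -⟩ := hsector 1 one_ne_zero f k z (if_pos ((hhead f k).2 hd))
          (hS _ hd z.1)
        exact Or.inl ⟨if_pos hd, by linarith⟩
      · obtain ⟨⟨r, h0, h⟩, -⟩ := hsector (-1) (by norm_num) f k z
          (if_neg fun h => hd ((hhead f k).1 h)) (hS' _ hd z.1)
        exact Or.inr ⟨if_neg hd, by linarith⟩
  · refine Realization.ind (p := fun q => m q = 0 → q = K.vtx p)
      (fun x => ?_) (fun d x => ?_) (fun f k z => ?_) q
    · intro h
      by_contra hp
      have hp' : x ≠ p := fun h => hp (by rw [h])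
      change val x = 0 at h
      simp only [val, if_neg hp'] at h
      split_ifs at h <;> norm_num at h
    · by_cases hd : d ∈ S
      · exact (hS d hd x).2
      · exact (hS' d hd x).2
    · by_cases hd : (K.bd f).get k ∈ S
      · exact (hsector 1 one_ne_zero f k z (if_pos ((hhead f k).2 hd)) (hS _ hd z.1)).2
      · exact (hsector (-1) (by norm_num) f k z (if_neg fun h => hd ((hhead f k).1 h))
          (hS' _ hd z.1)).2
  · rw [ρd, if_pos hd]
  · change val x ≤ 0
    by_cases hp : x = p
    · rw [hp, hvp]
    · obtain ⟨d, hd, rfl⟩ := hx hp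
      rw [hv2 d hd hp]
      norm_num

end TwoComplex

namespace VanKampenDiagram

variable {P : SymmetrizedPresentation G A} {w : List A} (Δ : VanKampenDiagram P w)

/-- A diagram can be retracted to the complement of the lobe bounded by a closed subpath `β` of
the boundary path. -/
theorem exists_retraction {α β α' : List Δ.D} (hb : Δ.bdry = α ++ β ++ α') (hne : Δ.bdry ≠ [])
    {p : Δ.V} (hα : Δ.IsPath Δ.base α p) (hβ : Δ.IsPath p β p) :
    ∃ (ρ : Δ.Realization → Δ.Realization) (m : Δ.Realization → ℝ), Continuous ρ ∧ Continuous m ∧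
      (∀ q, (ρ q = Δ.vtx p ∧ 0 ≤ m q) ∨ (ρ q = q ∧ m q ≤ 0)) ∧ (∀ q, m q = 0 → q = Δ.vtx p) ∧
      (∀ d ∈ β, ∀ x, ρ (Δ.onEdge d x) = Δ.vtx p) ∧ m Δ.basePt ≤ 0 := by
  obtain ⟨S, h1, h2, h3, h4, h5⟩ := Δ.exists_lobe hb hne hβ
  have hbd : ∀ f, ∀ d ∈ Δ.bd f, ∀ d' ∈ Δ.bd f, d ∈ S → d' ∈ S := by
    intro f d hd d' hd' h
    rcases Δ.cw_spec f with hf | hf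
    · exact h4 f d (hf ▸ hd) d' (hf ▸ hd') h
    · have hf' : ∀ {x}, x ∈ Δ.bd f → Δ.rev x ∈ Δ.cw f := fun hx => by
        rw [hf]
        exact List.mem_reverse.2 (List.mem_map_of_mem hx)
      exact (h1 d').1 (h4 f _ (hf' hd) _ (hf' hd') ((h1 d).2 h))
  obtain ⟨ρ, m, e1, e2, e3, e4, e5, e6⟩ :=
    TwoComplex.exists_collapse (p := p) h1 hbd h5 Δ.src_ne_tgt
  -- The base point is `p`, or else it starts the first edge of `α`. That edge lies outside the
  -- lobe, because boundary edges of the lobe belong to `β` and the boundary path repeats no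
  -- directed edge.
  refine ⟨ρ, m, e1, e2, e3, e4, fun d hd => e5 d (h2 d hd), e6 Δ.base fun hp => ?_⟩
  cases α with
  | nil => exact absurd hα hp
  | cons a α =>
    have hn := Δ.nodup_bdry
    rw [hb, List.append_assoc, List.cons_append, List.nodup_cons] at hn
    refine ⟨a, fun ha => hn.1 ?_, hα.1⟩
    have := h3 a (by rw [hb]; simp) ha
    simp [this]

end VanKampenDiagram

end TameFilling

namespace TameFilling

universe u v
variable {G : Type u} {A : Type v} [Group G]

/-! ### Tame curves under retraction, and their homotopies -/

theorem TwoComplex.IsPath.pathEnd_take {K : TwoComplex} {x y : K.V} {l : List K.D}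
    (h : K.IsPath x l y) {j : ℕ} (hj : j < l.length) :
    K.pathEnd x (l.take j) = K.src l[j] ∧ K.pathEnd x (l.take (j + 1)) = K.tgt l[j] := by
  have e : l = l.take j ++ l[j] :: l.drop (j + 1) := by simp
  rw [e, TwoComplex.isPath_append] at h
  refine ⟨h.2.1.symm, ?_⟩
  rw [List.take_succ_eq_append_getElem hj, TwoComplex.pathEnd_append]
  rfl

namespace VanKampenDiagram

variable {P : SymmetrizedPresentation G A} {w : List A} (Δ : VanKampenDiagram P w)

/-- A curve in a diagram is tame if heights along it do not decrease too much. -/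
def TameCurve (f : QuarterNat → QuarterNat) (c : I → Δ.Realization) : Prop :=
  ∀ s t, s < t → P.height (Δ.proj (c s)) ≤ f (P.height (Δ.proj (c t)))

variable {Δ}

/-- By the intermediate value theorem `m` vanishes in between, and its only zero is `p`. -/
theorem exists_crossing {m : Δ.Realization → ℝ} (hm : Continuous m) {p : Δ.V}
    (h0 : ∀ q, m q = 0 → q = Δ.vtx p) {c : I → Δ.Realization} (hc : Continuous c) {s t : I}
    (hst : s ≤ t) (h : (m (c s) ≤ 0 ∧ 0 ≤ m (c t)) ∨ (m (c t) ≤ 0 ∧ 0 ≤ m (c s))) :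
    ∃ u, s ≤ u ∧ u ≤ t ∧ c u = Δ.vtx p := by
  have hmc : ContinuousOn (fun t => m (c t)) (Set.Icc s t) := (hm.comp hc).continuousOn
  rcases h with h | h
  · obtain ⟨u, hu, h1⟩ := intermediate_value_Icc hst hmc h
    exact ⟨u, hu.1, hu.2, h0 _ h1⟩
  · obtain ⟨u, hu, h1⟩ := intermediate_value_Icc' hst hmc h
    exact ⟨u, hu.1, hu.2, h0 _ h1⟩

/-- If exactly one of the two points is moved to `p`, the original curve passes through `p` at a
time in between, and tameness is applied with that time. If both points become `p`, or the crossing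
falls on the end in question, the lower bound on `f` at `p` takes over; this is the source of the 2.
-/
theorem TameCurve.retract {f : QuarterNat → QuarterNat} (hf : Monotone f) {p : Δ.V}
    (hp : (P.height (Δ.proj (Δ.vtx p)) : ℚ) ≤ f (P.height (Δ.proj (Δ.vtx p))) + 2)
    {ρ : Δ.Realization → Δ.Realization} {m : Δ.Realization → ℝ} (hm : Continuous m)
    (hρ : ∀ q, (ρ q = Δ.vtx p ∧ 0 ≤ m q) ∨ (ρ q = q ∧ m q ≤ 0))
    (h0 : ∀ q, m q = 0 → q = Δ.vtx p) {c : I → Δ.Realization} (hc : Continuous c)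
    (ht : Δ.TameCurve f c) : Δ.TameCurve (shift 2 f) fun t => ρ (c t) := by
  intro s t hst
  have hpp : P.height (Δ.proj (Δ.vtx p)) ≤ shift 2 f (P.height (Δ.proj (Δ.vtx p))) :=
    le_shift hf (b := P.height (Δ.proj (Δ.vtx p))) (by norm_num) (by exact_mod_cast hp)
  simp only
  rcases hρ (c s) with ⟨h1, h2⟩ | ⟨h1, h2⟩ <;> rcases hρ (c t) with ⟨h3, h4⟩ | ⟨h3, h4⟩
  · rw [h1, h3]
    exact hpp
  · rw [h1, h3]
    obtain ⟨u, hu, hu', e⟩ := exists_crossing hm h0 hc hst.le (Or.inr ⟨h4, h2⟩)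
    rcases hu'.lt_or_eq with h | rfl
    · rw [← e]
      exact (ht u t h).trans (le_shift_self hf 2 _)
    · rw [e]
      exact hpp
  · rw [h1, h3]
    obtain ⟨u, hu, hu', e⟩ := exists_crossing hm h0 hc hst.le (Or.inl ⟨h2, h4⟩)
    rcases hu.lt_or_eq with h | rfl
    · rw [← e]
      exact (ht s u h).trans (le_shift_self hf 2 _)
    · rw [e]
      exact hpp
  · rw [h1, h3]
    exact (ht s t hst).trans (le_shift_self hf 2 _)

theorem follows_zero {c : I → Δ.Realization} {x y : Δ.V} {l : List Δ.D} (hl : Δ.IsPath x l y)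
    (h : Δ.Follows c x l) : c 0 = Δ.vtx x ∧ c 1 = Δ.vtx y ∧ Continuous c := by
  obtain ⟨r, h1, h2, h3, h4, h5⟩ := h
  refine ⟨?_, ?_, ?_⟩
  · rw [h5, TwoComplex.pathPt_nonpos hl h3.le]
  · rw [h5, TwoComplex.pathPt_of_length_le hl h4.ge]
  · rw [funext h5]
    exact (TwoComplex.continuous_pathPt hl).comp h1

/-- The curve starts outside the lobe and can enter it only through `p`. As its path is simple and
ends at `p`, it is stationary from then on. -/
theorem retract_follows {p y : Δ.V} {ρ : Δ.Realization → Δ.Realization} {m : Δ.Realization → ℝ}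
    (hm : Continuous m) (hρ : ∀ q, (ρ q = Δ.vtx p ∧ 0 ≤ m q) ∨ (ρ q = q ∧ m q ≤ 0))
    (h0 : ∀ q, m q = 0 → q = Δ.vtx p) (hbase : m Δ.basePt ≤ 0) {l : List Δ.D}
    (hl : Δ.IsPath Δ.base l y) (hs : P.IsSimple (l.map Δ.label)) {c : I → Δ.Realization}
    (hF : Δ.Follows c Δ.base l) (h1 : c 1 = Δ.vtx p) (t : I) : ρ (c t) = c t := by
  obtain ⟨hc0, hc1, hc⟩ := follows_zero hl hF
  obtain rfl : y = p := TwoComplex.vtx_injective (hc1.symm.trans h1)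
  rcases hρ (c t) with ⟨h2, h3⟩ | ⟨h2, -⟩
  · obtain ⟨r, r1, r2, r3, r4, r5⟩ := hF
    obtain ⟨u, -, hu, e⟩ := exists_crossing hm h0 hc (s := 0) (t := t) t.2.1
      (Or.inl ⟨by rw [hc0]; exact hbase, h3⟩)
    have hrange : ∀ t, r t ∈ Set.Icc (0 : ℝ) l.length := fun t =>
      ⟨r3 ▸ r2 t.2.1, r4 ▸ r2 t.2.2⟩
    have h4 : r u = r 1 := Δ.pathPt_injOn hl hs (hrange u) (hrange 1) (by
      rw [← r5, ← r5, e, h1])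
    have h5 : r t = r 1 := le_antisymm (r2 t.2.2) (h4 ▸ r2 hu)
    rw [h2, ← h1, r5 t, r5 1, h5]
  · exact h2

/-- The curves from the base point to `q` that are tame. -/
def curvesTo (Δ : VanKampenDiagram P w) (f : QuarterNat → QuarterNat) (q : Δ.Realization) :
    Set C(I, Δ.Realization) :=
  {c | c 0 = Δ.basePt ∧ c 1 = q ∧ Δ.TameCurve f c}

namespace IsShell

variable {f : QuarterNat → QuarterNat} {C : ℕ → I → Δ.Realization}
  {S : ℕ → I × I → Δ.Realization}

theorem tame_curve (h : Δ.IsShell f Δ.bdry C S) (hne : Δ.bdry ≠ []) {j : ℕ} (hj : j ≤ Δ.bdry.length) :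
    Δ.TameCurve f (C j) := by
  rcases hj.lt_or_eq with hj | rfl
  · rw [← show (fun t => S j (0, t)) = C j from funext (h.left j hj)]
    exact h.tame j hj 0
  · obtain ⟨n, hn⟩ := Nat.exists_eq_succ_of_ne_zero (mt List.length_eq_zero_iff.1 hne)
    rw [hn, ← show (fun t => S n (1, t)) = C n.succ from funext (h.right n (by omega))]
    exact h.tame n (by omega) 1

theorem curve_one (h : Δ.IsShell f Δ.bdry C S) (hne : Δ.bdry ≠ []) {j : ℕ} (hj : j ≤ Δ.bdry.length) :
    C j 1 = Δ.vtx (Δ.pathEnd Δ.base (Δ.bdry.take j)) := by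
  rcases hj.lt_or_eq with hj | rfl
  · rw [← h.left j hj, h.one j hj, TwoComplex.onEdge_zero, (Δ.bdry_isPath.pathEnd_take hj).1]
  · obtain ⟨n, hn⟩ := Nat.exists_eq_succ_of_ne_zero (mt List.length_eq_zero_iff.1 hne)
    have hn' : n < Δ.bdry.length := by omega
    rw [hn, ← h.right n hn', h.one n hn', TwoComplex.onEdge_one,
      ← (Δ.bdry_isPath.pathEnd_take hn').2]

theorem continuous_curve (h : Δ.IsShell f Δ.bdry C S) {j : ℕ} (hj : j ≤ Δ.bdry.length) : Continuous (C j) := by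
  obtain ⟨l, y, h1, -, h3⟩ := h.follows j hj
  exact (follows_zero h1 h3).2.2

theorem curve_zero (h : Δ.IsShell f Δ.bdry C S) {j : ℕ} (hj : j ≤ Δ.bdry.length) : C j 0 = Δ.basePt := by
  obtain ⟨l, y, h1, -, h3⟩ := h.follows j hj
  exact (follows_zero h1 h3).1

/-- Between the two visits to the same vertex the boundary path runs around a lobe. After its
collapse, the homotopies over these edges all end at that vertex and connect the two curves. -/
theorem joinedIn_of_lt (h : Δ.IsShell f Δ.bdry C S) (hf : Monotone f) (hne : Δ.bdry ≠ [])
    (hlow : ∀ q ∈ Δ.skeletonOne, (P.height (Δ.proj q) : ℚ) ≤ f (P.height (Δ.proj q)) + 2)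
    {j l : ℕ} (hjl : j < l) (hl : l ≤ Δ.bdry.length)
    (he : Δ.pathEnd Δ.base (Δ.bdry.take j) = Δ.pathEnd Δ.base (Δ.bdry.take l)) :
    JoinedIn (Δ.curvesTo (shift 2 f) (C j 1))
      (⟨C j, h.continuous_curve (hjl.le.trans hl)⟩ : C(I, Δ.Realization))
      ⟨C l, h.continuous_curve hl⟩ := by
  set p := Δ.pathEnd Δ.base (Δ.bdry.take j) with hp
  have hj := hjl.le.trans hl
  have hb : Δ.bdry = Δ.bdry.take j ++ (Δ.bdry.take l).drop j ++ Δ.bdry.drop l := by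
    rw [← Nat.min_eq_left hjl.le, ← List.take_take, Nat.min_eq_left hjl.le,
      List.take_append_drop, List.take_append_drop]
  have hpath := Δ.bdry_isPath
  rw [hb, TwoComplex.isPath_append, TwoComplex.isPath_append] at hpath
  obtain ⟨⟨hα, hβ⟩, -⟩ := hpath
  have hend : Δ.pathEnd Δ.base (Δ.bdry.take j ++ (Δ.bdry.take l).drop j) = p := by
    rw [he]
    congr 1
    rw [← Nat.min_eq_left hjl.le, ← List.take_take, Nat.min_eq_left hjl.le,
      List.take_append_drop]
  rw [hend] at hβ
  obtain ⟨ρ, m, e1, e2, e3, e4, e5, e6⟩ := Δ.exists_retraction hb hne hα hβ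
  have hlowp := hlow _ (Or.inl ⟨p, rfl⟩)
  have hCj : C j 1 = Δ.vtx p := h.curve_one hne hj
  have hCl : C l 1 = Δ.vtx p := by rw [h.curve_one hne hl, ← he]
  have hρp : ρ (Δ.vtx p) = Δ.vtx p := by
    rcases e3 (Δ.vtx p) with ⟨h1, -⟩ | ⟨h1, -⟩ <;> exact h1
  have hρb : ρ Δ.basePt = Δ.basePt := by
    rcases e3 Δ.basePt with ⟨h1, h2⟩ | ⟨h1, -⟩
    · rw [h1, e4 _ (le_antisymm e6 h2)]
    · exact h1
  have hret : ∀ i (hi : i ≤ Δ.bdry.length), C i 1 = Δ.vtx p → ∀ t, ρ (C i t) = C i t := by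
    intro i hi h1 t
    obtain ⟨l, y, g1, g2, g3⟩ := h.follows i hi
    exact retract_follows e2 e3 e4 e6 g1 g2 g3 h1 t
  -- Induction along the lobe: each edge of `β` is crushed to `p`, so the retracted homotopy over it
  -- moves no end point.
  have key : ∀ i, j ≤ i → ∀ hi : i ≤ l, JoinedIn (Δ.curvesTo (shift 2 f) (C j 1))
      (⟨C j, h.continuous_curve hj⟩ : C(I, Δ.Realization))
      ⟨fun t => ρ (C i t), e1.comp (h.continuous_curve (hi.trans hl))⟩ := by
    intro i hji
    induction i, hji using Nat.le_induction with
    | base =>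
      intro hi
      have : (⟨fun t => ρ (C j t), e1.comp (h.continuous_curve (hi.trans hl))⟩ :
          C(I, Δ.Realization)) = ⟨C j, h.continuous_curve hj⟩ :=
        ContinuousMap.ext fun t => hret j hj hCj t
      rw [this]
      refine JoinedIn.refl ⟨h.curve_zero hj, rfl, ?_⟩
      exact fun s t hst => (h.tame_curve hne hj s t hst).trans (le_shift_self hf 2 _)
    | succ i hji ih =>
      intro hi
      have hib : i < Δ.bdry.length := by omega
      refine (ih (by omega)).trans ?_
      have hc : Continuous fun z => ρ (S i z) := e1.comp (h.continuous i hib)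
      refine ⟨⟨ContinuousMap.curry ⟨fun z => ρ (S i z), hc⟩, ?_, ?_⟩, fun x => ?_⟩
      · ext t
        exact congrArg ρ (h.left i hib t)
      · ext t
        exact congrArg ρ (h.right i hib t)
      · refine ⟨(congrArg ρ (h.zero i hib x)).trans hρb, ?_, ?_⟩
        · refine (congrArg ρ (h.one i hib x)).trans ((e5 _ ?_ x).trans hCj.symm)
          rw [List.mem_iff_getElem]
          refine ⟨i - j, by simp; omega, ?_⟩
          simp [Nat.add_sub_cancel' hji]
        · exact TameCurve.retract hf hlowp e2 e3 e4
            ((h.continuous i hib).comp (by fun_prop : Continuous fun t : I => (x, t)))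
            (h.tame i hib x)
  have hfin := key l hjl.le le_rfl
  have : (⟨fun t => ρ (C l t), e1.comp (h.continuous_curve hl)⟩ : C(I, Δ.Realization)) =
      ⟨C l, h.continuous_curve hl⟩ := ContinuousMap.ext fun t => hret l hl hCl t
  rwa [this] at hfin

theorem joinedIn (h : Δ.IsShell f Δ.bdry C S) (hf : Monotone f) (hne : Δ.bdry ≠ [])
    (hlow : ∀ q ∈ Δ.skeletonOne, (P.height (Δ.proj q) : ℚ) ≤ f (P.height (Δ.proj q)) + 2)
    {j l : ℕ} (hj : j ≤ Δ.bdry.length) (hl : l ≤ Δ.bdry.length)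
    (he : Δ.pathEnd Δ.base (Δ.bdry.take j) = Δ.pathEnd Δ.base (Δ.bdry.take l)) :
    JoinedIn (Δ.curvesTo (shift 2 f) (C j 1))
      (⟨C j, h.continuous_curve hj⟩ : C(I, Δ.Realization)) ⟨C l, h.continuous_curve hl⟩ := by
  rcases lt_trichotomy j l with h1 | rfl | h1
  · exact h.joinedIn_of_lt hf hne hlow h1 hl he
  · exact JoinedIn.refl ⟨h.curve_zero hj, rfl, fun s t hst =>
      (h.tame_curve hne hj s t hst).trans (le_shift_self hf 2 _)⟩
  · have := (h.joinedIn_of_lt hf hne hlow h1 hj he.symm).symm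
    rwa [h.curve_one hne hl, ← he, ← h.curve_one hne hj] at this

end IsShell

/-- The tame curves from the base point to points of the edge `d`. -/
def curvesToEdge (Δ : VanKampenDiagram P w) (f : QuarterNat → QuarterNat) (d : Δ.D) :
    Set (C(I, Δ.Realization) × I) :=
  {z | z.1 0 = Δ.basePt ∧ z.1 1 = Δ.onEdge d z.2 ∧ Δ.TameCurve f z.1}

theorem joinedIn_curvesToEdge {f : QuarterNat → QuarterNat} {d : Δ.D} {x : I}
    {c c' : C(I, Δ.Realization)} {q : Δ.Realization} (h : JoinedIn (Δ.curvesTo f q) c c')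
    (hq : q = Δ.onEdge d x) : JoinedIn (Δ.curvesToEdge f d) (c, x) (c', x) := by
  subst hq
  obtain ⟨γ, hγ⟩ := h
  exact ⟨γ.map (f := fun c => (c, x)) (by fun_prop), fun t => hγ t⟩

/-- The homotopy over some occurrence of `d` is preceded and followed by homotopies that replace its
end curves by the chosen curves to the same vertices. -/
theorem IsShell.joinedIn_edge {f : QuarterNat → QuarterNat} {C : ℕ → I → Δ.Realization}
    {S : ℕ → I × I → Δ.Realization} (h : Δ.IsShell f Δ.bdry C S) (hf : Monotone f)
    (hlow : ∀ q ∈ Δ.skeletonOne, (P.height (Δ.proj q) : ℚ) ≤ f (P.height (Δ.proj q)) + 2)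
    {d : Δ.D} (hd : d ∈ Δ.bdry) {j l : ℕ} (hj : j ≤ Δ.bdry.length) (hl : l ≤ Δ.bdry.length)
    (hjd : Δ.pathEnd Δ.base (Δ.bdry.take j) = Δ.src d)
    (hld : Δ.pathEnd Δ.base (Δ.bdry.take l) = Δ.tgt d) :
    JoinedIn (Δ.curvesToEdge (shift 2 f) d)
      ((⟨C j, h.continuous_curve hj⟩, 0) : C(I, Δ.Realization) × I)
      (⟨C l, h.continuous_curve hl⟩, 1) := by
  have hne := List.ne_nil_of_mem hd
  obtain ⟨i, hi, rfl⟩ := List.mem_iff_getElem.1 hd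
  obtain ⟨h1, h2⟩ := Δ.bdry_isPath.pathEnd_take hi
  have j1 := joinedIn_curvesToEdge (d := Δ.bdry[i]) (x := 0)
    (h.joinedIn hf hne hlow hj hi.le (hjd.trans h1.symm))
    (by rw [h.curve_one hne hj, hjd, TwoComplex.onEdge_zero])
  have j3 := joinedIn_curvesToEdge (d := Δ.bdry[i]) (x := 1)
    (h.joinedIn hf hne hlow (j := i + 1) hi hl (h2.trans hld.symm))
    (by rw [h.curve_one hne hi, h2, TwoComplex.onEdge_one])
  refine (j1.trans ?_).trans j3
  have hc := (ContinuousMap.curry ⟨S i, h.continuous i hi⟩).continuous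
  refine ⟨⟨⟨fun x => (ContinuousMap.curry ⟨S i, h.continuous i hi⟩ x, x), by fun_prop⟩, ?_, ?_⟩,
    fun x => ⟨h.zero i hi x, h.one i hi x, fun s t hst => ?_⟩⟩
  · exact Prod.ext (ContinuousMap.ext (h.left i hi)) rfl
  · exact Prod.ext (ContinuousMap.ext (h.right i hi)) rfl
  · exact (h.tame i hi x s t hst).trans (le_shift_self hf 2 _)

end VanKampenDiagram

end TameFilling

/-! ### From shells to van Kampen homotopies -/

namespace TameFilling

universe u v
variable {G : Type u} {A : Type v} [Group G]

/-- The map `t ↦ min (2 t) 1`. -/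
noncomputable def double (t : I) : I := Set.projIcc 0 1 zero_le_one (2 * (t : ℝ))

theorem continuous_double : Continuous double := by
  unfold double
  fun_prop

theorem double_zero : double 0 = 0 := by
  rw [double, Set.Icc.coe_zero, mul_zero]
  exact Set.projIcc_left _

theorem double_of_ge {t : I} (h : (1 : ℝ) / 2 ≤ t) : double t = 1 :=
  Set.projIcc_of_right_le _ (by linarith)

theorem coe_double {t : I} (h : (t : ℝ) ≤ 1 / 2) : (double t : ℝ) = 2 * t := by
  have := t.2.1
  rw [double, Set.projIcc_of_mem _ ⟨by linarith, by linarith⟩]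

/-- The affine interpolation between `r` and `y` for `1/2 ≤ t ≤ 1`. -/
noncomputable def drift (r y t : I) : I :=
  Set.projIcc 0 1 zero_le_one (r + (2 * (t : ℝ) - 1) * (y - r))

theorem drift_half {r y t : I} (h : (t : ℝ) = 1 / 2) : drift r y t = r := by
  rw [drift, h]
  norm_num

theorem drift_one (r y : I) : drift r y 1 = y := by
  rw [drift, Set.Icc.coe_one]
  norm_num

theorem drift_self (r t : I) : drift r r t = r := by
  rw [drift, sub_self, mul_zero, add_zero, Set.projIcc_val]

namespace VanKampenDiagram

variable {P : SymmetrizedPresentation G A} {w : List A} {Δ : VanKampenDiagram P w}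

/-- A path of curves need not reach the point `x` of the edge at parameter `x`, because
concatenation reparametrizes. So each curve is run in the first half of the time, and its end point
then drifts along the edge to the correct place. Heights on an edge differ by at most 2, which is
added to the 2 already present. -/
theorem curvesToEdge_homotopy {f : QuarterNat → QuarterNat} (hf : Monotone f)
    (hlow : ∀ q ∈ Δ.skeletonOne, (P.height (Δ.proj q) : ℚ) ≤ f (P.height (Δ.proj q)) + 2)
    {d : Δ.D} {c c' : C(I, Δ.Realization)}
    (h : JoinedIn (Δ.curvesToEdge (shift 2 f) d) (c, 0) (c', 1)) :
    ∃ T : I × I → Δ.Realization, Continuous T ∧ (∀ t, T (0, t) = c (double t)) ∧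
      (∀ t, T (1, t) = c' (double t)) ∧ (∀ x, T (x, 0) = Δ.basePt) ∧
      (∀ x, T (x, 1) = Δ.onEdge d x) ∧ Δ.ExtrinsicallyTame T (shift 4 f) := by
  obtain ⟨γ, hγ⟩ := h
  have hu : Continuous fun z : I × I => (γ z.1).1 (double z.2) := by
    have h1 : Continuous fun x : I => (γ x).1 := continuous_fst.comp γ.continuous
    exact (ContinuousMap.continuous_uncurry_of_continuous ⟨_, h1⟩).comp
      (continuous_fst.prodMk (continuous_double.comp continuous_snd))
  have hv : Continuous fun z : I × I => Δ.onEdge d (drift (γ z.1).2 z.1 z.2) := by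
    refine (TwoComplex.continuous_onEdge d).comp ?_
    have h1 : Continuous fun x : I => (γ x).2 := continuous_snd.comp γ.continuous
    unfold drift
    refine continuous_projIcc.comp ?_
    fun_prop
  have hagree : ∀ z : I × I, (z.2 : ℝ) = 1 / 2 →
      (γ z.1).1 (double z.2) = Δ.onEdge d (drift (γ z.1).2 z.1 z.2) := by
    intro z hz
    rw [double_of_ge hz.ge, drift_half hz, (hγ z.1).2.1]
  have hedge : ∀ x y, (P.height (Δ.proj (Δ.onEdge d x)) : ℚ) ≤
      P.height (Δ.proj (Δ.onEdge d y)) + 2 := by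
    intro x y
    have h1 := (P.reachable.coarseDist_onEdge_bounds (Δ.dart d) x).2
    have h2 := (P.reachable.coarseDist_onEdge_bounds (Δ.dart d) y).1
    change (P.cayley.coarseDist (1 : G) (P.cayley.onEdge (Δ.dart d) x) : ℚ) ≤
      P.cayley.coarseDist (1 : G) (P.cayley.onEdge (Δ.dart d) y) + 2
    linarith
  have hslow : ∀ x y, P.height (Δ.proj (Δ.onEdge d x)) ≤
      shift 4 f (P.height (Δ.proj (Δ.onEdge d y))) := by
    intro x y
    have h1 := hlow _ (Or.inr ⟨d, x, rfl⟩)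
    have h2 := hedge x y
    refine le_shift hf (b := P.height (Δ.proj (Δ.onEdge d x))) ?_ ?_
    · push_cast
      linarith
    · push_cast
      linarith
  refine ⟨fun z => if (z.2 : ℝ) ≤ 1 / 2 then (γ z.1).1 (double z.2) else
    Δ.onEdge d (drift (γ z.1).2 z.1 z.2), hu.if_le hv (by fun_prop) (by fun_prop) hagree,
    fun t => ?_, fun t => ?_, fun x => ?_, fun x => ?_, fun x s t hst => ?_⟩
  · simp only [γ.source]
    split_ifs with h
    · rfl
    · have h0 := (hγ 0).2.1
      rw [γ.source] at h0
      rw [drift_self, ← h0, double_of_ge (not_le.1 h).le]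
  · simp only [γ.target]
    split_ifs with h
    · rfl
    · have h0 := (hγ 1).2.1
      rw [γ.target] at h0
      rw [drift_self, ← h0, double_of_ge (not_le.1 h).le]
  · simp only
    rw [if_pos (by rw [Set.Icc.coe_zero]; norm_num), double_zero]
    exact (hγ x).1
  · simp only
    rw [if_neg (by rw [Set.Icc.coe_one]; norm_num), drift_one]
  · have hst' : (s : ℝ) < t := hst
    simp only
    by_cases ht : (t : ℝ) ≤ 1 / 2
    · rw [if_pos ht, if_pos (hst'.le.trans ht)]
      refine ((hγ x).2.2 _ _ ?_).trans (shift_le_shift hf (by norm_num) _)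
      rw [← Subtype.coe_lt_coe, coe_double ht, coe_double (hst'.le.trans ht)]
      linarith
    · rw [if_neg ht]
      by_cases hs : (s : ℝ) ≤ 1 / 2
      · rw [if_pos hs]
        rcases hs.lt_or_eq with hs' | hs'
        · have h1 := (hγ x).2.2 (double s) 1 (by
            rw [← Subtype.coe_lt_coe, coe_double hs, Set.Icc.coe_one]
            linarith)
          rw [(hγ x).2.1] at h1
          have h2 : (P.height (Δ.proj ((γ x).1 (double s))) : ℚ) ≤
            shift 2 f (P.height (Δ.proj (Δ.onEdge d (γ x).2))) := h1
          rw [coe_shift] at h2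
          -- The intermediate argument is raised by 2 to match the inner `shift 2`; the change of
          -- height along the edge raises the bound for it to 4.
          refine le_shift hf (b := (P.height (Δ.proj (Δ.onEdge d (γ x).2))).addNat 2) ?_ ?_
          · have := hedge (γ x).2 (drift (γ x).2 x t)
            change (P.height (Δ.proj (Δ.onEdge d (γ x).2)) : ℚ) + (2 : ℕ) ≤ _
            push_cast
            linarith
          · push_cast at h2 ⊢
            linarith
        · rw [hagree (x, s) hs']
          exact hslow _ _
      · rw [if_neg hs]
        exact hslow _ _

/-- Curves with the same initial point are homotopic, with free end points. -/
theorem joined_of_zero {X : Type*} [TopologicalSpace X] {x : X} {c c' : C(I, X)} (h : c 0 = x)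
    (h' : c' 0 = x) : Joined c c' := by
  have key : ∀ c : C(I, X), c 0 = x → Joined (ContinuousMap.const I x) c := by
    intro c hc
    refine ⟨⟨ContinuousMap.curry ⟨fun z : I × I => c (z.1 * z.2), by fun_prop⟩, ?_, ?_⟩⟩
    · ext t
      change c (0 * t) = x
      rw [zero_mul, hc]
    · ext t
      change c (1 * t) = c t
      rw [one_mul]
  exact (key c h).symm.trans (key c' h')

/-- With one curve chosen for each vertex, the homotopies over the edges fit together. The map is
built on the whole 1-skeleton, where continuity is available, and then restricted to the boundary.
-/
theorem IsShell.exists_isVanKampenHomotopy {f : QuarterNat → QuarterNat}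
    {C : ℕ → I → Δ.Realization} {S : ℕ → I × I → Δ.Realization} (h : Δ.IsShell f Δ.bdry C S)
    (hf : Monotone f) (hne : Δ.bdry ≠ [])
    (hlow : ∀ q ∈ Δ.skeletonOne, (P.height (Δ.proj q) : ℚ) ≤ f (P.height (Δ.proj q)) + 2) :
    ∃ ψ : Δ.boundary × I → Δ.Realization,
      Δ.IsVanKampenHomotopy ψ ∧ Δ.ExtrinsicallyTame ψ (shift 4 f) := by
  classical
  have := Δ.finite_D
  -- A vertex on the boundary gets the curve of one of its visits; any other vertex gets a constant
  -- curve, which plays no role after restriction.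
  have hcur : ∀ v : Δ.V, ∃ c : C(I, Δ.Realization), c 0 = Δ.basePt ∧
      (∀ t, c t ∈ Δ.skeletonOne) ∧
      ((∃ j ≤ Δ.bdry.length, Δ.pathEnd Δ.base (Δ.bdry.take j) = v) →
        ∃ j, ∃ hj : j ≤ Δ.bdry.length, Δ.pathEnd Δ.base (Δ.bdry.take j) = v ∧
          c = ⟨C j, h.continuous_curve hj⟩) := by
    intro v
    by_cases hv : ∃ j ≤ Δ.bdry.length, Δ.pathEnd Δ.base (Δ.bdry.take j) = v
    · obtain ⟨j, hj, e⟩ := hv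
      refine ⟨⟨C j, h.continuous_curve hj⟩, h.curve_zero hj, fun t => ?_,
        fun _ => ⟨j, hj, e, rfl⟩⟩
      obtain ⟨l, y, -, -, ρ, -, -, -, -, h1⟩ := h.follows j hj
      change C j t ∈ _
      rw [h1]
      exact TwoComplex.pathPt_mem_skeletonOne _ _ _
    · exact ⟨ContinuousMap.const I Δ.basePt, rfl, fun _ => Or.inl ⟨_, rfl⟩, fun h => absurd h hv⟩
  choose c hc0 hcs hc using hcur
  -- The curve chosen for the base point follows a simple path whose label represents the identity,
  -- so that path is empty.
  have hbase : ∀ t, c Δ.base t = Δ.basePt := by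
    obtain ⟨j, hj, e, hcj⟩ := hc Δ.base ⟨0, Nat.zero_le _, rfl⟩
    have h1 := h.curve_one hne hj
    obtain ⟨l, y, g1, g2, g3⟩ := h.follows j hj
    have hy : y = Δ.base := TwoComplex.vtx_injective
      ((follows_zero g1 g3).2.1.symm.trans (h1.trans (congrArg _ e)))
    have h2 := Δ.pos_isPath g1
    rw [hy, Δ.pos_base, one_mul] at h2
    obtain rfl : l = [] := List.map_eq_nil_iff.1 (g2.eq_nil h2.symm)
    obtain ⟨ρ, -, -, -, -, g4⟩ := g3
    intro t
    rw [hcj]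
    exact g4 t
  have hsrc : ∀ d ∈ Δ.bdry, (∃ j ≤ Δ.bdry.length, Δ.pathEnd Δ.base (Δ.bdry.take j) = Δ.src d) ∧
      ∃ j ≤ Δ.bdry.length, Δ.pathEnd Δ.base (Δ.bdry.take j) = Δ.tgt d := by
    intro d hd
    obtain ⟨i, hi, rfl⟩ := List.mem_iff_getElem.1 hd
    obtain ⟨h1, h2⟩ := Δ.bdry_isPath.pathEnd_take hi
    exact ⟨⟨i, hi.le, h1⟩, i + 1, hi, h2⟩
  have hb : ∀ d ∈ Δ.bdry, ∃ T : I × I → Δ.Realization, Continuous T ∧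
      (∀ t, T (0, t) = c (Δ.src d) (double t)) ∧ (∀ t, T (1, t) = c (Δ.tgt d) (double t)) ∧
      (∀ x, T (x, 0) = Δ.basePt) ∧ (∀ x, T (x, 1) = Δ.onEdge d x) ∧
      Δ.ExtrinsicallyTame T (shift 4 f) := by
    intro d hd
    obtain ⟨j, hj, e, hcj⟩ := hc _ (hsrc d hd).1
    obtain ⟨l, hl, e', hcl⟩ := hc _ (hsrc d hd).2
    rw [hcj, hcl]
    exact curvesToEdge_homotopy hf hlow (h.joinedIn_edge hf hlow hd hj hl e e')
  -- Edges off the boundary only need some homotopy between the chosen end curves; contracting both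
  -- curves to the base point provides it.
  have hT : ∀ d, ∃ T : I × I → Δ.Realization, Continuous T ∧
      (∀ t, T (0, t) = c (Δ.src d) (double t)) ∧ (∀ t, T (1, t) = c (Δ.tgt d) (double t)) ∧
      (d ∈ Δ.bdry ∨ Δ.rev d ∈ Δ.bdry → (∀ x, T (x, 0) = Δ.basePt) ∧
        (∀ x, T (x, 1) = Δ.onEdge d x) ∧ Δ.ExtrinsicallyTame T (shift 4 f)) := by
    intro d
    by_cases hd : d ∈ Δ.bdry
    · obtain ⟨T, h1, h2, h3, h4⟩ := hb d hd
      exact ⟨T, h1, h2, h3, fun _ => h4⟩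
    · by_cases hd' : Δ.rev d ∈ Δ.bdry
      · obtain ⟨T, h1, h2, h3, h4, h5, h6⟩ := hb _ hd'
        refine ⟨fun z => T (σ z.1, z.2), h1.comp (by fun_prop), fun t => ?_, fun t => ?_,
          fun _ => ⟨fun x => h4 _, fun x => (h5 _).trans (TwoComplex.onEdge_rev d x),
            fun x s t hst => h6 _ s t hst⟩⟩
        · simp only [unitInterval.symm_zero, h3, TwoComplex.tgt_rev]
        · simp only [unitInterval.symm_one, h2]
          rfl
      · obtain ⟨γ⟩ := joined_of_zero (hc0 (Δ.src d)) (hc0 (Δ.tgt d))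
        refine ⟨fun z => γ z.1 (double z.2), ?_, fun t => by simp only [γ.source],
          fun t => by simp only [γ.target], fun h => absurd h (by simp [hd, hd'])⟩
        exact (ContinuousMap.continuous_uncurry_of_continuous ⟨_, γ.continuous⟩).comp
          (continuous_fst.prodMk (continuous_double.comp continuous_snd))
  choose T hTc hT0 hT1 hTb using hT
  obtain ⟨O, hO, -⟩ := Δ.toTwoComplex.exists_orientation
  -- The boundary path may traverse an edge in both directions, with unrelated homotopies. The
  -- orientation selects one of them for the undirected edge.
  let T' : Δ.D → I → I → Δ.Realization := fun d x t =>
    if d ∈ O then T d (x, t) else T (Δ.rev d) (σ x, t)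
  obtain ⟨Υ, hΥ, hΥv, hΥe⟩ := TwoComplex.exists_continuous_skeletonOne
    (fun v t => c v (double t)) T'
    (fun v => (c v).continuous.comp continuous_double)
    (fun d => by
      by_cases hd : d ∈ O
      · simp only [T', if_pos hd]
        exact hTc d
      · simp only [T', if_neg hd]
        exact (hTc _).comp (by fun_prop : Continuous fun z : I × I => (σ z.1, z.2)))
    (fun d t => by
      by_cases hd : d ∈ O
      · simp only [T', if_pos hd, hT0]
      · simp only [T', if_neg hd, unitInterval.symm_zero, hT1, TwoComplex.tgt_rev])
    (fun d x t => by
      by_cases hd : d ∈ O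
      · have : Δ.rev d ∉ O := fun h => (hO d).1 h hd
        simp only [T', if_pos hd, if_neg this, unitInterval.symm_symm, Δ.rev_rev]
      · simp only [T', if_neg hd, if_pos ((hO d).2 hd)])
  have hT'b : ∀ d ∈ Δ.bdry, (∀ x, T' d x 0 = Δ.basePt) ∧ (∀ x, T' d x 1 = Δ.onEdge d x) ∧
      ∀ x s t, s < t → P.height (Δ.proj (T' d x s)) ≤
        shift 4 f (P.height (Δ.proj (T' d x t))) := by
    intro d hd
    by_cases hdO : d ∈ O
    · obtain ⟨h1, h2, h3⟩ := hTb d (Or.inl hd)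
      simp only [T', if_pos hdO]
      exact ⟨h1, h2, h3⟩
    · obtain ⟨h1, h2, h3⟩ := hTb (Δ.rev d) (Or.inr ((Δ.rev_rev d).symm ▸ hd))
      simp only [T', if_neg hdO]
      exact ⟨fun _ => h1 _, fun x => (h2 _).trans (TwoComplex.onEdge_rev d x),
        fun x s t hst => h3 _ s t hst⟩
  have hsub : ∀ q ∈ Δ.boundary, q ∈ Δ.skeletonOne := by
    rintro q (rfl | ⟨d, -, x, rfl⟩)
    · exact Or.inl ⟨_, rfl⟩
    · exact Or.inr ⟨_, _, rfl⟩
  have hΥb : ∀ hp t, Υ (⟨Δ.basePt, hp⟩, t) = Δ.basePt := fun hp t =>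
    (hΥv Δ.base hp t).trans (hbase _)
  refine ⟨fun z => Υ (⟨z.1, hsub _ z.1.2⟩, z.2), ⟨?_, ?_, ?_, ?_, ?_⟩, ?_⟩
  · exact hΥ.comp (Continuous.prodMk
      ((continuous_subtype_val.comp continuous_fst).subtype_mk _) continuous_snd)
  · rintro ⟨q, rfl | ⟨d, hd, x, rfl⟩⟩
    · exact hΥb _ _
    · exact (hΥe d x _ 0).trans ((hT'b d hd).1 x)
  · rintro ⟨q, rfl | ⟨d, hd, x, rfl⟩⟩
    · exact hΥb _ _
    · exact (hΥe d x _ 1).trans ((hT'b d hd).2.1 x)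
  · rintro ⟨q, hq⟩ t (rfl : q = Δ.basePt)
    exact hΥb _ _
  · rintro ⟨q, hq⟩ t ⟨x, (rfl : q = Δ.vtx x)⟩
    exact (hΥv x _ t) ▸ hcs x (double t)
  · rintro ⟨q, rfl | ⟨d, hd, x, rfl⟩⟩ s t hst
    · simp only [hΥb]
      have h1 := hlow Δ.basePt (Or.inl ⟨_, rfl⟩)
      exact le_shift hf (b := P.height (Δ.proj Δ.basePt)) (by norm_num)
        (by push_cast; linarith)
    · simp only [hΥe]
      exact (hT'b d hd).2.2 x s t hst

/-- The diagram of the empty word that consists of a single vertex. -/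
def point (P : SymmetrizedPresentation G A) : VanKampenDiagram P [] where
  V := Unit
  D := Empty
  F := Empty
  src := Empty.elim
  rev := id
  rev_rev _ := rfl
  rev_ne d := d.elim
  bd := Empty.elim
  bd_ne_nil f := f.elim
  bd_closed f := f.elim
  finite_V := inferInstance
  finite_D := inferInstance
  finite_F := inferInstance
  base := ()
  label := Empty.elim
  label_rev d := d.elim
  label_face f := f.elim
  pos _ := 1
  pos_base := rfl
  pos_tgt d := d.elim
  cw := Empty.elim
  cw_spec f := f.elim
  bdry := []
  bdry_isPath := rfl
  bdry_label := rfl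
  connected _ := ⟨[], rfl⟩
  sides := ⟨by rintro (⟨⟨⟩, _⟩ | ⟨_, h⟩); simp at h, fun d => d.elim⟩
  link d := d.elim
  euler := by simp

end VanKampenDiagram

/-- The diagrams of the combing are assembled letter by letter along the word. Since it represents
the identity, whose combing path is empty, the final boundary path carries the word alone. -/
theorem RadialTameCombing.tameFilling {P : SymmetrizedPresentation G A}
    {f : QuarterNat → QuarterNat} (hf : Monotone f) (h : RadialTameCombing P f) :
    ExtrinsicTameFilling P (shift 4 f) := by
  obtain ⟨Υ, ⟨hΥ, hΥ0, hΥ1, -, -, word, hword, hedge⟩, ht⟩ := h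
  have hlow : ∀ q ∈ P.cayley.skeletonOne, (P.height q : ℚ) ≤ f (P.height q) + 2 := fun q hq =>
    P.height_le_of_vertices hf (fun g => P.exists_le_of_tame
      (hΥ.comp (by fun_prop : Continuous fun t : I => (vertexPt P g, t))) (hΥ1 (vertexPt P g))
      fun s t hst => ht _ s t hst) hq
  have hw1 : word 1 = [] := (hword 1).2.1.eq_nil (hword 1).1
  intro w hw
  -- Shells are built for nonempty words only. For the empty word the one-point diagram works, its
  -- tameness at equal heights again coming from the lower bound on `f`.
  rcases eq_or_ne w [] with rfl | hne
  · refine ⟨VanKampenDiagram.point P, fun _ => (VanKampenDiagram.point P).basePt,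
      ⟨continuous_const, fun _ => rfl, ?_, fun _ _ _ => rfl, fun _ _ _ => Or.inl ⟨_, rfl⟩⟩,
      fun p s t _ => ?_⟩
    · rintro ⟨q, rfl | ⟨d, -, x, rfl⟩⟩
      · rfl
      · exact d.elim
    · have h1 : (P.height ((VanKampenDiagram.point P).proj (VanKampenDiagram.point P).basePt) : ℚ) ≤
          f (P.height ((VanKampenDiagram.point P).proj (VanKampenDiagram.point P).basePt)) + 2 :=
        hlow _ ((VanKampenDiagram.point P).cell.map_skeletonOne
        (q := (VanKampenDiagram.point P).basePt) (Or.inl ⟨_, rfl⟩))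
      exact le_shift hf (b := P.height ((VanKampenDiagram.point P).proj
        (VanKampenDiagram.point P).basePt)) (by norm_num)
        (h1.trans (by push_cast; linarith))
  obtain ⟨w', Δ, b, p, C, S, hb, hbl, hpl, hS, -⟩ := VanKampenDiagram.exists_isShell (f := f)
    (word := word) (Y := fun g t => Υ (vertexPt P g, t)) (fun g => (hword g).2.1) hw1
    (fun g a => by
      obtain ⟨Δ, θ, ⟨p, d, q, h1, h2, h3, h4, h5, h6, h7, h8, h9⟩, h10⟩ := hedge g a
      obtain ⟨hp, hq⟩ := Δ.isPath_of_bdry_eq h1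
      refine ⟨_, Δ, θ, p, d, q, h1, h2, h3, h4, ?_, h8, h9, fun t => ?_, fun t => ?_⟩
      · refine VanKampenDiagram.IsEdgeHomotopy.isShell h5 h6 h7 (fun x s t hst => ?_) hp hq
          (by rw [h2]; exact (hword g).2.1) (by rw [h4]; exact (hword _).2.1) h8 h9
        rw [← h10, ← h10]
        exact ht _ s t hst
      · rw [← h10]
        congr 2
        exact Subtype.ext (TwoComplex.onEdge_zero (K := P.cayley) (g, a))
      · rw [← h10]
        congr 2
        exact Subtype.ext (TwoComplex.onEdge_one (K := P.cayley) (g, a))) w hne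
  rw [hw, hw1] at hpl
  obtain rfl : p = [] := List.map_eq_nil_iff.1 hpl
  obtain rfl : Δ.bdry = b := by simpa [TwoComplex.revPath] using hb
  obtain rfl : w' = w := Δ.bdry_label.symm.trans hbl
  exact ⟨Δ, hS.exists_isVanKampenHomotopy hf
    (fun h => hne (by rw [← Δ.bdry_label, h]; rfl))
    (fun q hq => hlow _ (Δ.cell.map_skeletonOne hq))⟩

end TameFilling

theorem proposition3p3 {G A : Type*} [Group G] [Finite A]
    (P : TameFilling.SymmetrizedPresentation G A)
    (f : TameFilling.QuarterNat → TameFilling.QuarterNat) (hf : Monotone f) :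
    List.TFAE
      [TameFilling.UpToLipschitz (TameFilling.ExtrinsicTameFilling P) f,
       TameFilling.UpToLipschitz (TameFilling.ExtrinsicRelaxedTameFilling P) f,
       TameFilling.UpToLipschitz (TameFilling.ExtrinsicGeodesicTameNormal P) f,
       TameFilling.UpToLipschitz (TameFilling.ExtrinsicTameNormal P) f,
       TameFilling.UpToLipschitz (TameFilling.RadialTameCombing P) f] := by
  tfae_have 1 → 2 := fun ⟨g, h1, h2, h3⟩ => ⟨g, h1, h2, h3.relaxed⟩
  -- Only this implication and the closing one change the tameness function, by the constants 8 and
  -- 4; the others keep it.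
  tfae_have 2 → 3 := TameFilling.UpToLipschitz.imp hf 8 fun g hg h => h.geodesicNormal hg
  tfae_have 3 → 4 := fun ⟨g, h1, h2, h3⟩ => ⟨g, h1, h2, h3.tameNormal⟩
  tfae_have 4 → 5 := fun ⟨g, h1, h2, h3⟩ => ⟨g, h1, h2, h3.radial⟩
  tfae_have 5 → 1 := TameFilling.UpToLipschitz.imp hf 4 fun g hg h => h.tameFilling hg
  tfae_finish
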